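/- Let $(M_i^{m_i},g_i)$ and $(N_i^{n_i},g_i')$, $i=1,2$, be Riemannian manifolds (smooth, without boundary, $M_1$ and $M_2$ nonempty) with $n_1<m_1$ and $n_2<m_2$. Let $f:M_1\to(0,\infty)$ and $\rho:N_1\to(0,\infty)$ be smooth, and let $M=M_1\times_f M_2$ be the product $M_1\times M_2$ with the warped product metric $g=g_1+f^2g_2$, and similarly $N=N_1\times_\rho N_2$. Let $\phi=(\phi_1,\phi_2):M\to N$, $\phi(p_1,p_2)=(\phi_1(p_1),\phi_2(p_2))$, be a Riemannian warped product submersion, i.e. $\phi_1:M_1\to N_1$ and $\phi_2:M_2\to N_2$ are Riemannian submersions (smooth, onto, with surjective derivatives which preserve the lengths of horizontal vectors) and $f=\rho\circ\phi_1$. Assume that the fibers of $\phi$ are connected, and let $\psi:M\to\mathbb R$ be smooth. For a Riemannian submersion with vertical spaces $\mathcal V_p=\ker\phi_{*p}$, horizontal spaces $\mathcal H_p=\mathcal V_p^\perp$, orthogonal projections $\mathcal V,\mathcal H$ and Levi-Civita connection $\nabla$, put $T_EF=\mathcal H\nabla_{\mathcal VE}\mathcal VF+\mathcal V\nabla_{\mathcal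 VE}\mathcal HF$. The mean curvature vector field of the fibers is $H=\frac1k\sum_{i=1}^kT_{U_i}U_i$ for orthonormal bases $U_1,\dots,U_k$ of the vertical spaces; the fibers are totally umbilical if $T_UW=g(U,W)H$ for all vertical $U,W$, and totally geodesic if $T=0$. The submersion $\phi$ is called Clairaut with $r=e^\psi$ if for every nonconstant geodesic $c$ of $M$ the function $(r\circ c)\sin\omega$ is constant, where $\omega(t)\in[0,\frac\pi2]$ is the angle between $\dot c(t)$ and the horizontal space of $\phi$ at $c(t)$. Then $\phi$ is Clairaut with $r=e^\psi$ if and only if the following three conditions hold: 1. $\nabla\psi$ (the gradient on $M$) is horizontal; 2. the fibers of $\phi_1$ are totally umbilical, and their mean curvature vector field $H_1$ satisfies $H_1=-\nabla\psi=-\nabla\ln f$; that is, $\nabla\psi$ at each $(p_1,p_2)\in M$ is tangent to $M_1\times\{p_2\}$ and equals there $-H_1(p_1)$, and $H_1=-\nabla\ln f$ on $(M_1,g_1)$; 3. the fibers of $\phi_2$ are totally geodesic. -/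

import Mathlib

open Set Filter Topology Manifold Bundle
open scoped ContDiff

noncomputable section

namespace Clairaut

/-! ### Riemannian metrics, gradient, Levi-Civita connection, geodesics

Throughout, `M` is a finite dimensional smooth manifold without boundary, modelled on `I`. -/

section Riemannian

/-- The pullback `(v, w) ↦ B(L v, L w)` of a bilinear form `B` by a linear map `L`. -/
def pullbackForm {V W : Type*} [AddCommGroup V] [Module ℝ V] [TopologicalSpace V]
    [AddCommGroup W] [Module ℝ W] [TopologicalSpace W] (B : W →L[ℝ] W →L[ℝ] ℝ) (L : V →L[ℝ] W) :
    V →L[ℝ] V →L[ℝ] ℝ :=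
  (ContinuousLinearMap.precomp ℝ L) ∘L B ∘L L

@[simp]
lemma pullbackForm_apply {V W : Type*} [AddCommGroup V] [Module ℝ V] [TopologicalSpace V]
    [AddCommGroup W] [Module ℝ W] [TopologicalSpace W] (B : W →L[ℝ] W →L[ℝ] ℝ) (L : V →L[ℝ] W)
    (v w : V) : pullbackForm B L v w = B (L v) (L w) := rfl

variable {E : Type*} [NormedAddCommGroup E] [NormedSpace ℝ E]
  {H : Type*} [TopologicalSpace H] {I : ModelWithCorners ℝ E H}
  {M : Type*} [TopologicalSpace M] [ChartedSpace H M] [IsManifold I ∞ M]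

variable (I M) in
/-- Smooth Riemannian metrics on the manifold `M`. -/
abbrev Metric : Type _ :=
  ContMDiffRiemannianMetric I ∞ E (fun x : M ↦ TangentSpace I x)

/-- The length `√g(v, v)` of a tangent vector. -/
def length (g : Metric I M) {p : M} (v : TangentSpace I p) : ℝ :=
  √(g.inner p v v)

/-- The gradient of `ψ`: the tangent vector `∇ψ` with `g(∇ψ, v) = dψ(v)` for all `v`. -/
def grad (g : Metric I M) (ψ : M → ℝ) (p : M) : TangentSpace I p :=
  (g.inner p).inverse (mvfderiv I ψ p)

/-- The metric written in the chart of the atlas around `x₀`: at the point of the model space with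
coordinates `u`, the value on `a`, `b` is `∑ g_ij(u) a^i b^j`. -/
def chartMetric (g : Metric I M) (x₀ : M) (u : E) : E →L[ℝ] E →L[ℝ] ℝ :=
  letI D : E →L[ℝ] TangentSpace I ((extChartAt I x₀).symm u) :=
    mfderiv 𝓘(ℝ, E) I (extChartAt I x₀).symm u
  pullbackForm (g.inner ((extChartAt I x₀).symm u)) D

/-- The Christoffel symbols in the chart around `x₀`, at the point with coordinates `u`:
`∑ Γ^k_ij a^i b^j ∂_k = ∑ ½ g^kl (∂_i g_jl + ∂_j g_il - ∂_l g_ij) a^i b^j ∂_k`. -/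
def christoffel (g : Metric I M) (x₀ : M) (u a b : E) : E :=
  (chartMetric g x₀ u).inverse
    ((1 / 2 : ℝ) • (fderiv ℝ (chartMetric g x₀) u a b + fderiv ℝ (chartMetric g x₀) u b a
      - ((fderiv ℝ (chartMetric g x₀) u).flip a).flip b))

/-- The Levi-Civita connection: `covDeriv g Y p v` is `∇_v Y` at `p`. It is computed in the chart of
the atlas around `p`, as `∑ (v(Y^k) + Γ^k_ij v^i Y^j) ∂_k`. The coordinate vectors
`∂_k` of that chart give the identification of the tangent space at `p` with the model vector space
which is built in `TangentSpace I p`. -/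
def covDeriv (g : Metric I M) (Y : Π x : M, TangentSpace I x) (p : M) (v : TangentSpace I p) :
    TangentSpace I p :=
  letI Yloc : E → E := VectorField.mpullback 𝓘(ℝ, E) I (extChartAt I p).symm Y
  (fderiv ℝ Yloc (extChartAt I p p) v + christoffel g p (extChartAt I p p) v (Y p) : E)

/-- The velocity of a curve. -/
def velocity (I : ModelWithCorners ℝ E H) (c : ℝ → M) (t : ℝ) : TangentSpace I (c t) :=
  mfderiv 𝓘(ℝ, ℝ) I c t (1 : ℝ)

/-- `c` is a geodesic on the open set `s` of times: in all the charts of the atlas it satisfies the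
geodesic equation `ü^k + Γ^k_ij u̇^i u̇^j = 0`. (Smoothness of `c` is then automatic.) -/
def IsGeodesicOn (g : Metric I M) (c : ℝ → M) (s : Set ℝ) : Prop :=
  ContMDiffOn 𝓘(ℝ, ℝ) I 2 c s ∧
    ∀ x₀ : M, ∀ t ∈ s, c t ∈ (chartAt H x₀).source →
      letI u : ℝ → E := fun τ ↦ extChartAt I x₀ (c τ)
      deriv (deriv u) t + christoffel g x₀ (u t) (deriv u t) (deriv u t) = 0

end Riemannian

/-! ### Riemannian submersions, the tensor `T`, the geometry of the fibers, Clairaut condition -/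

section Submersion

variable {E : Type*} [NormedAddCommGroup E] [NormedSpace ℝ E] [FiniteDimensional ℝ E]
  {H : Type*} [TopologicalSpace H] {I : ModelWithCorners ℝ E H}
  {M : Type*} [TopologicalSpace M] [ChartedSpace H M] [IsManifold I ∞ M]
  {E' : Type*} [NormedAddCommGroup E'] [NormedSpace ℝ E']
  {H' : Type*} [TopologicalSpace H'] (I' : ModelWithCorners ℝ E' H')
  {N : Type*} [TopologicalSpace N] [ChartedSpace H' N]

/-- The vertical space at `p`: the kernel of the derivative of `φ`. -/
def vertical (I : ModelWithCorners ℝ E H) (I' : ModelWithCorners ℝ E' H') (φ : M → N) (p : M) :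
    Submodule ℝ (TangentSpace I p) :=
  LinearMap.ker (mfderiv I I' φ p).toLinearMap

/-- The horizontal space at `p`: the orthogonal complement of the vertical space. -/
def horizontal (g : Metric I M) (φ : M → N) (p : M) : Submodule ℝ (TangentSpace I p) where
  carrier := {v | ∀ u ∈ vertical I I' φ p, g.inner p u v = 0}
  add_mem' ha hb u hu := by simp [ha u hu, hb u hu]
  zero_mem' u _ := by simp
  smul_mem' c v hv u hu := by simp [hv u hu]

lemma exists_orthonormal_basis (g : Metric I M) (p : M) (W : Submodule ℝ (TangentSpace I p)) :
    ∃ b : Module.Basis (Fin (Module.finrank ℝ W)) ℝ W,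
      ∀ i j, g.inner p (b i) (b j) = if i = j then 1 else 0 := by
  have : FiniteDimensional ℝ (TangentSpace I p) := inferInstanceAs (FiniteDimensional ℝ E)
  let core := g.toRiemannianMetric.toCore p
  let i1 : NormedAddCommGroup (TangentSpace I p) := core.toNormedAddCommGroup
  let i2 : InnerProductSpace ℝ (TangentSpace I p) := InnerProductSpace.ofCore core.toCore
  let b := stdOrthonormalBasis ℝ W
  refine ⟨b.toBasis, fun i j ↦ ?_⟩
  have := orthonormal_iff_ite.1 b.orthonormal i j
  simpa using! this

lemma isCompl_vertical_horizontal (g : Metric I M) (φ : M → N) (p : M) :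
    IsCompl (vertical I I' φ p) (horizontal I' g φ p) := by
  obtain ⟨b, hb⟩ := exists_orthonormal_basis g p (vertical I I' φ p)
  rw [isCompl_iff, Submodule.disjoint_def, codisjoint_iff, Submodule.eq_top_iff']
  refine ⟨fun v hv hv' ↦ ?_, fun v ↦ ?_⟩
  · by_contra h
    exact (g.pos p v h).ne' (hv' v hv)
  · rw [Submodule.mem_sup]
    let w : vertical I I' φ p := ∑ i, g.inner p (b i) v • b i
    refine ⟨w, w.2, v - w, fun u hu ↦ ?_, by abel⟩
    have hbi : ∀ i, g.inner p (b i) (v - w) = 0 := by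
      intro i
      simp [w, hb]
    have : (⟨u, hu⟩ : vertical I I' φ p) = ∑ i, b.repr ⟨u, hu⟩ i • b i := (b.sum_repr _).symm
    have h2 : u = ∑ i, b.repr ⟨u, hu⟩ i • (b i : TangentSpace I p) := by
      have h3 := congrArg Subtype.val this
      rw [AddSubmonoidClass.coe_finsetSum] at h3
      exact h3
    rw [h2]
    simp only [map_sum, map_smul, sum_apply, smul_apply,
      hbi, smul_zero, Finset.sum_const_zero]

/-- The orthogonal projection of a tangent vector to the vertical space. -/
def vertProj (g : Metric I M) (φ : M → N) (p : M) : TangentSpace I p →ₗ[ℝ] TangentSpace I p :=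
  Submodule.projection _ _ (isCompl_vertical_horizontal I' g φ p)

/-- The orthogonal projection of a tangent vector to the horizontal space. -/
def horProj (g : Metric I M) (φ : M → N) (p : M) : TangentSpace I p →ₗ[ℝ] TangentSpace I p :=
  Submodule.projection _ _ (isCompl_vertical_horizontal I' g φ p).symm

/-- O'Neill's fundamental tensor `T_X Y = 𝓗 ∇_{𝓥X} 𝓥Y + 𝓥 ∇_{𝓥X} 𝓗Y`, on vector fields. -/
def oneillT (g : Metric I M) (φ : M → N) (X Y : Π x : M, TangentSpace I x) (p : M) :
    TangentSpace I p :=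
  horProj I' g φ p
      (covDeriv g (fun x ↦ vertProj I' g φ x (Y x)) p (vertProj I' g φ p (X p)))
    + vertProj I' g φ p
      (covDeriv g (fun x ↦ horProj I' g φ x (Y x)) p (vertProj I' g φ p (X p)))

/-- The tensor `T` on tangent vectors at `p`, through extensions to vector fields (which are smooth
near `p`). -/
def oneillTAt (g : Metric I M) (φ : M → N) (p : M) (v w : TangentSpace I p) : TangentSpace I p :=
  oneillT I' g φ (FiberBundle.extend E v) (FiberBundle.extend E w) p

/-- The mean curvature vector field of the fibers of `φ`: the horizontal vector field
`(1 / k) ∑ T_{U_i} U_i`, where `U_1, …, U_k` is an orthonormal basis of the vertical space. -/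
def meanCurvature (g : Metric I M) (φ : M → N) (p : M) : TangentSpace I p :=
  letI b := (exists_orthonormal_basis g p (vertical I I' φ p)).choose
  (Module.finrank ℝ (vertical I I' φ p) : ℝ)⁻¹ • ∑ i, oneillTAt I' g φ p (b i) (b i)

/-- The fibers of `φ` are totally umbilical: `T_U W = g(U, W) H` for vertical `U`, `W`. -/
def HasTotallyUmbilicalFibers (g : Metric I M) (φ : M → N) : Prop :=
  ∀ p : M, ∀ u ∈ vertical I I' φ p, ∀ w ∈ vertical I I' φ p,
    oneillTAt I' g φ p u w = g.inner p u w • meanCurvature I' g φ p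

/-- The fibers of `φ` are totally geodesic: `T` vanishes identically. -/
def HasTotallyGeodesicFibers (g : Metric I M) (φ : M → N) : Prop :=
  ∀ p : M, ∀ v w : TangentSpace I p, oneillTAt I' g φ p v w = 0

/-- The angle in `[0, π/2]` between a nonzero tangent vector `v` and the horizontal space. -/
def angleToHorizontal (g : Metric I M) (φ : M → N) {p : M} (v : TangentSpace I p) : ℝ :=
  Real.arccos (length g (horProj I' g φ p v) / length g v)

/-- The Clairaut condition for `φ` with the function `r > 0`: along any (nonconstant) geodesic `c`,
defined on an open interval, `(r ∘ c) sin ω` is constant, where `ω(t)` is the angle between the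
velocity of `c` and the horizontal space at `c(t)`. -/
def IsClairautWith (g : Metric I M) (φ : M → N) (r : M → ℝ) : Prop :=
  (∀ p, 0 < r p) ∧
  ∀ (c : ℝ → M) (s : Set ℝ), IsOpen s → s.OrdConnected → IsGeodesicOn g c s →
    (∀ t ∈ s, velocity I c t ≠ 0) →
    ∀ t₁ ∈ s, ∀ t₂ ∈ s,
      r (c t₁) * Real.sin (angleToHorizontal I' g φ (velocity I c t₁)) =
        r (c t₂) * Real.sin (angleToHorizontal I' g φ (velocity I c t₂))

/-- Riemannian submersions: smooth, onto, with surjective derivatives preserving the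
lengths of horizontal vectors. -/
structure IsRiemannianSubmersion {I' : ModelWithCorners ℝ E' H'} [IsManifold I' ∞ N]
    (g : Metric I M) (g' : Metric I' N) (φ : M → N) : Prop where
  contMDiff : ContMDiff I I' ∞ φ
  surjective : Function.Surjective φ
  mfderiv_surjective : ∀ p, Function.Surjective (mfderiv I I' φ p)
  length_eq : ∀ p, ∀ v ∈ horizontal I' g φ p, length g' (mfderiv I I' φ p v) = length g v

end Submersion

/-! ### Warped products -/

section Warped

set_option linter.unusedSectionVars false

/-- Warping functions: smooth positive functions on a manifold. -/
structure WarpingFunction {E : Type*} [NormedAddCommGroup E] [NormedSpace ℝ E]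
    {H : Type*} [TopologicalSpace H] (I : ModelWithCorners ℝ E H)
    (M : Type*) [TopologicalSpace M] [ChartedSpace H M] where
  /-- the underlying function -/
  toFun : M → ℝ
  contMDiff : ContMDiff I 𝓘(ℝ, ℝ) ∞ toFun
  pos : ∀ x, 0 < toFun x

variable
  {E₁ : Type*} [NormedAddCommGroup E₁] [NormedSpace ℝ E₁] [FiniteDimensional ℝ E₁]
  {H₁ : Type*} [TopologicalSpace H₁] {I₁ : ModelWithCorners ℝ E₁ H₁}
  {M₁ : Type*} [TopologicalSpace M₁] [ChartedSpace H₁ M₁] [IsManifold I₁ ∞ M₁]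
  {E₂ : Type*} [NormedAddCommGroup E₂] [NormedSpace ℝ E₂] [FiniteDimensional ℝ E₂]
  {H₂ : Type*} [TopologicalSpace H₂] {I₂ : ModelWithCorners ℝ E₂ H₂}
  {M₂ : Type*} [TopologicalSpace M₂] [ChartedSpace H₂ M₂] [IsManifold I₂ ∞ M₂]

/-- The bilinear form `g₁ + f² g₂` on the tangent spaces of `M₁ × M₂`, i.e.
`g(v, w) = g₁(dπ₁ v, dπ₁ w) + f(π₁ p)² g₂(dπ₂ v, dπ₂ w)`. -/
def warpedInner (g₁ : Metric I₁ M₁) (g₂ : Metric I₂ M₂) (f : WarpingFunction I₁ M₁)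
    (p : M₁ × M₂) :
    TangentSpace (I₁.prod I₂) p →L[ℝ] TangentSpace (I₁.prod I₂) p →L[ℝ] ℝ :=
  pullbackForm (g₁.inner p.1) (mfderiv (I₁.prod I₂) I₁ Prod.fst p)
    + (f.toFun p.1 ^ 2) • pullbackForm (g₂.inner p.2) (mfderiv (I₁.prod I₂) I₂ Prod.snd p)

lemma warpedInner_apply (g₁ : Metric I₁ M₁) (g₂ : Metric I₂ M₂) (f : WarpingFunction I₁ M₁)
    (p : M₁ × M₂) (v w : TangentSpace (I₁.prod I₂) p) :
    warpedInner g₁ g₂ f p v w = g₁.inner p.1 v.1 w.1 + f.toFun p.1 ^ 2 * g₂.inner p.2 v.2 w.2 := by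
  simp [warpedInner, mfderiv_fst, mfderiv_snd]
  rfl

lemma isVonNBounded_warpedInner (g₁ : Metric I₁ M₁) (g₂ : Metric I₂ M₂) (f : WarpingFunction I₁ M₁)
    (p : M₁ × M₂) :
    Bornology.IsVonNBounded ℝ {v : TangentSpace (I₁.prod I₂) p | warpedInner g₁ g₂ f p v v < 1} := by
  have h₁ : Bornology.IsVonNBounded ℝ {v : E₁ | g₁.inner p.1 v v < 1} := g₁.isVonNBounded p.1
  have h₂ : Bornology.IsVonNBounded ℝ {v : E₂ | g₂.inner p.2 v v < 1} := g₂.isVonNBounded p.2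
  change Bornology.IsVonNBounded ℝ {v : E₁ × E₂ | warpedInner g₁ g₂ f p v v < 1}
  rw [NormedSpace.isVonNBounded_iff, isBounded_iff_forall_norm_le] at h₁ h₂ ⊢
  obtain ⟨C₁, hC₁⟩ := h₁
  obtain ⟨C₂, hC₂⟩ := h₂
  have hf := f.pos p.1
  have pos₁ : ∀ v : E₁, 0 ≤ g₁.inner p.1 v v := fun v ↦ by
    rcases eq_or_ne v 0 with rfl | h
    · exact (map_zero (g₁.inner p.1 (0 : TangentSpace I₁ p.1))).ge
    · exact (g₁.pos p.1 v h).le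
  have pos₂ : ∀ v : E₂, 0 ≤ g₂.inner p.2 v v := fun v ↦ by
    rcases eq_or_ne v 0 with rfl | h
    · exact (map_zero (g₂.inner p.2 (0 : TangentSpace I₂ p.2))).ge
    · exact (g₂.pos p.2 v h).le
  refine ⟨max C₁ (C₂ / f.toFun p.1), fun v hv ↦ ?_⟩
  have hv' : g₁.inner p.1 v.1 v.1 + f.toFun p.1 ^ 2 * g₂.inner p.2 v.2 v.2 < 1 :=
    lt_of_eq_of_lt (warpedInner_apply g₁ g₂ f p v v).symm hv
  have a₁ := pos₁ v.1
  have a₂ := mul_nonneg (sq_nonneg (f.toFun p.1)) (pos₂ v.2)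
  have b₁ : ‖v.1‖ ≤ C₁ := hC₁ v.1 (show g₁.inner p.1 v.1 v.1 < 1 by linarith)
  have b₂ : ‖f.toFun p.1 • v.2‖ ≤ C₂ := by
    refine hC₂ _ ?_
    have : g₂.inner p.2 (f.toFun p.1 • v.2 : E₂) (f.toFun p.1 • v.2 : E₂)
        = f.toFun p.1 ^ 2 * g₂.inner p.2 v.2 v.2 := by
      have e := (g₂.inner p.2).map_smul (f.toFun p.1) v.2
      have e' := (g₂.inner p.2 v.2).map_smul (f.toFun p.1) v.2
      calc _ = (f.toFun p.1 • g₂.inner p.2 v.2) (f.toFun p.1 • v.2 : E₂) :=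
            congrArg (fun L ↦ L (f.toFun p.1 • v.2 : E₂)) e
        _ = f.toFun p.1 * (g₂.inner p.2 v.2 (f.toFun p.1 • v.2 : E₂)) := rfl
        _ = f.toFun p.1 * (f.toFun p.1 * g₂.inner p.2 v.2 v.2) := congrArg _ e'
        _ = _ := by ring
    show g₂.inner p.2 (f.toFun p.1 • v.2 : E₂) (f.toFun p.1 • v.2 : E₂) < 1
    rw [this]; linarith
  rw [norm_smul, Real.norm_eq_abs, abs_of_pos hf] at b₂
  exact max_le_max b₁ ((le_div_iff₀' hf).2 b₂)

/-- A field of bilinear forms is smooth at `p` as soon as its values on extensions of tangent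
vectors at `p` are. -/
lemma contMDiffAt_bilin_of_extend {B : Π x : M₁, TangentSpace I₁ x →L[ℝ] TangentSpace I₁ x →L[ℝ] ℝ}
    {p : M₁}
    (h : ∀ v w : TangentSpace I₁ p, ContMDiffAt I₁ 𝓘(ℝ, ℝ) ∞ (fun x ↦
      B x (FiberBundle.extend E₁ v x) (FiberBundle.extend E₁ w x)) p) :
    ContMDiffAt I₁ (I₁.prod 𝓘(ℝ, E₁ →L[ℝ] E₁ →L[ℝ] ℝ)) ∞
      (fun x ↦ TotalSpace.mk' (E₁ →L[ℝ] E₁ →L[ℝ] ℝ) x (B x)) p := by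
  rw [contMDiffAt_hom_bundle]
  refine ⟨contMDiffAt_id, ?_⟩
  let t := trivializationAt E₁ (TangentSpace I₁ : M₁ → Type _) p
  have hp : p ∈ t.baseSet := FiberBundle.mem_baseSet_trivializationAt' p
  let A : M₁ → E₁ →L[ℝ] E₁ →L[ℝ] ℝ := fun x ↦
    ContinuousLinearMap.inCoordinates E₁ (TangentSpace I₁ : M₁ → Type _) (E₁ →L[ℝ] ℝ)
      (fun x ↦ TangentSpace I₁ x →L[ℝ] ℝ) p x p x (B x)
  change ContMDiffAt I₁ 𝓘(ℝ, E₁ →L[ℝ] E₁ →L[ℝ] ℝ) ∞ A p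
  have hA : ∀ a b : E₁, ContMDiffAt I₁ 𝓘(ℝ, ℝ) ∞ (fun x ↦ A x a b) p := by
    intro a b
    refine (h (t.symm p a) (t.symm p b)).congr_of_eventuallyEq ?_
    filter_upwards [t.open_baseSet.mem_nhds hp] with x hx
    have := inCoordinates_apply_eq₂ (F₁ := E₁) (F₂ := E₁) (F₃ := ℝ)
      (E₁ := (TangentSpace I₁ : M₁ → Type _)) (E₂ := (TangentSpace I₁ : M₁ → Type _))
      (E₃ := fun _ ↦ ℝ) (x₀ := p) (x := x) (ϕ := B x) (v := a) (w := b) hx hx (mem_univ _)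
    refine this.trans ?_
    have e : ∀ a : E₁, (t ⟨p, t.symm p a⟩).2 = a := fun a ↦ by
      rw [Trivialization.apply_mk_symm t hp]
    simp only [FiberBundle.extend]
    rw [e a, e b]
    simp
  let b := Module.finBasis ℝ E₁
  have hsum : A = fun x ↦ ∑ i, ∑ j, A x (b i) (b j) •
      ((LinearMap.toContinuousLinearMap (b.coord i)).smulRight
        (LinearMap.toContinuousLinearMap (b.coord j)) : E₁ →L[ℝ] E₁ →L[ℝ] ℝ) := by
    funext x
    ext v w
    conv_lhs => rw [← b.sum_repr v, ← b.sum_repr w]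
    simp only [map_sum, map_smul, sum_apply, smul_apply, smul_eq_mul, Finset.mul_sum,
      ContinuousLinearMap.smulRight_apply, LinearMap.coe_toContinuousLinearMap', Module.Basis.coord_apply]
    rw [Finset.sum_comm]
    refine Finset.sum_congr rfl fun i _ ↦ Finset.sum_congr rfl fun j _ ↦ by ring
  rw [hsum]
  exact ContMDiffAt.sum fun i _ ↦ ContMDiffAt.sum fun j _ ↦
    (hA (b i) (b j)).smul contMDiffAt_const

lemma contMDiff_warpedInner (g₁ : Metric I₁ M₁) (g₂ : Metric I₂ M₂) (f : WarpingFunction I₁ M₁) :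
    ContMDiff (I₁.prod I₂) ((I₁.prod I₂).prod 𝓘(ℝ, E₁ × E₂ →L[ℝ] E₁ × E₂ →L[ℝ] ℝ)) ∞
      (fun p ↦ TotalSpace.mk' (E₁ × E₂ →L[ℝ] E₁ × E₂ →L[ℝ] ℝ) p (warpedInner g₁ g₂ f p)) := by
  intro p
  apply contMDiffAt_bilin_of_extend
  intro v w
  have ext_smooth : ∀ v : TangentSpace (I₁.prod I₂) p, ContMDiffAt (I₁.prod I₂)
      (I₁.prod I₂).tangent ∞ (fun q ↦ (⟨q, FiberBundle.extend (E₁ × E₂) v q⟩ :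
        TangentBundle (I₁.prod I₂) (M₁ × M₂))) p :=
    fun v ↦ FiberBundle.contMDiffAt_extend (I₁.prod I₂) (E₁ × E₂) v
  have h₁ : ∀ v : TangentSpace (I₁.prod I₂) p, ContMDiffAt (I₁.prod I₂) I₁.tangent ∞
      (fun q ↦ (TotalSpace.mk' E₁ q.1 (mfderiv (I₁.prod I₂) I₁ Prod.fst q
        (FiberBundle.extend (E₁ × E₂) v q)) : TangentBundle I₁ M₁)) p := fun v ↦
    ((contMDiff_fst (I := I₁) (J := I₂) (M := M₁) (N := M₂)
      (n := ∞)).contMDiff_tangentMap (m := ∞) le_rfl).contMDiffAt.comp p (ext_smooth v)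
  have h₂ : ∀ v : TangentSpace (I₁.prod I₂) p, ContMDiffAt (I₁.prod I₂) I₂.tangent ∞
      (fun q ↦ (TotalSpace.mk' E₂ q.2 (mfderiv (I₁.prod I₂) I₂ Prod.snd q
        (FiberBundle.extend (E₁ × E₂) v q)) : TangentBundle I₂ M₂)) p := fun v ↦
    ((contMDiff_snd (I := I₁) (J := I₂) (M := M₁) (N := M₂)
      (n := ∞)).contMDiff_tangentMap (m := ∞) le_rfl).contMDiffAt.comp p (ext_smooth v)
  have k₁ := ContMDiffAt.clm_bundle_apply₂ (F₁ := E₁) (F₂ := E₁) (F₃ := ℝ)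
    (E₁ := (TangentSpace I₁ : M₁ → Type _)) (E₂ := (TangentSpace I₁ : M₁ → Type _))
    (E₃ := fun _ ↦ ℝ) (b := fun q : M₁ × M₂ ↦ q.1) (ψ := fun q ↦ g₁.inner q.1)
    (g₁.contMDiff.contMDiffAt.comp p contMDiffAt_fst) (h₁ v) (h₁ w)
  have k₂ := ContMDiffAt.clm_bundle_apply₂ (F₁ := E₂) (F₂ := E₂) (F₃ := ℝ)
    (E₁ := (TangentSpace I₂ : M₂ → Type _)) (E₂ := (TangentSpace I₂ : M₂ → Type _))
    (E₃ := fun _ ↦ ℝ) (b := fun q : M₁ × M₂ ↦ q.2) (ψ := fun q ↦ g₂.inner q.2)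
    (g₂.contMDiff.contMDiffAt.comp p contMDiffAt_snd) (h₂ v) (h₂ w)
  rw [contMDiffAt_totalSpace] at k₁ k₂
  have hf : ContMDiffAt (I₁.prod I₂) 𝓘(ℝ, ℝ) ∞ (fun q : M₁ × M₂ ↦ f.toFun q.1) p :=
    f.contMDiff.contMDiffAt.comp p contMDiffAt_fst
  exact k₁.2.add ((hf.pow 2).mul k₂.2)

/-- The warped product metric `g₁ + f² g₂` on `M₁ × M₂`. -/
def warpedMetric (g₁ : Metric I₁ M₁) (g₂ : Metric I₂ M₂) (f : WarpingFunction I₁ M₁) :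
    Metric (I₁.prod I₂) (M₁ × M₂) where
  inner := warpedInner g₁ g₂ f
  symm p v w :=
    (warpedInner_apply g₁ g₂ f p v w).trans ((congrArg₂ (· + ·) (g₁.symm p.1 v.1 w.1)
      (congrArg (f.toFun p.1 ^ 2 * ·) (g₂.symm p.2 v.2 w.2))).trans
        (warpedInner_apply g₁ g₂ f p w v).symm)
  pos p v hv := by
    rw [warpedInner_apply]
    have hf := pow_pos (f.pos p.1) 2
    have pos₁ : ∀ v : TangentSpace I₁ p.1, 0 ≤ g₁.inner p.1 v v := fun v ↦ by
      rcases eq_or_ne v 0 with rfl | h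
      · exact (map_zero (g₁.inner p.1 (0 : TangentSpace I₁ p.1))).ge
      · exact (g₁.pos p.1 v h).le
    have pos₂ : ∀ v : TangentSpace I₂ p.2, 0 ≤ g₂.inner p.2 v v := fun v ↦ by
      rcases eq_or_ne v 0 with rfl | h
      · exact (map_zero (g₂.inner p.2 (0 : TangentSpace I₂ p.2))).ge
      · exact (g₂.pos p.2 v h).le
    by_cases h : (v.1 : TangentSpace I₁ p.1) = 0
    · have h2 : (v.2 : TangentSpace I₂ p.2) ≠ 0 := fun h2 ↦ hv (Prod.ext h h2)
      exact add_pos_of_nonneg_of_pos (pos₁ v.1) (mul_pos hf (g₂.pos p.2 v.2 h2))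
    · exact add_pos_of_pos_of_nonneg (g₁.pos p.1 v.1 h) (mul_nonneg hf.le (pos₂ v.2))
  isVonNBounded := isVonNBounded_warpedInner g₁ g₂ f
  contMDiff := contMDiff_warpedInner g₁ g₂ f

/-- A tangent vector to `M₁` at `p.1`, seen as a tangent vector to `M₁ × M₂` at `p` which is tangent
to `M₁ × {p.2}`. -/
def liftLeft (p : M₁ × M₂) (v : TangentSpace I₁ p.1) : TangentSpace (I₁.prod I₂) p :=
  ((v, 0) : E₁ × E₂)

variable
  {E₁' : Type*} [NormedAddCommGroup E₁'] [NormedSpace ℝ E₁']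
  {H₁' : Type*} [TopologicalSpace H₁'] {I₁' : ModelWithCorners ℝ E₁' H₁'}
  {N₁ : Type*} [TopologicalSpace N₁] [ChartedSpace H₁' N₁] [IsManifold I₁' ∞ N₁]
  {E₂' : Type*} [NormedAddCommGroup E₂'] [NormedSpace ℝ E₂']
  {H₂' : Type*} [TopologicalSpace H₂'] {I₂' : ModelWithCorners ℝ E₂' H₂'}
  {N₂ : Type*} [TopologicalSpace N₂] [ChartedSpace H₂' N₂] [IsManifold I₂' ∞ N₂]

/-- The product map `φ = (φ₁, φ₂) : M₁ ×_f M₂ → N₁ ×_ρ N₂` is a Riemannian warped product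
submersion: `φ₁` and `φ₂` are Riemannian submersions and `f = ρ ∘ φ₁`. -/
structure IsRiemannianWarpedProductSubmersion
    (g₁ : Metric I₁ M₁) (g₂ : Metric I₂ M₂) (f : WarpingFunction I₁ M₁)
    (g₁' : Metric I₁' N₁) (g₂' : Metric I₂' N₂) (ρ : WarpingFunction I₁' N₁)
    (φ₁ : M₁ → N₁) (φ₂ : M₂ → N₂) : Prop where
  left : IsRiemannianSubmersion g₁ g₁' φ₁
  right : IsRiemannianSubmersion g₂ g₂' φ₂
  warping : ∀ x, f.toFun x = ρ.toFun (φ₁ x)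

end Warped

end Clairaut

end

/-!
# Clairaut warped product submersions

For a Riemannian submersion `φ`, the vertical part of the metric is the form `P = g - φ^* g'`
(`vertForm`), which is smooth, positive semidefinite, and null exactly on horizontal vectors. Along
a geodesic with velocity `v`, the quantity `(exp ψ sin ω)²` is `exp (2ψ) P(v, v) / g(v, v)`, and
`g(v, v)` is constant. So the Clairaut condition says that `exp (2ψ) P(v, v)` is constant along
geodesics. Write `v = U + X` with `U` vertical and `X` horizontal. The derivative of `P(v, v)` along
a geodesic is `2 g(T_U U, X)` (`IsRiemannianSubmersion.hasDerivAt_vertForm`), and as there are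
geodesics with any initial velocity (`exists_geodesic`), the Clairaut condition is equivalent to

  `g(T_U U, X) + dψ(U + X) g(U, U) = 0` for all vertical `U` and horizontal `X`,

which is `IsRiemannianSubmersion.isClairautWith_exp_iff`.

All computations are made in charts, with the Christoffel symbols of the first kind `firstKind` of
possibly degenerate fields of forms. Those of `P` at vertical, vertical, horizontal arguments are
the second fundamental form `g(T_U W, X)` of the fibers (`secondForm`). The computations rest on
three facts: the first-kind Christoffel symbols of `g` are the sum of those of `P` and of `φ^* g'`;
those of `φ^* g'` vanish when the last argument is vertical; the derivatives of a semidefinite form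
vanish at pairs of null vectors. The tensor `T` enters the proof only through
`inner_oneillTAt_horizontal` and `inner_oneillTAt_vertical`.

For a warped product submersion, `P = P₁ + f² P₂`, so that for `U = (u₁, u₂)` and `X = (x₁, x₂)`

  `g(T_U U, X) = g₁(T_{u₁} u₁, x₁) + f² (g₂(T_{u₂} u₂, x₂) - d(ln f)(x₁) g₂(u₂, u₂))`

(`IsRiemannianWarpedProductSubmersion.secondForm_tangentPair`). Since both factors have fibers of
positive dimension, the Clairaut condition can be tested with `u₁ ≠ 0 = u₂` and with
`u₁ = 0 ≠ u₂`. It splits into `dψ = d(ln f)`, `g₁(T_{u₁} u₁, x₁) = -g₁(u₁, u₁) d(ln f)(x₁)` and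
`g₂(T_{u₂} u₂, x₂) = 0` (`IsRiemannianWarpedProductSubmersion.isClairautWith_exp_iff_forall`). These
are the conditions on `∇ψ` and on the fibers of `φ₁` and `φ₂`; `∇ψ` is automatically horizontal
because `f = ρ ∘ φ₁` is constant along the fibers.
-/

set_option maxSynthPendingDepth 3
set_option linter.unusedSectionVars false

namespace Clairaut

/-! ### Fields of bilinear forms on a vector space -/

section FormFields

variable {E : Type*} [NormedAddCommGroup E] [NormedSpace ℝ E]
  {E' : Type*} [NormedAddCommGroup E'] [NormedSpace ℝ E']

/-- The Christoffel symbols of the first kind of a field `B` of bilinear forms, which may be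
degenerate: `½ (D_a B (b, w) + D_b B (a, w) - D_w B (a, b))` at the point `u`. -/
noncomputable def firstKind (B : E → E →L[ℝ] E →L[ℝ] ℝ) (u a b w : E) : ℝ :=
  1 / 2 * (fderiv ℝ B u a b w + fderiv ℝ B u b a w - fderiv ℝ B u w a b)

lemma isInvertible_of_posDef [FiniteDimensional ℝ E] (b : E →L[ℝ] E →L[ℝ] ℝ)
    (hb : ∀ v, v ≠ 0 → 0 < b v v) : b.IsInvertible := by
  have hinj : Function.Injective b.toLinearMap := by
    rw [injective_iff_map_eq_zero]
    intro v hv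
    by_contra h
    have h1 := hb v h
    have h2 : b v = 0 := hv
    rw [h2] at h1
    simp at h1
  have hdim : Module.finrank ℝ E = Module.finrank ℝ (E →L[ℝ] ℝ) := by
    rw [← (LinearMap.toContinuousLinearMap (𝕜 := ℝ) (E := E) (F' := ℝ)).finrank_eq]
    exact (Subspace.dual_finrank_eq (K := ℝ) (V := E)).symm
  exact ⟨(LinearEquiv.ofInjectiveOfFinrankEq b.toLinearMap hinj hdim).toContinuousLinearEquiv,
    by ext; rfl⟩

lemma apply_inverse_apply {b : E →L[ℝ] E →L[ℝ] ℝ} (hb : b.IsInvertible) (l : E →L[ℝ] ℝ) (w : E) :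
    b (b.inverse l) w = l w := by
  obtain ⟨e, rfl⟩ := hb
  simp

lemma contDiffAt_pullbackForm {n : WithTop ℕ∞} {A : E → E' →L[ℝ] E' →L[ℝ] ℝ} {L : E → E →L[ℝ] E'}
    {u : E} (hA : ContDiffAt ℝ n A u) (hL : ContDiffAt ℝ n L u) :
    ContDiffAt ℝ n (fun u ↦ pullbackForm (A u) (L u)) u := by
  unfold pullbackForm
  have h : ContDiffAt ℝ n (fun u ↦ ContinuousLinearMap.precomp (σ := RingHom.id ℝ) ℝ (L u)) u :=
    (ContinuousLinearMap.compL ℝ E E' ℝ).flip.contDiff.contDiffAt.comp u hL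
  exact h.clm_comp (hA.clm_comp hL)

/-- The derivative of a pullback `τ^* G` of a field of bilinear forms. -/
lemma fderiv_of_eventuallyEq_pullbackForm {G : E' → E' →L[ℝ] E' →L[ℝ] ℝ} {τ : E → E'}
    {B : E → E →L[ℝ] E →L[ℝ] ℝ} {u : E} (hτ : ContDiffAt ℝ 2 τ u)
    (hG : DifferentiableAt ℝ G (τ u))
    (hB : B =ᶠ[𝓝 u] fun x ↦ pullbackForm (G (τ x)) (fderiv ℝ τ x)) (c a b : E) :
    fderiv ℝ B u c a b = fderiv ℝ G (τ u) (fderiv ℝ τ u c) (fderiv ℝ τ u a) (fderiv ℝ τ u b)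
      + G (τ u) (fderiv ℝ (fderiv ℝ τ) u c a) (fderiv ℝ τ u b)
      + G (τ u) (fderiv ℝ τ u a) (fderiv ℝ (fderiv ℝ τ) u c b) := by
  have hτ1 : HasFDerivAt τ (fderiv ℝ τ u) u :=
    (hτ.differentiableAt (by norm_num)).hasFDerivAt
  have hτ2 : HasFDerivAt (fderiv ℝ τ) (fderiv ℝ (fderiv ℝ τ) u) u :=
    ((hτ.fderiv_right (m := 1) (by norm_num)).differentiableAt (by norm_num)).hasFDerivAt
  have hGτ : HasFDerivAt (fun x ↦ G (τ x)) (fderiv ℝ G (τ u) ∘L fderiv ℝ τ u) u :=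
    hG.hasFDerivAt.comp u hτ1
  have hsmooth : DifferentiableAt ℝ B u := by
    refine DifferentiableAt.congr_of_eventuallyEq ?_ hB
    unfold pullbackForm
    have h : DifferentiableAt ℝ
        (fun u ↦ ContinuousLinearMap.precomp (σ := RingHom.id ℝ) ℝ (fderiv ℝ τ u)) u :=
      (ContinuousLinearMap.compL ℝ E E' ℝ).flip.differentiableAt.comp u hτ2.differentiableAt
    exact h.clm_comp (hGτ.differentiableAt.clm_comp hτ2.differentiableAt)
  have h1 : HasFDerivAt (fun x ↦ B x a b) _ u :=
    (hsmooth.hasFDerivAt.clm_apply (hasFDerivAt_const a u)).clm_apply (hasFDerivAt_const b u)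
  have h2 : HasFDerivAt (fun x ↦ G (τ x) (fderiv ℝ τ x a) (fderiv ℝ τ x b)) _ u :=
    (hGτ.clm_apply (hτ2.clm_apply (hasFDerivAt_const a u))).clm_apply
      (hτ2.clm_apply (hasFDerivAt_const b u))
  have h3 : (fun x ↦ B x a b) =ᶠ[𝓝 u] fun x ↦ G (τ x) (fderiv ℝ τ x a) (fderiv ℝ τ x b) := by
    filter_upwards [hB] with x hx
    rw [hx, pullbackForm_apply]
  have h4 := congrArg (fun L : E →L[ℝ] ℝ ↦ L c) (h1.unique (h2.congr_of_eventuallyEq h3))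
  simp at h4
  linarith

/-- First-kind Christoffel symbols of a pullback. They vanish on `ker Dτ` in the last argument. -/
lemma firstKind_of_eventuallyEq_pullbackForm {G : E' → E' →L[ℝ] E' →L[ℝ] ℝ} {τ : E → E'}
    {B : E → E →L[ℝ] E →L[ℝ] ℝ} {u : E} (hτ : ContDiffAt ℝ 2 τ u)
    (hG : DifferentiableAt ℝ G (τ u)) (hsymm : ∀ a b, G (τ u) a b = G (τ u) b a)
    (hB : B =ᶠ[𝓝 u] fun x ↦ pullbackForm (G (τ x)) (fderiv ℝ τ x)) (a b w : E) :
    firstKind B u a b w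
      = firstKind G (τ u) (fderiv ℝ τ u a) (fderiv ℝ τ u b) (fderiv ℝ τ u w)
        + G (τ u) (fderiv ℝ (fderiv ℝ τ) u a b) (fderiv ℝ τ u w) := by
  have hs : ∀ x y, fderiv ℝ (fderiv ℝ τ) u x y = fderiv ℝ (fderiv ℝ τ) u y x :=
    (hτ.isSymmSndFDerivAt (by simp)).eq
  simp only [firstKind, fderiv_of_eventuallyEq_pullbackForm hτ hG hB]
  rw [hs b a, hs w a, hs w b, hsymm (fderiv ℝ τ u b), hsymm (fderiv ℝ τ u a)]
  ring

lemma firstKind_add {A B : E → E →L[ℝ] E →L[ℝ] ℝ} {u : E} (hA : DifferentiableAt ℝ A u)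
    (hB : DifferentiableAt ℝ B u) (a b w : E) :
    firstKind (fun x ↦ A x + B x) u a b w = firstKind A u a b w + firstKind B u a b w := by
  simp only [firstKind, fderiv_fun_add hA hB, add_apply]
  ring

lemma fderiv_symm_of_eventually {B : E → E →L[ℝ] E →L[ℝ] ℝ} {u : E} (hB : DifferentiableAt ℝ B u)
    (hsymm : ∀ᶠ x in 𝓝 u, ∀ a b, B x a b = B x b a) (c a b : E) :
    fderiv ℝ B u c a b = fderiv ℝ B u c b a := by
  have h : ∀ a b : E, HasFDerivAt (fun x ↦ B x a b) _ u := fun a b ↦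
    (hB.hasFDerivAt.clm_apply (hasFDerivAt_const a u)).clm_apply (hasFDerivAt_const b u)
  have h3 : (fun x ↦ B x a b) =ᶠ[𝓝 u] fun x ↦ B x b a := by
    filter_upwards [hsymm] with x hx using hx a b
  have h4 := congrArg (fun L : E →L[ℝ] ℝ ↦ L c) ((h a b).unique ((h b a).congr_of_eventuallyEq h3))
  simpa using h4

/-- A null vector of a semidefinite field of forms is a critical point of the field. -/
lemma fderiv_apply_self_eq_zero_of_null {P : E → E →L[ℝ] E →L[ℝ] ℝ} {u : E}
    (hP : DifferentiableAt ℝ P u) (hpos : ∀ᶠ x in 𝓝 u, ∀ a, 0 ≤ P x a a) {X : E}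
    (hX : P u X X = 0) (c : E) : fderiv ℝ P u c X X = 0 := by
  have h : HasFDerivAt (fun x ↦ P x X X) _ u :=
    (hP.hasFDerivAt.clm_apply (hasFDerivAt_const X u)).clm_apply (hasFDerivAt_const X u)
  have hmin : IsLocalMin (fun x ↦ P x X X) u := by
    filter_upwards [hpos] with x hx
    rw [hX]
    exact hx X
  have h4 := congrArg (fun L : E →L[ℝ] ℝ ↦ L c) (hmin.hasFDerivAt_eq_zero h)
  simpa using h4

lemma fderiv_apply_eq_zero_of_null {P : E → E →L[ℝ] E →L[ℝ] ℝ} {u : E}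
    (hP : DifferentiableAt ℝ P u) (hpos : ∀ᶠ x in 𝓝 u, ∀ a, 0 ≤ P x a a)
    (hsymm : ∀ᶠ x in 𝓝 u, ∀ a b, P x a b = P x b a) {X Y : E}
    (hX : P u X X = 0) (hY : P u Y Y = 0) (hXY : P u X Y = 0) (c : E) :
    fderiv ℝ P u c X Y = 0 := by
  have hYX : P u Y X = 0 := (hsymm.self_of_nhds Y X).trans hXY
  have h1 := fderiv_apply_self_eq_zero_of_null hP hpos hX c
  have h2 := fderiv_apply_self_eq_zero_of_null hP hpos hY c
  have h3 := fderiv_apply_self_eq_zero_of_null hP hpos (X := X + Y) (by simp [hX, hY, hXY, hYX]) c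
  have h4 := fderiv_symm_of_eventually hP hsymm c X Y
  simp only [map_add, add_apply] at h3
  linarith

/-- For a semidefinite field of forms, only the component of `v` transverse to the null directions
contributes to `firstKind P u v v X` for a null vector `X`. -/
lemma firstKind_add_null {P : E → E →L[ℝ] E →L[ℝ] ℝ} {u : E} (hP : DifferentiableAt ℝ P u)
    (hpos : ∀ᶠ x in 𝓝 u, ∀ a, 0 ≤ P x a a) (hsymm : ∀ᶠ x in 𝓝 u, ∀ a b, P x a b = P x b a)
    (U : E) {X : E} (hX : P u X X = 0) :
    firstKind P u (U + X) (U + X) X = firstKind P u U U X := by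
  have h : ∀ c, fderiv ℝ P u c X X = 0 := fderiv_apply_self_eq_zero_of_null hP hpos hX
  have h1 := fderiv_symm_of_eventually hP hsymm X X U
  simp only [firstKind, map_add, add_apply, h]
  linarith

lemma firstKind_add_add_self {P : E → E →L[ℝ] E →L[ℝ] ℝ} {u : E} (hP : DifferentiableAt ℝ P u)
    (hsymm : ∀ᶠ x in 𝓝 u, ∀ a b, P x a b = P x b a) (a b w : E) :
    firstKind P u (a + b) (a + b) w
      = firstKind P u a a w + 2 * firstKind P u a b w + firstKind P u b b w := by
  have h1 := fderiv_symm_of_eventually hP hsymm w a b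
  simp only [firstKind, map_add, add_apply]
  linarith

/-- The derivative of `B(u)(u', u')` along a curve. -/
lemma hasDerivAt_form_along {B : E → E →L[ℝ] E →L[ℝ] ℝ} {u v : ℝ → E} {a : E} {t : ℝ}
    (hB : DifferentiableAt ℝ B (u t)) (hsymm : ∀ a b, B (u t) a b = B (u t) b a)
    (hu : HasDerivAt u (v t) t) (hv : HasDerivAt v a t) :
    HasDerivAt (fun τ ↦ B (u τ) (v τ) (v τ))
      (2 * (firstKind B (u t) (v t) (v t) (v t) + B (u t) a (v t))) t := by
  have h1 : HasDerivAt (fun τ ↦ B (u τ)) (fderiv ℝ B (u t) (v t)) t :=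
    hB.hasFDerivAt.comp_hasDerivAt t hu
  convert! (h1.clm_apply hv).clm_apply hv using 1
  simp only [firstKind, add_apply]
  rw [hsymm (v t) a]
  ring

/-- Coordinate expression near `u` of a Riemannian submersion: `τ` is the map, `G` and `G'` are the
metrics, `B` is the pullback of `G'`, and `G - B` is positive semidefinite. The vertical vectors
at `u` are those in the kernel of `Dτ`. -/
structure IsLocalSubmersion (G B : E → E →L[ℝ] E →L[ℝ] ℝ) (G' : E' → E' →L[ℝ] E' →L[ℝ] ℝ)
    (τ : E → E') (u : E) : Prop where
  contDiffAt_map : ContDiffAt ℝ 2 τ u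
  differentiableAt_metric : DifferentiableAt ℝ G u
  differentiableAt_metric' : DifferentiableAt ℝ G' (τ u)
  pullback : B =ᶠ[𝓝 u] fun x ↦ pullbackForm (G' (τ x)) (fderiv ℝ τ x)
  differentiableAt_pullback : DifferentiableAt ℝ B u
  symm : ∀ᶠ x in 𝓝 u, ∀ a b, G x a b = G x b a
  symm_pullback : ∀ᶠ x in 𝓝 u, ∀ a b, B x a b = B x b a
  symm' : ∀ a b, G' (τ u) a b = G' (τ u) b a
  nonneg : ∀ᶠ x in 𝓝 u, ∀ a, 0 ≤ (G x - B x) a a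

namespace IsLocalSubmersion

variable {G B : E → E →L[ℝ] E →L[ℝ] ℝ} {G' : E' → E' →L[ℝ] E' →L[ℝ] ℝ} {τ : E → E'} {u : E}
  (h : IsLocalSubmersion G B G' τ u)

include h

lemma pullback_vertical {U : E} (hU : fderiv ℝ τ u U = 0) (b : E) : B u U b = 0 := by
  rw [h.pullback.self_of_nhds, pullbackForm_apply, hU]
  simp

lemma differentiableAt_sub : DifferentiableAt ℝ (fun x ↦ G x - B x) u :=
  h.differentiableAt_metric.sub h.differentiableAt_pullback

lemma symm_sub : ∀ᶠ x in 𝓝 u, ∀ a b, (G x - B x) a b = (G x - B x) b a := by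
  filter_upwards [h.symm, h.symm_pullback] with x h1 h2 a b
  rw [sub_apply, sub_apply, sub_apply, sub_apply, h1, h2]

lemma firstKind_metric (a b w : E) :
    firstKind G u a b w = firstKind (fun x ↦ G x - B x) u a b w + firstKind B u a b w := by
  rw [← firstKind_add h.differentiableAt_sub h.differentiableAt_pullback]
  simp only [sub_add_cancel]

lemma firstKind_pullback_vertical (a b : E) {U : E} (hU : fderiv ℝ τ u U = 0) :
    firstKind B u a b U = 0 := by
  rw [firstKind_of_eventuallyEq_pullbackForm h.contDiffAt_map h.differentiableAt_metric' h.symm'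
    h.pullback, hU]
  simp [firstKind]

/-- The fibers are submanifolds: this is the symmetry of their second fundamental form. -/
lemma fderiv_pullback_comm {U W : E} (hU : fderiv ℝ τ u U = 0) (hW : fderiv ℝ τ u W = 0) (b : E) :
    fderiv ℝ B u U W b = fderiv ℝ B u W U b := by
  have hs := h.contDiffAt_map.isSymmSndFDerivAt (by simp)
  simp only [fderiv_of_eventuallyEq_pullbackForm h.contDiffAt_map h.differentiableAt_metric'
    h.pullback, hU, hW, hs.eq U W, map_zero, zero_apply]

lemma fderiv_pullback_vertical (c : E) {U W : E} (hU : fderiv ℝ τ u U = 0)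
    (hW : fderiv ℝ τ u W = 0) : fderiv ℝ B u c U W = 0 := by
  simp only [fderiv_of_eventuallyEq_pullbackForm h.contDiffAt_map h.differentiableAt_metric'
    h.pullback, hU, hW, map_zero, zero_apply, add_zero]

/-- The derivative of the vertical part of the metric along a geodesic with velocity `U + X` and
acceleration `-Γ`. Derivatives of the form at the null vector `X` do not contribute. -/
lemma firstKind_sub_self {U X Γ : E} (hU : fderiv ℝ τ u U = 0)
    (hX : ∀ b, (G u - B u) b X = 0)
    (hΓ : ∀ w, G u Γ w = firstKind G u (U + X) (U + X) w) :
    firstKind (fun x ↦ G x - B x) u (U + X) (U + X) (U + X) - (G u - B u) Γ (U + X)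
      = firstKind (fun x ↦ G x - B x) u U U X := by
  -- `X` is null for `G - B`, so that only `G(Γ, U)` remains.
  have e1 : (G u - B u) Γ (U + X) = firstKind (fun x ↦ G x - B x) u (U + X) (U + X) U := by
    rw [map_add, hX, add_zero, sub_apply, sub_apply, h.symm_pullback.self_of_nhds Γ U,
      h.pullback_vertical hU, sub_zero, hΓ, h.firstKind_metric,
      h.firstKind_pullback_vertical _ _ hU, add_zero]
  have e2 : firstKind (fun x ↦ G x - B x) u (U + X) (U + X) (U + X)
      = firstKind (fun x ↦ G x - B x) u (U + X) (U + X) U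
        + firstKind (fun x ↦ G x - B x) u (U + X) (U + X) X := by
    simp only [firstKind, map_add, add_apply]
    ring
  rw [e1, e2, firstKind_add_null h.differentiableAt_sub h.nonneg h.symm_sub U (hX X)]
  ring

lemma fderiv_apply_of_horizontalPart {Y : E → E} {w : E} (hY : DifferentiableAt ℝ Y u)
    (hYG : ∀ᶠ x in 𝓝 u, ∀ b, G x (Y x) b = B x w b) (c b : E) :
    fderiv ℝ G u c (Y u) b + G u (fderiv ℝ Y u c) b = fderiv ℝ B u c w b := by
  have h1 : HasFDerivAt (fun x ↦ G x (Y x) b) _ u :=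
    (h.differentiableAt_metric.hasFDerivAt.clm_apply hY.hasFDerivAt).clm_apply
      (hasFDerivAt_const b u)
  have h2 : HasFDerivAt (fun x ↦ B x w b) _ u :=
    (h.differentiableAt_pullback.hasFDerivAt.clm_apply (hasFDerivAt_const w u)).clm_apply
      (hasFDerivAt_const b u)
  have h3 : (fun x ↦ G x (Y x) b) =ᶠ[𝓝 u] fun x ↦ B x w b := by
    filter_upwards [hYG] with x hx using hx b
  have h4 := congrArg (fun L : E →L[ℝ] ℝ ↦ L c) (h1.unique (h2.congr_of_eventuallyEq h3))
  simp at h4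
  linarith

/-- `T_U W` in coordinates: `Y` is the horizontal part of the constant vector field `w = W + X`, so
that the covariant derivative of its vertical part in the direction `U` is `-D_U Y + Γ(U, W)`. -/
lemma metric_covDeriv_vertical {Y : E → E} {U W X X' Γ : E} (hU : fderiv ℝ τ u U = 0)
    (hW : fderiv ℝ τ u W = 0) (hX : ∀ b, (G u - B u) b X = 0) (hX' : ∀ b, (G u - B u) b X' = 0)
    (hY : DifferentiableAt ℝ Y u) (hYX : Y u = X)
    (hYG : ∀ᶠ x in 𝓝 u, ∀ b, G x (Y x) b = B x (W + X) b)
    (hΓ : ∀ b, G u Γ b = firstKind G u U W b) :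
    G u (-fderiv ℝ Y u U + Γ) X' = firstKind (fun x ↦ G x - B x) u U W X' := by
  have e1 := h.fderiv_apply_of_horizontalPart hY hYG U X'
  have e2 : fderiv ℝ (fun x ↦ G x - B x) u U X X' = 0 :=
    fderiv_apply_eq_zero_of_null h.differentiableAt_sub h.nonneg h.symm_sub (hX X) (hX' X')
      (hX' X) U
  rw [fderiv_fun_sub h.differentiableAt_metric h.differentiableAt_pullback, sub_apply, sub_apply,
    sub_apply] at e2
  have e3 : firstKind B u U W X' = fderiv ℝ B u U W X' := by
    rw [firstKind, ← h.fderiv_pullback_comm hU hW, h.fderiv_pullback_vertical X' hU hW]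
    ring
  rw [hYX, map_add, add_apply] at e1
  rw [map_add, map_neg, add_apply, neg_apply, hΓ, h.firstKind_metric, e3]
  linarith

/-- `T_U X` in coordinates, with `Y` as in `metric_covDeriv_vertical`. -/
lemma metric_covDeriv_horizontal {Y : E → E} {U W X W' Γ : E}
    (hW : fderiv ℝ τ u W = 0) (hW' : fderiv ℝ τ u W' = 0)
    (hY : DifferentiableAt ℝ Y u) (hYX : Y u = X)
    (hYG : ∀ᶠ x in 𝓝 u, ∀ b, G x (Y x) b = B x (W + X) b)
    (hΓ : ∀ b, G u Γ b = firstKind G u U X b) :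
    G u (fderiv ℝ Y u U + Γ) W' = -firstKind (fun x ↦ G x - B x) u U W' X := by
  have e1 := h.fderiv_apply_of_horizontalPart hY hYG U W'
  have e2 := h.fderiv_pullback_vertical U hW hW'
  have e3 : fderiv ℝ (fun x ↦ G x - B x) u U X W'
      = fderiv ℝ G u U X W' - fderiv ℝ B u U X W' := by
    rw [fderiv_fun_sub h.differentiableAt_metric h.differentiableAt_pullback, sub_apply, sub_apply,
      sub_apply]
  rw [hYX, map_add, add_apply, e2] at e1
  have e4 := fderiv_symm_of_eventually h.differentiableAt_sub h.symm_sub U X W'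
  rw [map_add, add_apply, hΓ, h.firstKind_metric, h.firstKind_pullback_vertical _ _ hW']
  simp only [firstKind]
  linarith

end IsLocalSubmersion

end FormFields

/-! ### Tensor fields in charts -/

lemma contDiffAt_of_forall_apply_apply {E : Type*} [NormedAddCommGroup E] [NormedSpace ℝ E]
    [FiniteDimensional ℝ E] {A : E → E →L[ℝ] E →L[ℝ] ℝ} {u : E} {n : WithTop ℕ∞}
    (hA : ∀ a b, ContDiffAt ℝ n (fun x ↦ A x a b) u) : ContDiffAt ℝ n A u := by
  let b := Module.finBasis ℝ E
  have hsum : A = fun x ↦ ∑ i, ∑ j, A x (b i) (b j) •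
      ((LinearMap.toContinuousLinearMap (b.coord i)).smulRight
        (LinearMap.toContinuousLinearMap (b.coord j)) : E →L[ℝ] E →L[ℝ] ℝ) := by
    funext x
    ext v w
    conv_lhs => rw [← b.sum_repr v, ← b.sum_repr w]
    simp only [map_sum, map_smul, sum_apply, smul_apply, smul_eq_mul, Finset.mul_sum,
      ContinuousLinearMap.smulRight_apply, LinearMap.coe_toContinuousLinearMap',
      Module.Basis.coord_apply]
    rw [Finset.sum_comm]
    refine Finset.sum_congr rfl fun i _ ↦ Finset.sum_congr rfl fun j _ ↦ by ring
  rw [hsum]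
  exact ContDiffAt.sum fun i _ ↦ ContDiffAt.sum fun j _ ↦ (hA (b i) (b j)).smul contDiffAt_const

section Charts

variable {E : Type*} [NormedAddCommGroup E] [NormedSpace ℝ E]
  {H : Type*} [TopologicalSpace H] {I : ModelWithCorners ℝ E H}
  {M : Type*} [TopologicalSpace M] [ChartedSpace H M]

variable (I) in
/-- The coordinate frame of the chart around `x₀`, at the point with coordinates `u`, as the linear
map sending `a` to `∑ a^i ∂_i`. -/
noncomputable def chartFrame (x₀ : M) (u : E) :
    E →L[ℝ] TangentSpace I ((extChartAt I x₀).symm u) :=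
  mfderiv 𝓘(ℝ, E) I (extChartAt I x₀).symm u

/-- A field `β` of bilinear forms on `M`, written in the chart around `x₀`. -/
noncomputable def chartForm (β : Π q : M, TangentSpace I q →L[ℝ] TangentSpace I q →L[ℝ] ℝ)
    (x₀ : M) (u : E) : E →L[ℝ] E →L[ℝ] ℝ :=
  pullbackForm (β ((extChartAt I x₀).symm u)) (chartFrame I x₀ u)

lemma chartForm_apply (β : Π q : M, TangentSpace I q →L[ℝ] TangentSpace I q →L[ℝ] ℝ)
    (x₀ : M) (u a b : E) :
    chartForm β x₀ u a b
      = β ((extChartAt I x₀).symm u) (chartFrame I x₀ u a) (chartFrame I x₀ u b) := rfl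

variable [IsManifold I ∞ M]

lemma chartMetric_eq_chartForm (g : Metric I M) (x₀ : M) :
    chartMetric g x₀ = chartForm g.inner x₀ := rfl

lemma chartMetric_symm (g : Metric I M) (x₀ : M) (u a b : E) :
    chartMetric g x₀ u a b = chartMetric g x₀ u b a :=
  g.symm _ _ _

section Boundaryless

variable [I.Boundaryless]

lemma chartFrame_eq_mfderivWithin (x₀ : M) (u : E) :
    chartFrame I x₀ u = mfderivWithin 𝓘(ℝ, E) I (extChartAt I x₀).symm (range I) u := by
  rw [I.range_eq_univ, mfderivWithin_univ]
  rfl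

lemma isInvertible_chartFrame {x₀ : M} {u : E} (hu : u ∈ (extChartAt I x₀).target) :
    (chartFrame I x₀ u).IsInvertible := by
  rw [chartFrame_eq_mfderivWithin]
  exact isInvertible_mfderivWithin_extChartAt_symm hu

/-- At the centre of a chart, the coordinate frame is the identification of the tangent space with
the model space built in `TangentSpace`. -/
lemma chartFrame_self (p : M) (a : E) :
    chartFrame I p (extChartAt I p p) a = (a : TangentSpace I p) := by
  rw [chartFrame_eq_mfderivWithin, mfderivWithin_range_extChartAt_symm]
  rfl

lemma mdifferentiableAt_extChartAt_symm {x₀ : M} {u : E} (hu : u ∈ (extChartAt I x₀).target) :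
    MDifferentiableAt 𝓘(ℝ, E) I (extChartAt I x₀).symm u := by
  have := mdifferentiableWithinAt_extChartAt_symm (I := I) hu
  rwa [I.range_eq_univ, mdifferentiableWithinAt_univ] at this

lemma contMDiffAt_extChartAt_symm {x₀ : M} {u : E} (hu : u ∈ (extChartAt I x₀).target) :
    ContMDiffAt 𝓘(ℝ, E) I ∞ (extChartAt I x₀).symm u :=
  (contMDiffOn_extChartAt_symm x₀).contMDiffAt ((isOpen_extChartAt_target x₀).mem_nhds hu)

lemma chartFrame_eq_symmL {x₀ : M} {u : E} (hu : u ∈ (extChartAt I x₀).target) (a : E) :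
    chartFrame I x₀ u a
      = (trivializationAt E (TangentSpace I : M → Type _) x₀).symm
          ((extChartAt I x₀).symm u) a := by
  have hs : (extChartAt I x₀).symm u ∈ (chartAt H x₀).source := by
    have := (extChartAt I x₀).map_target hu
    rwa [extChartAt_source] at this
  have h := TangentBundle.symmL_trivializationAt (I := I) hs
  rw [(extChartAt I x₀).right_inv hu, ← chartFrame_eq_mfderivWithin] at h
  have h2 := (congrArg (fun L : E →L[ℝ] TangentSpace I ((extChartAt I x₀).symm u) ↦ L a) h).symm
  refine h2.trans ?_
  rw [Trivialization.symmL_apply]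
  exact hs

/-- The extension of tangent vectors in the definition of `oneillTAt` is the extension with
constant coefficients in the chart. -/
lemma extend_eq_chartFrame (p : M) (w : TangentSpace I p) {u : E}
    (hu : u ∈ (extChartAt I p).target) :
    FiberBundle.extend E w ((extChartAt I p).symm u) = chartFrame I p u (w : E) := by
  have h1 : (trivializationAt E (TangentSpace I : M → Type _) p ⟨p, w⟩).2 = (w : E) := by
    have h0 := mem_chart_source H p
    have h2 := TangentBundle.continuousLinearMapAt_trivializationAt (I := I) h0
    rw [mfderiv_extChartAt_self] at h2
    have h3 := congrArg (fun L : TangentSpace I p →L[ℝ] E ↦ L w) h2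
    refine Eq.trans ?_ h3
    rw [Trivialization.continuousLinearMapAt_apply, Trivialization.linearMapAt_apply,
      if_pos (FiberBundle.mem_baseSet_trivializationAt' p)]
  refine Eq.trans ?_ (chartFrame_eq_symmL hu (w : E)).symm
  exact congrArg _ h1

lemma contMDiffAt_chartFrame {x₀ : M} {u : E} (hu : u ∈ (extChartAt I x₀).target) (a : E) :
    ContMDiffAt 𝓘(ℝ, E) I.tangent ∞ (fun x ↦ (TotalSpace.mk' E ((extChartAt I x₀).symm x)
      (chartFrame I x₀ x a) : TangentBundle I M)) u := by
  let t := trivializationAt E (TangentSpace I : M → Type _) x₀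
  have hs : (extChartAt I x₀).symm u ∈ t.baseSet := by
    have := (extChartAt I x₀).map_target hu
    rwa [extChartAt_source] at this
  have h1 : ContMDiffAt 𝓘(ℝ, E) I.tangent ∞
      (fun x ↦ (TotalSpace.mk' E ((extChartAt I x₀).symm x)
        (t.symm ((extChartAt I x₀).symm x) a) : TangentBundle I M)) u := by
    rw [Trivialization.contMDiffAt_iff (e := t) hs]
    refine ⟨contMDiffAt_extChartAt_symm hu, ?_⟩
    refine (contMDiffAt_const (c := a)).congr_of_eventuallyEq ?_
    filter_upwards [(contMDiffAt_extChartAt_symm hu).continuousAt.preimage_mem_nhds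
      (t.open_baseSet.mem_nhds hs)] with x hx
    exact t.apply_mk_symm hx a ▸ rfl
  refine h1.congr_of_eventuallyEq ?_
  filter_upwards [(isOpen_extChartAt_target x₀).mem_nhds hu] with x hx
  rw [chartFrame_eq_symmL hx]

lemma chartMetric_pos (g : Metric I M) {x₀ : M} {u : E}
    (hu : u ∈ (extChartAt I x₀).target) (a : E) (ha : a ≠ 0) : 0 < chartMetric g x₀ u a a := by
  refine g.pos _ _ fun h ↦ ha ?_
  obtain ⟨e, he⟩ := isInvertible_chartFrame (I := I) hu
  have h1 : chartFrame I x₀ u a = 0 := h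
  rw [← he] at h1
  exact e.injective (h1.trans (map_zero e).symm)

variable [FiniteDimensional ℝ E]

lemma contDiffAt_chartMetric (g : Metric I M) {x₀ : M} {u : E}
    (hu : u ∈ (extChartAt I x₀).target) : ContDiffAt ℝ ∞ (chartMetric g x₀) u := by
  refine contDiffAt_of_forall_apply_apply fun a b ↦ ?_
  have k := ContMDiffAt.clm_bundle_apply₂ (F₁ := E) (F₂ := E) (F₃ := ℝ)
    (E₁ := (TangentSpace I : M → Type _)) (E₂ := (TangentSpace I : M → Type _))
    (E₃ := fun _ ↦ ℝ) (b := (extChartAt I x₀).symm)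
    (ψ := fun x ↦ g.inner ((extChartAt I x₀).symm x))
    (g.contMDiff.contMDiffAt.comp u (contMDiffAt_extChartAt_symm hu))
    (contMDiffAt_chartFrame hu a) (contMDiffAt_chartFrame hu b)
  rw [contMDiffAt_totalSpace] at k
  exact k.2.contDiffAt

lemma isInvertible_chartMetric (g : Metric I M) {x₀ : M} {u : E}
    (hu : u ∈ (extChartAt I x₀).target) : (chartMetric g x₀ u).IsInvertible :=
  isInvertible_of_posDef _ (chartMetric_pos g hu)

lemma chartMetric_christoffel (g : Metric I M) {x₀ : M} {u : E}
    (hu : u ∈ (extChartAt I x₀).target) (a b w : E) :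
    chartMetric g x₀ u (christoffel g x₀ u a b) w = firstKind (chartMetric g x₀) u a b w := by
  rw [christoffel, apply_inverse_apply (isInvertible_chartMetric g hu), firstKind]
  simp

end Boundaryless

end Charts

section PullbackMetric

variable {E : Type*} [NormedAddCommGroup E] [NormedSpace ℝ E]
  {H : Type*} [TopologicalSpace H] {I : ModelWithCorners ℝ E H}
  {M : Type*} [TopologicalSpace M] [ChartedSpace H M]
  {E' : Type*} [NormedAddCommGroup E'] [NormedSpace ℝ E']
  {H' : Type*} [TopologicalSpace H'] {I' : ModelWithCorners ℝ E' H'}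
  {N : Type*} [TopologicalSpace N] [ChartedSpace H' N] [IsManifold I' ∞ N]

variable (I) in
/-- The pullback `φ^* g'` of a Riemannian metric: `(v, w) ↦ g'(dφ v, dφ w)`. -/
noncomputable def pullbackMetric (g' : Metric I' N) (φ : M → N) (q : M) :
    TangentSpace I q →L[ℝ] TangentSpace I q →L[ℝ] ℝ :=
  pullbackForm (g'.inner (φ q)) (mfderiv I I' φ q)

lemma pullbackMetric_congr (g' : Metric I' N) {F F' : M → N} {q : M} (h : F =ᶠ[𝓝 q] F') :
    pullbackMetric I g' F q = pullbackMetric I g' F' q := by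
  have h1 : (mfderiv I I' F q : TangentSpace I q →L[ℝ] E') = mfderiv I I' F' q := h.mfderiv_eq
  let G : N → E' →L[ℝ] E' →L[ℝ] ℝ := fun y ↦ g'.inner y
  have h2 : G (F q) = G (F' q) := congrArg G h.self_of_nhds
  exact congrArg₂ (fun (B : E' →L[ℝ] E' →L[ℝ] ℝ) (L : TangentSpace I q →L[ℝ] E') ↦
    pullbackForm B L) h2 h1

variable [IsManifold I ∞ M] [I.Boundaryless] [I'.Boundaryless]

variable (I I') in
/-- The map `φ` written in the charts around `x₀` and `y₀`. -/
noncomputable def chartMap (φ : M → N) (x₀ : M) (y₀ : N) (u : E) : E' :=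
  extChartAt I' y₀ (φ ((extChartAt I x₀).symm u))

lemma contDiffAt_chartMap {φ : M → N} (hφ : ContMDiff I I' ∞ φ) {x₀ : M} {y₀ : N} {u : E}
    (hu : u ∈ (extChartAt I x₀).target)
    (hy : φ ((extChartAt I x₀).symm u) ∈ (chartAt H' y₀).source) :
    ContDiffAt ℝ ∞ (chartMap I I' φ x₀ y₀) u := by
  rw [← contMDiffAt_iff_contDiffAt]
  exact (contMDiffAt_extChartAt' hy).comp u
    (hφ.contMDiffAt.comp u (contMDiffAt_extChartAt_symm hu))

/-- In charts, the form `φ^* g'` is the pullback of the coordinate expression of `g'` by the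
coordinate expression of `φ`. -/
lemma chartForm_pullbackMetric_eventuallyEq (g' : Metric I' N) {φ : M → N}
    (hφ : ContMDiff I I' ∞ φ) {x₀ : M} {y₀ : N} {u : E} (hu : u ∈ (extChartAt I x₀).target)
    (hy : φ ((extChartAt I x₀).symm u) ∈ (chartAt H' y₀).source) :
    chartForm (pullbackMetric I g' φ) x₀ =ᶠ[𝓝 u] fun x ↦
      pullbackForm (chartMetric g' y₀ (chartMap I I' φ x₀ y₀ x))
        (fderiv ℝ (chartMap I I' φ x₀ y₀) x) := by
  have hcont : ContinuousAt (fun x ↦ φ ((extChartAt I x₀).symm x)) u :=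
    (hφ.contMDiffAt.comp u (contMDiffAt_extChartAt_symm hu)).continuousAt
  have hev : ∀ᶠ x in 𝓝 u, x ∈ (extChartAt I x₀).target ∧
      φ ((extChartAt I x₀).symm x) ∈ (chartAt H' y₀).source :=
    ((isOpen_extChartAt_target x₀).mem_nhds hu |> Filter.eventually_mem_set.2).and
      (hcont.preimage_mem_nhds ((chartAt H' y₀).open_source.mem_nhds hy))
  filter_upwards [hev.eventually_nhds] with x hx
  obtain ⟨hxt, hxs⟩ := hx.self_of_nhds
  have hF : (fun z ↦ φ ((extChartAt I x₀).symm z)) =ᶠ[𝓝 x]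
      fun z ↦ (extChartAt I' y₀).symm (chartMap I I' φ x₀ y₀ z) := by
    filter_upwards [hx] with z hz
    rw [chartMap, (extChartAt I' y₀).left_inv]
    rw [extChartAt_source]
    exact hz.2
  have hxs' : chartMap I I' φ x₀ y₀ x ∈ (extChartAt I' y₀).target :=
    (extChartAt I' y₀).map_source (by rw [extChartAt_source]; exact hxs)
  have e1 : chartForm (pullbackMetric I g' φ) x₀ x
      = pullbackMetric 𝓘(ℝ, E) g' (fun z ↦ φ ((extChartAt I x₀).symm z)) x := by
    have h := mfderiv_comp (I := 𝓘(ℝ, E)) (I' := I) (I'' := I') x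
      (hφ.mdifferentiable (by simp) _) (mdifferentiableAt_extChartAt_symm hxt)
    ext a b
    exact (congrArg₂ (fun v w : TangentSpace I' (φ ((extChartAt I x₀).symm x)) ↦
      g'.inner (φ ((extChartAt I x₀).symm x)) v w)
      (congrArg (fun L : E →L[ℝ] E' ↦ L a) h) (congrArg (fun L : E →L[ℝ] E' ↦ L b) h)).symm
  have e2 : pullbackForm (chartMetric g' y₀ (chartMap I I' φ x₀ y₀ x))
        (fderiv ℝ (chartMap I I' φ x₀ y₀) x)
      = pullbackMetric 𝓘(ℝ, E) g'
          (fun z ↦ (extChartAt I' y₀).symm (chartMap I I' φ x₀ y₀ z)) x := by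
    have h := mfderiv_comp (I := 𝓘(ℝ, E)) (I' := 𝓘(ℝ, E')) (I'' := I') x
      (mdifferentiableAt_extChartAt_symm hxs')
      ((contDiffAt_chartMap hφ hxt hxs).differentiableAt (by simp)).mdifferentiableAt
    rw [mfderiv_eq_fderiv] at h
    ext a b
    exact (congrArg₂ (fun v w : TangentSpace I' _ ↦
      g'.inner ((extChartAt I' y₀).symm (chartMap I I' φ x₀ y₀ x)) v w)
      (congrArg (fun L : E →L[ℝ] E' ↦ L a) h) (congrArg (fun L : E →L[ℝ] E' ↦ L b) h)).symm
  rw [e1, e2]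
  exact pullbackMetric_congr g' hF

variable [FiniteDimensional ℝ E']

lemma contDiffAt_chartForm_pullbackMetric (g' : Metric I' N) {φ : M → N}
    (hφ : ContMDiff I I' ∞ φ) {x₀ : M} {u : E} (hu : u ∈ (extChartAt I x₀).target) :
    ContDiffAt ℝ ∞ (chartForm (pullbackMetric I g' φ) x₀) u := by
  have hy := mem_chart_source H' (φ ((extChartAt I x₀).symm u))
  refine ContDiffAt.congr_of_eventuallyEq ?_ (chartForm_pullbackMetric_eventuallyEq g' hφ hu hy)
  have h := contDiffAt_chartMap hφ hu hy
  refine contDiffAt_pullbackForm ?_ (h.fderiv_right (by simp))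
  exact (contDiffAt_chartMetric g' ((extChartAt I' _).map_source
    (by rw [extChartAt_source]; exact hy))).comp u h

end PullbackMetric

/-! ### Geodesics in charts: change of chart, existence, derivatives along geodesics -/

section Geodesics

variable {E : Type*} [NormedAddCommGroup E] [NormedSpace ℝ E]
  {H : Type*} [TopologicalSpace H] {I : ModelWithCorners ℝ E H}
  {M : Type*} [TopologicalSpace M] [ChartedSpace H M]

lemma tangentBundle_mk_eq {x y : M} {v : TangentSpace I x} {w : TangentSpace I y} (h : x = y)
    (h' : (v : E) = w) : (⟨x, v⟩ : TangentBundle I M) = ⟨y, w⟩ := by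
  subst h
  exact congrArg (TotalSpace.mk' E x) h'

lemma form_velocity_congr (β : Π q : M, TangentSpace I q →L[ℝ] TangentSpace I q →L[ℝ] ℝ)
    {c c' : ℝ → M} {t : ℝ} (h : c =ᶠ[𝓝 t] c') :
    β (c t) (velocity I c t) (velocity I c t) = β (c' t) (velocity I c' t) (velocity I c' t) := by
  have h1 : (mfderiv 𝓘(ℝ, ℝ) I c t : ℝ →L[ℝ] E) = mfderiv 𝓘(ℝ, ℝ) I c' t := h.mfderiv_eq
  let G : M → E →L[ℝ] E →L[ℝ] ℝ := fun y ↦ β y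
  have h2 : G (c t) = G (c' t) := congrArg G h.self_of_nhds
  exact congrArg₂ (fun (B : E →L[ℝ] E →L[ℝ] ℝ) (L : ℝ →L[ℝ] E) ↦ B (L 1) (L 1)) h2 h1

variable [IsManifold I ∞ M] [I.Boundaryless]

lemma velocity_extChartAt_symm {x₀ : M} {u : ℝ → E} {v : E} {t : ℝ}
    (hu : u t ∈ (extChartAt I x₀).target) (hd : HasDerivAt u v t) :
    velocity I (fun τ ↦ (extChartAt I x₀).symm (u τ)) t = chartFrame I x₀ (u t) v := by
  have h := mfderiv_comp (I := 𝓘(ℝ, ℝ)) (I' := 𝓘(ℝ, E)) (I'' := I) t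
      (mdifferentiableAt_extChartAt_symm hu) hd.differentiableAt.mdifferentiableAt
  rw [mfderiv_eq_fderiv] at h
  have h2 : fderiv ℝ u t 1 = v := by rw [fderiv_apply_one_eq_deriv, hd.deriv]
  exact (congrArg (fun L : ℝ →L[ℝ] E ↦ L 1) h).trans (congrArg (chartFrame I x₀ (u t)) h2)

/-- A quadratic form evaluated on the velocity, in the chart around `x₀`. -/
lemma form_velocity_eq_chartForm (β : Π q : M, TangentSpace I q →L[ℝ] TangentSpace I q →L[ℝ] ℝ)
    {x₀ : M} {c : ℝ → M} {t : ℝ} (hc : ContinuousAt c t) (hx : c t ∈ (chartAt H x₀).source)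
    (hd : DifferentiableAt ℝ (fun τ ↦ extChartAt I x₀ (c τ)) t) :
    β (c t) (velocity I c t) (velocity I c t)
      = chartForm β x₀ (extChartAt I x₀ (c t)) (deriv (fun τ ↦ extChartAt I x₀ (c τ)) t)
          (deriv (fun τ ↦ extChartAt I x₀ (c τ)) t) := by
  have h : c =ᶠ[𝓝 t] fun τ ↦ (extChartAt I x₀).symm (extChartAt I x₀ (c τ)) := by
    filter_upwards [hc.preimage_mem_nhds ((chartAt H x₀).open_source.mem_nhds hx)] with τ hτ
    rw [(extChartAt I x₀).left_inv]
    rw [extChartAt_source]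
    exact hτ
  rw [form_velocity_congr β h]
  have h2 := velocity_extChartAt_symm (I := I) (x₀ := x₀) (t := t)
    (u := fun τ ↦ extChartAt I x₀ (c τ))
    ((extChartAt I x₀).map_source (by rw [extChartAt_source]; exact hx)) hd.hasDerivAt
  rw [chartForm_apply, ← h2]

lemma chartMetric_eventuallyEq (g : Metric I M) {x₀ x₁ : M} {u : E}
    (hu : u ∈ (extChartAt I x₀).target)
    (hx : (extChartAt I x₀).symm u ∈ (chartAt H x₁).source) :
    chartMetric g x₀ =ᶠ[𝓝 u] fun x ↦ pullbackForm (chartMetric g x₁ (chartMap I I id x₀ x₁ x))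
        (fderiv ℝ (chartMap I I id x₀ x₁) x) := by
  refine Filter.EventuallyEq.trans (Eq.eventuallyEq ?_)
    (chartForm_pullbackMetric_eventuallyEq g contMDiff_id hu hx)
  rw [chartMetric_eq_chartForm]
  congr 1
  funext q
  unfold pullbackMetric
  rw [mfderiv_id]
  rfl

variable [FiniteDimensional ℝ E]

/-- The geodesic equation does not depend on the chart. -/
lemma geodesic_equation_chartMap (g : Metric I M) {x₀ x₁ : M} {u v : ℝ → E} {t : ℝ}
    (hu : u t ∈ (extChartAt I x₀).target)
    (hx : (extChartAt I x₀).symm (u t) ∈ (chartAt H x₁).source)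
    (huv : ∀ᶠ τ in 𝓝 t, HasDerivAt u (v τ) τ)
    (hv : HasDerivAt v (-christoffel g x₀ (u t) (v t) (v t)) t) :
    letI w : ℝ → E := fun τ ↦ chartMap I I id x₀ x₁ (u τ)
    deriv (deriv w) t + christoffel g x₁ (w t) (deriv w t) (deriv w t) = 0 := by
  set w : ℝ → E := fun τ ↦ chartMap I I id x₀ x₁ (u τ)
  set T := chartMap I I (id : M → M) x₀ x₁ with hT
  have hTs : ContDiffAt ℝ ∞ T (u t) := contDiffAt_chartMap contMDiff_id hu hx
  have hut := huv.self_of_nhds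
  have hTd : ∀ᶠ τ in 𝓝 t, DifferentiableAt ℝ T (u τ) := by
    have h1 := (hTs.of_le (m := 1) (mod_cast le_top)).eventually (by decide)
    filter_upwards [hut.continuousAt.eventually h1] with τ hτ using hτ.differentiableAt (by simp)
  have hw1 : deriv w =ᶠ[𝓝 t] fun τ ↦ fderiv ℝ T (u τ) (v τ) := by
    filter_upwards [huv, hTd] with τ h1 h2
    exact (h2.hasFDerivAt.comp_hasDerivAt τ h1).deriv
  have hT2 : HasFDerivAt (fderiv ℝ T) (fderiv ℝ (fderiv ℝ T) (u t)) (u t) :=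
    ((hTs.fderiv_right (m := 1) (WithTop.coe_le_coe.2 le_top)).differentiableAt
      (by simp)).hasFDerivAt
  have hTu : HasDerivAt (fun τ ↦ fderiv ℝ T (u τ)) (fderiv ℝ (fderiv ℝ T) (u t) (v t)) t :=
    hT2.comp_hasDerivAt t hut
  have hw2 : deriv (deriv w) t = fderiv ℝ (fderiv ℝ T) (u t) (v t) (v t)
      - fderiv ℝ T (u t) (christoffel g x₀ (u t) (v t) (v t)) := by
    rw [hw1.deriv_eq, (hTu.clm_apply hv).deriv, map_neg, sub_eq_add_neg]
  have hTt : T (u t) ∈ (extChartAt I x₁).target :=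
    (extChartAt I x₁).map_source (by rw [extChartAt_source]; exact hx)
  have hG := chartMetric_eventuallyEq g hu hx
  have hGt : ∀ a b, chartMetric g x₀ (u t) a b
      = chartMetric g x₁ (T (u t)) (fderiv ℝ T (u t) a) (fderiv ℝ T (u t) b) := by
    intro a b
    rw [hG.self_of_nhds, pullbackForm_apply]
  have hsurj : Function.Surjective (fderiv ℝ T (u t)) := by
    have hinj : Function.Injective (fderiv ℝ T (u t)).toLinearMap := by
      rw [injective_iff_map_eq_zero]
      intro a ha
      by_contra hne
      have h1 := chartMetric_pos g hu a hne
      have ha' : fderiv ℝ T (u t) a = 0 := ha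
      rw [hGt, ha'] at h1
      simp at h1
    exact LinearMap.injective_iff_surjective.1 hinj
  by_contra hne
  have hpos := chartMetric_pos g hTt _ hne
  obtain ⟨a, ha⟩ := hsurj
    (deriv (deriv w) t + christoffel g x₁ (w t) (deriv w t) (deriv w t))
  have hk := firstKind_of_eventuallyEq_pullbackForm
    (hTs.of_le (m := 2) (WithTop.coe_le_coe.2 le_top))
    ((contDiffAt_chartMetric g hTt).differentiableAt (by simp)) (chartMetric_symm g x₁ _) hG
    (v t) (v t) a
  rw [← chartMetric_christoffel g hu, hGt, ← chartMetric_christoffel g hTt, ha] at hk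
  have hwt : deriv w t = fderiv ℝ T (u t) (v t) := hw1.self_of_nhds
  have hz : deriv (deriv w) t + christoffel g x₁ (w t) (deriv w t) (deriv w t)
      = fderiv ℝ (fderiv ℝ T) (u t) (v t) (v t)
        - fderiv ℝ T (u t) (christoffel g x₀ (u t) (v t) (v t))
        + christoffel g x₁ (T (u t)) (fderiv ℝ T (u t) (v t)) (fderiv ℝ T (u t) (v t)) := by
    rw [hw2, hwt]
  generalize deriv (deriv w) t + christoffel g x₁ (w t) (deriv w t) (deriv w t) = z
    at hpos hk hz
  refine hpos.ne' ?_
  have h := congrArg (fun y ↦ chartMetric g x₁ (T (u t)) y z) hz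
  simp only [map_add, map_sub, add_apply, sub_apply] at h
  linarith

lemma contDiffAt_christoffel (g : Metric I M) {x₀ : M} {z : E × E}
    (hz : z.1 ∈ (extChartAt I x₀).target) :
    ContDiffAt ℝ 1 (fun z : E × E ↦ christoffel g x₀ z.1 z.2 z.2) z := by
  have hG := contDiffAt_chartMetric g hz
  have hG1 : ContDiffAt ℝ 1 (fun z : E × E ↦ chartMetric g x₀ z.1) z :=
    (hG.of_le (m := 1) (mod_cast le_top)).comp z contDiffAt_fst
  have hG2 : ContDiffAt ℝ 1 (fun z : E × E ↦ fderiv ℝ (chartMetric g x₀) z.1) z :=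
    ContDiffAt.comp z (hG.fderiv_right (m := 1) (WithTop.coe_le_coe.2 le_top)) contDiffAt_fst
  have hinv : ContDiffAt ℝ 1 (fun z : E × E ↦ (chartMetric g x₀ z.1).inverse) z :=
    ContDiffAt.comp (g := ContinuousLinearMap.inverse) z
      (isInvertible_chartMetric g hz).contDiffAt_map_inverse hG1
  have h2 : ContDiffAt ℝ 1 (fun z : E × E ↦ z.2) z := contDiffAt_snd
  have hflip : ContDiffAt ℝ 1 (fun z : E × E ↦
      ((fderiv ℝ (chartMetric g x₀) z.1).flip z.2).flip z.2) z := by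
    have k1 : ContDiffAt ℝ 1 (fun z : E × E ↦ (fderiv ℝ (chartMetric g x₀) z.1).flip) z :=
      (ContinuousLinearMap.flipₗᵢ ℝ E E (E →L[ℝ] ℝ)).contDiff.contDiffAt.comp z hG2
    exact ((ContinuousLinearMap.flipₗᵢ ℝ E E ℝ).contDiff.contDiffAt.comp z
      (k1.clm_apply h2)).clm_apply h2
  have h3 := (hG2.clm_apply h2).clm_apply h2
  exact hinv.clm_apply (((h3.add h3).sub hflip).const_smul (1 / 2 : ℝ))

/-- Through every nonzero tangent vector there passes a geodesic, with velocity different from `0`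
at all times. -/
lemma exists_geodesic (g : Metric I M) (p : M) (v : TangentSpace I p) (hv : v ≠ 0) :
    ∃ (c : ℝ → M) (s : Set ℝ), IsOpen s ∧ s.OrdConnected ∧ (0 : ℝ) ∈ s ∧ IsGeodesicOn g c s ∧
      (∀ t ∈ s, velocity I c t ≠ 0) ∧
      (⟨c 0, velocity I c 0⟩ : TangentBundle I M) = ⟨p, v⟩ := by
  -- The geodesic equation as a first order system for position and velocity.
  let F : E × E → E × E := fun z ↦ (z.2, -christoffel g p z.1 z.2 z.2)
  have hF : ∀ z : E × E, z.1 ∈ (extChartAt I p).target → ContDiffAt ℝ 1 F z := fun z hz ↦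
    contDiffAt_snd.prodMk (contDiffAt_christoffel g hz).neg
  have hp := mem_extChartAt_target (I := I) p
  obtain ⟨α, hα0, ε, hε, hα⟩ :=
    (hF (extChartAt I p p, (v : E)) hp)
      |>.exists_forall_mem_closedBall_exists_eq_forall_mem_Ioo_hasDerivAt₀ 0
  rw [zero_sub, zero_add] at hα
  have hcont : ContinuousAt α 0 := (hα 0 ⟨by linarith, hε⟩).continuousAt
  have hev : ∀ᶠ t in 𝓝 (0 : ℝ), t ∈ Ioo (-ε) ε ∧ (α t).1 ∈ (extChartAt I p).target
      ∧ (α t).2 ≠ 0 := by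
    refine (Ioo_mem_nhds (by linarith) hε |> Filter.eventually_mem_set.2).and (.and ?_ ?_)
    · exact hcont.fst.preimage_mem_nhds (((isOpen_extChartAt_target p)).mem_nhds (by rwa [hα0]))
    · exact hcont.snd.eventually_ne (by rw [hα0]; exact hv)
  obtain ⟨δ, hδ, hs⟩ := Metric.eventually_nhds_iff_ball.1 hev
  set s := Metric.ball (0 : ℝ) δ with hsdef
  have hso : IsOpen s := Metric.isOpen_ball
  have hαs : ∀ t ∈ s, HasDerivAt α (F (α t)) t := fun t ht ↦ hα t (hs t ht).1
  have h1 : ∀ t ∈ s, HasDerivAt (fun τ ↦ (α τ).1) (α t).2 t := fun t ht ↦ (hαs t ht).fst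
  have h2 : ∀ t ∈ s, HasDerivAt (fun τ ↦ (α τ).2)
    (-christoffel g p (α t).1 (α t).2 (α t).2) t := fun t ht ↦ (hαs t ht).snd
  have hvel : ∀ t ∈ s, velocity I (fun τ ↦ (extChartAt I p).symm (α τ).1) t
      = chartFrame I p (α t).1 (α t).2 := fun t ht ↦
    velocity_extChartAt_symm (u := fun τ ↦ (α τ).1) (hs t ht).2.1 (h1 t ht)
  have hsmooth2 : ContDiffOn ℝ 1 (fun τ ↦ (α τ).2) s := by
    rw [← zero_add (1 : WithTop ℕ∞), contDiffOn_succ_iff_deriv_of_isOpen hso]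
    refine ⟨fun t ht ↦ (h2 t ht).differentiableAt.differentiableWithinAt, by simp, ?_⟩
    rw [contDiffOn_zero]
    refine ContinuousOn.congr (f := fun t ↦ (F (α t)).2) (fun t ht ↦ ?_) fun t ht ↦ (h2 t ht).deriv
    exact (ContinuousAt.comp (hF _ (hs t ht).2.1).continuousAt
      (hαs t ht).continuousAt).snd.continuousWithinAt
  have hsmooth1 : ContDiffOn ℝ 2 (fun τ ↦ (α τ).1) s := by
    rw [← one_add_one_eq_two, contDiffOn_succ_iff_deriv_of_isOpen hso]
    exact ⟨fun t ht ↦ (h1 t ht).differentiableAt.differentiableWithinAt, by simp,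
      hsmooth2.congr fun t ht ↦ (h1 t ht).deriv⟩
  refine ⟨fun τ ↦ (extChartAt I p).symm (α τ).1, s, hso, ?_, Metric.mem_ball_self hδ,
    ⟨?_, ?_⟩, ?_, ?_⟩
  · rw [hsdef, Real.ball_eq_Ioo]
    exact ordConnected_Ioo
  · exact ((contMDiffOn_extChartAt_symm (n := ∞) p).of_le (m := 2)
      (WithTop.coe_le_coe.2 le_top)).comp
      hsmooth1.contMDiffOn fun t ht ↦ (hs t ht).2.1
  · intro x₁ t ht hx
    refine geodesic_equation_chartMap g (u := fun τ ↦ (α τ).1) (v := fun τ ↦ (α τ).2)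
      (hs t ht).2.1 hx ?_ (h2 t ht)
    filter_upwards [hso.mem_nhds ht] with τ hτ using h1 τ hτ
  · intro t ht h0
    obtain ⟨e, he⟩ := isInvertible_chartFrame (I := I) (hs t ht).2.1
    rw [hvel t ht, ← he] at h0
    exact (hs t ht).2.2 (e.injective (h0.trans (map_zero e).symm))
  · have h00 : (0 : ℝ) ∈ s := Metric.mem_ball_self hδ
    refine tangentBundle_mk_eq ?_ ?_
    · change (extChartAt I p).symm (α 0).1 = p
      rw [hα0]
      exact extChartAt_to_inv p
    · rw [hvel 0 h00]
      have h3 := chartFrame_self (I := I) p (v : E)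
      rw [show α 0 = (extChartAt I p p, (v : E)) from hα0]
      exact h3

lemma IsGeodesicOn.differentiability {g : Metric I M} {c : ℝ → M} {s : Set ℝ} (hs : IsOpen s)
    (hc : IsGeodesicOn g c s) {t : ℝ} (ht : t ∈ s) {x₀ : M} (hx : c t ∈ (chartAt H x₀).source) :
    (∀ᶠ τ in 𝓝 t, τ ∈ s ∧ c τ ∈ (chartAt H x₀).source ∧ ContinuousAt c τ ∧
      DifferentiableAt ℝ (fun τ ↦ extChartAt I x₀ (c τ)) τ) ∧
    HasDerivAt (deriv (fun τ ↦ extChartAt I x₀ (c τ)))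
      (-christoffel g x₀ (extChartAt I x₀ (c t)) (deriv (fun τ ↦ extChartAt I x₀ (c τ)) t)
        (deriv (fun τ ↦ extChartAt I x₀ (c τ)) t)) t := by
  have hcd : ∀ τ ∈ s, ContMDiffAt 𝓘(ℝ, ℝ) I 2 c τ := fun τ hτ ↦
    hc.1.contMDiffAt (hs.mem_nhds hτ)
  have hud : ∀ τ ∈ s, c τ ∈ (chartAt H x₀).source →
      ContDiffAt ℝ 2 (fun τ ↦ extChartAt I x₀ (c τ)) τ := by
    intro τ hτ hτx
    rw [← contMDiffAt_iff_contDiffAt]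
    exact ((contMDiffAt_extChartAt' (n := ∞) hτx).of_le (m := 2)
      (WithTop.coe_le_coe.2 le_top)).comp τ (hcd τ hτ)
  constructor
  · filter_upwards [hs.mem_nhds ht, (hcd t ht).continuousAt.preimage_mem_nhds
      ((chartAt H x₀).open_source.mem_nhds hx)] with τ h1 h2
    exact ⟨h1, h2, (hcd τ h1).continuousAt, (hud τ h1 h2).differentiableAt (by simp)⟩
  · have h1 : DifferentiableAt ℝ (deriv (fun τ ↦ extChartAt I x₀ (c τ))) t := by
      have h := (hud t ht hx).fderiv_right (m := 1) (by norm_num)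
      have h' := (h.differentiableAt (by simp)).clm_apply (differentiableAt_const (1 : ℝ))
      simpa only [fderiv_apply_one_eq_deriv] using h'
    rw [← eq_neg_of_add_eq_zero_left (hc.2 x₀ t ht hx)]
    exact h1.hasDerivAt

/-- The derivative of a quadratic form along the velocity of a geodesic. -/
lemma IsGeodesicOn.hasDerivAt_form {g : Metric I M} {c : ℝ → M} {s : Set ℝ} (hs : IsOpen s)
    (hc : IsGeodesicOn g c s) {t : ℝ} (ht : t ∈ s)
    (β : Π q : M, TangentSpace I q →L[ℝ] TangentSpace I q →L[ℝ] ℝ)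
    (hβs : ∀ q v w, β q v w = β q w v) {x₀ : M} (hx : c t ∈ (chartAt H x₀).source)
    (hβ : DifferentiableAt ℝ (chartForm β x₀) (extChartAt I x₀ (c t))) :
    letI u : E := extChartAt I x₀ (c t)
    letI v : E := deriv (fun τ ↦ extChartAt I x₀ (c τ)) t
    HasDerivAt (fun τ ↦ β (c τ) (velocity I c τ) (velocity I c τ))
      (2 * (firstKind (chartForm β x₀) u v v v
        - chartForm β x₀ u (christoffel g x₀ u v v) v)) t := by
  obtain ⟨h1, h2⟩ := hc.differentiability hs ht hx
  have h3 := hasDerivAt_form_along (B := chartForm β x₀) (u := fun τ ↦ extChartAt I x₀ (c τ))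
    hβ (fun a b ↦ hβs _ _ _) h1.self_of_nhds.2.2.2.hasDerivAt h2
  rw [map_neg, neg_apply, ← sub_eq_add_neg] at h3
  refine h3.congr_of_eventuallyEq ?_
  filter_upwards [h1] with τ hτ
  exact form_velocity_eq_chartForm β hτ.2.2.1 hτ.2.1 hτ.2.2.2

/-- Geodesics have constant speed. -/
lemma IsGeodesicOn.hasDerivAt_metric {g : Metric I M} {c : ℝ → M} {s : Set ℝ} (hs : IsOpen s)
    (hc : IsGeodesicOn g c s) {t : ℝ} (ht : t ∈ s) :
    HasDerivAt (fun τ ↦ g.inner (c τ) (velocity I c τ) (velocity I c τ)) 0 t := by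
  have hu := mem_extChartAt_target (I := I) (c t)
  have h := hc.hasDerivAt_form hs ht g.inner g.symm (mem_chart_source H (c t))
    ((contDiffAt_chartMetric g hu).differentiableAt (by simp))
  rw [← chartMetric_eq_chartForm, chartMetric_christoffel g hu, sub_self, mul_zero] at h
  exact h

end Geodesics

/-! ### Riemannian submersions: the vertical part of the metric -/

section Submersion

variable {E : Type*} [NormedAddCommGroup E] [NormedSpace ℝ E]
  {H : Type*} [TopologicalSpace H] {I : ModelWithCorners ℝ E H}
  {M : Type*} [TopologicalSpace M] [ChartedSpace H M] [IsManifold I ∞ M]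
  {E' : Type*} [NormedAddCommGroup E'] [NormedSpace ℝ E']
  {H' : Type*} [TopologicalSpace H'] {I' : ModelWithCorners ℝ E' H'}
  {N : Type*} [TopologicalSpace N] [ChartedSpace H' N] [IsManifold I' ∞ N]

lemma inner_self_nonneg (g : Metric I M) (p : M) (v : TangentSpace I p) : 0 ≤ g.inner p v v := by
  rcases eq_or_ne v 0 with rfl | h
  · simp
  · exact (g.pos p v h).le

/-- The vertical part `(v, w) ↦ g(𝓥v, 𝓥w)` of the metric of a Riemannian submersion, which is
`g - φ^* g'`. -/
noncomputable def vertForm (g : Metric I M) (g' : Metric I' N) (φ : M → N) (q : M) :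
    TangentSpace I q →L[ℝ] TangentSpace I q →L[ℝ] ℝ :=
  g.inner q - pullbackMetric I g' φ q

lemma vertForm_apply (g : Metric I M) (g' : Metric I' N) (φ : M → N) (q : M)
    (v w : TangentSpace I q) : vertForm g g' φ q v w
      = g.inner q v w - g'.inner (φ q) (mfderiv I I' φ q v) (mfderiv I I' φ q w) := rfl

lemma vertForm_symm (g : Metric I M) (g' : Metric I' N) (φ : M → N) (q : M)
    (v w : TangentSpace I q) : vertForm g g' φ q v w = vertForm g g' φ q w v := by
  rw [vertForm_apply, vertForm_apply, g.symm, g'.symm]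

lemma vertForm_of_vertical (g : Metric I M) (g' : Metric I' N) (φ : M → N) (q : M)
    {v : TangentSpace I q} (hv : v ∈ vertical I I' φ q) (w : TangentSpace I q) :
    vertForm g g' φ q v w = g.inner q v w := by
  have h : mfderiv I I' φ q v = 0 := hv
  simp [vertForm_apply, h]

lemma chartForm_vertForm (g : Metric I M) (g' : Metric I' N) (φ : M → N) (x₀ : M) :
    chartForm (vertForm g g' φ) x₀
      = fun u ↦ chartMetric g x₀ u - chartForm (pullbackMetric I g' φ) x₀ u := rfl

lemma chartForm_self [I.Boundaryless]
    (β : Π q : M, TangentSpace I q →L[ℝ] TangentSpace I q →L[ℝ] ℝ) (p : M)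
    (v w : TangentSpace I p) : chartForm β p (extChartAt I p p) v w = β p v w := by
  let G : M → E →L[ℝ] E →L[ℝ] ℝ := fun y ↦ β y
  have h2 : G ((extChartAt I p).symm (extChartAt I p p)) = G p := congrArg G (extChartAt_to_inv p)
  have h3 := chartFrame_self (I := I) p
  exact (congrArg₂ (fun a b : E ↦ G ((extChartAt I p).symm (extChartAt I p p)) a b)
    (h3 v) (h3 w)).trans (congrArg (fun B : E →L[ℝ] E →L[ℝ] ℝ ↦ B v w) h2)

lemma velocity_eq_deriv [I.Boundaryless] {c : ℝ → M} {t : ℝ} (hc : ContinuousAt c t)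
    (hd : DifferentiableAt ℝ (fun τ ↦ extChartAt I (c t) (c τ)) t) :
    (velocity I c t : E) = deriv (fun τ ↦ extChartAt I (c t) (c τ)) t := by
  have hx := mem_chart_source H (c t)
  have h : c =ᶠ[𝓝 t] fun τ ↦ (extChartAt I (c t)).symm (extChartAt I (c t) (c τ)) := by
    filter_upwards [hc.preimage_mem_nhds ((chartAt H (c t)).open_source.mem_nhds hx)] with τ hτ
    rw [(extChartAt I (c t)).left_inv]
    rw [extChartAt_source]
    exact hτ
  have h1 : (mfderiv 𝓘(ℝ, ℝ) I c t : ℝ →L[ℝ] E) = mfderiv 𝓘(ℝ, ℝ) I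
      (fun τ ↦ (extChartAt I (c t)).symm (extChartAt I (c t) (c τ))) t := h.mfderiv_eq
  have h2 := velocity_extChartAt_symm (I := I) (x₀ := c t) (t := t)
    (u := fun τ ↦ extChartAt I (c t) (c τ)) (mem_extChartAt_target (c t)) hd.hasDerivAt
  exact (congrArg (fun L : ℝ →L[ℝ] E ↦ L 1) h1).trans (h2.trans (chartFrame_self (I := I) (c t) _))

variable [FiniteDimensional ℝ E]

lemma vertProj_mem (g : Metric I M) (φ : M → N) (p : M) (v : TangentSpace I p) :
    vertProj I' g φ p v ∈ vertical I I' φ p :=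
  Submodule.projection_apply_mem _ _

lemma horProj_mem (g : Metric I M) (φ : M → N) (p : M) (v : TangentSpace I p) :
    horProj I' g φ p v ∈ horizontal I' g φ p :=
  Submodule.projection_apply_mem _ _

lemma vertProj_add_horProj (g : Metric I M) (φ : M → N) (p : M) (v : TangentSpace I p) :
    vertProj I' g φ p v + horProj I' g φ p v = v :=
  Submodule.projection_add_projection_eq_self _ _

lemma vertProj_of_mem (g : Metric I M) (φ : M → N) (p : M) {v : TangentSpace I p}
    (hv : v ∈ vertical I I' φ p) : vertProj I' g φ p v = v :=
  Submodule.projection_apply_of_mem_left _ hv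

lemma horProj_of_mem_vertical (g : Metric I M) (φ : M → N) (p : M) {v : TangentSpace I p}
    (hv : v ∈ vertical I I' φ p) : horProj I' g φ p v = 0 := by
  have h := vertProj_add_horProj (I' := I') g φ p v
  rw [vertProj_of_mem g φ p hv] at h
  simpa using h

lemma inner_vertProj (g : Metric I M) (φ : M → N) (p : M) (v : TangentSpace I p)
    {W : TangentSpace I p} (hW : W ∈ vertical I I' φ p) :
    g.inner p (vertProj I' g φ p v) W = g.inner p v W := by
  have h := congrArg (fun z ↦ g.inner p W z) (vertProj_add_horProj (I' := I') g φ p v)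
  simp only [map_add, horProj_mem (I' := I') g φ p v W hW, add_zero] at h
  rw [g.symm, h, g.symm]

lemma inner_horProj (g : Metric I M) (φ : M → N) (p : M) (v : TangentSpace I p)
    {X : TangentSpace I p} (hX : X ∈ horizontal I' g φ p) :
    g.inner p (horProj I' g φ p v) X = g.inner p v X := by
  have h := congrArg (fun z ↦ g.inner p z X) (vertProj_add_horProj (I' := I') g φ p v)
  simp only [map_add, add_apply, hX _ (vertProj_mem (I' := I') g φ p v), zero_add] at h
  exact h

namespace IsRiemannianSubmersion

variable {g : Metric I M} {g' : Metric I' N} {φ : M → N} (hφ : IsRiemannianSubmersion g g' φ)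

include hφ

lemma inner_self_eq {p : M} {v : TangentSpace I p} (hv : v ∈ horizontal I' g φ p) :
    g'.inner (φ p) (mfderiv I I' φ p v) (mfderiv I I' φ p v) = g.inner p v v :=
  (Real.sqrt_inj (inner_self_nonneg g' _ _) (inner_self_nonneg g _ _)).1 (hφ.length_eq p v hv)

lemma vertForm_of_horizontal {p : M} {X : TangentSpace I p} (hX : X ∈ horizontal I' g φ p)
    (v : TangentSpace I p) : vertForm g g' φ p X v = 0 := by
  have hhor : ∀ Y ∈ horizontal I' g φ p, vertForm g g' φ p X Y = 0 := by
    intro Y hY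
    have h1 := hφ.inner_self_eq hX
    have h2 := hφ.inner_self_eq hY
    have h3 := hφ.inner_self_eq ((horizontal I' g φ p).add_mem hX hY)
    simp only [map_add, add_apply] at h3
    rw [g.symm p Y X, g'.symm _ (mfderiv I I' φ p Y) (mfderiv I I' φ p X)] at h3
    rw [vertForm_apply]
    linarith
  rw [← vertProj_add_horProj (I' := I') g φ p v, map_add, hhor _ (horProj_mem g φ p v), add_zero,
    vertForm_symm, vertForm_of_vertical _ _ _ _ (vertProj_mem g φ p v)]
  exact hX _ (vertProj_mem g φ p v)

lemma vertForm_eq {p : M} (v w : TangentSpace I p) :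
    vertForm g g' φ p v w = g.inner p v (vertProj I' g φ p w) := by
  conv_lhs => rw [← vertProj_add_horProj (I' := I') g φ p w]
  rw [map_add, vertForm_symm _ _ _ _ v (horProj I' g φ p w),
    hφ.vertForm_of_horizontal (horProj_mem g φ p w), add_zero, vertForm_symm,
    vertForm_of_vertical _ _ _ _ (vertProj_mem g φ p w), g.symm]

lemma vertForm_self_eq {p : M} (v : TangentSpace I p) :
    vertForm g g' φ p v v = g.inner p (vertProj I' g φ p v) (vertProj I' g φ p v) := by
  rw [hφ.vertForm_eq, inner_vertProj _ _ _ _ (vertProj_mem g φ p v)]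

lemma vertForm_self_nonneg {p : M} (v : TangentSpace I p) : 0 ≤ vertForm g g' φ p v v := by
  rw [hφ.vertForm_self_eq]
  exact inner_self_nonneg g p _

lemma pullbackMetric_eq {p : M} (v w : TangentSpace I p) :
    pullbackMetric I g' φ p v w = g.inner p (horProj I' g φ p v) w := by
  have h1 := hφ.vertForm_eq w v
  have h2 : vertForm g g' φ p v w = g.inner p v w - pullbackMetric I g' φ p v w := rfl
  rw [vertForm_symm, h2, g.symm p w] at h1
  have h3 := congrArg (fun z ↦ g.inner p z w) (vertProj_add_horProj (I' := I') g φ p v)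
  simp only [map_add, add_apply] at h3
  linarith

variable [I.Boundaryless] [I'.Boundaryless] [FiniteDimensional ℝ E']

lemma differentiableAt_chartForm_pullbackMetric {x₀ : M} {u : E}
    (hu : u ∈ (extChartAt I x₀).target) :
    DifferentiableAt ℝ (chartForm (pullbackMetric I g' φ) x₀) u :=
  (contDiffAt_chartForm_pullbackMetric g' hφ.contMDiff hu).differentiableAt (by simp)

lemma differentiableAt_chartForm_vertForm {x₀ : M} {u : E}
    (hu : u ∈ (extChartAt I x₀).target) :
    DifferentiableAt ℝ (chartForm (vertForm g g' φ) x₀) u := by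
  rw [chartForm_vertForm]
  exact ((contDiffAt_chartMetric g hu).differentiableAt (by simp)).sub
    (hφ.differentiableAt_chartForm_pullbackMetric hu)

end IsRiemannianSubmersion

end Submersion

/-! ### The second fundamental form of the fibers -/

section SecondForm

variable {E : Type*} [NormedAddCommGroup E] [NormedSpace ℝ E]
  {H : Type*} [TopologicalSpace H] {I : ModelWithCorners ℝ E H}
  {M : Type*} [TopologicalSpace M] [ChartedSpace H M] [IsManifold I ∞ M]
  {E' : Type*} [NormedAddCommGroup E'] [NormedSpace ℝ E']
  {H' : Type*} [TopologicalSpace H'] {I' : ModelWithCorners ℝ E' H'}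
  {N : Type*} [TopologicalSpace N] [ChartedSpace H' N] [IsManifold I' ∞ N]

/-- The first-kind Christoffel symbols of the vertical part of the metric, in the chart around
`p`. For vertical `u`, `w` and horizontal `x` this is `g(T_u w, x)`, the second fundamental form of
the fiber through `p`; see `IsRiemannianSubmersion.inner_oneillTAt_horizontal`. For other arguments
it depends on the chart. -/
noncomputable def secondForm (g : Metric I M) (g' : Metric I' N) (φ : M → N) (p : M)
    (u w x : TangentSpace I p) : ℝ :=
  firstKind (chartForm (vertForm g g' φ) p) (extChartAt I p p) u w x

variable [FiniteDimensional ℝ E] [I.Boundaryless] [I'.Boundaryless] [FiniteDimensional ℝ E']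

lemma pullbackMetric_symm (g' : Metric I' N) (φ : M → N) (q : M) (v w : TangentSpace I q) :
    pullbackMetric I g' φ q v w = pullbackMetric I g' φ q w v :=
  g'.symm _ _ _

lemma fderiv_chartMap_self {φ : M → N} (hφ : ContMDiff I I' ∞ φ) (p : M) :
    fderiv ℝ (chartMap I I' φ p (φ p)) (extChartAt I p p) = (mfderiv I I' φ p : E →L[ℝ] E') := by
  have h : (mfderiv I I' φ p : E →L[ℝ] E') = _ := if_pos (hφ.mdifferentiable (by simp) p)
  rw [h, I.range_eq_univ, fderivWithin_univ]
  rfl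

lemma eventually_horizontalPart (g : Metric I M) (g' : Metric I' N) (φ : M → N) (p : M) (w : E) :
    ∀ᶠ x in 𝓝 (extChartAt I p p), ∀ b, chartMetric g p x ((chartMetric g p x).inverse
      (chartForm (pullbackMetric I g' φ) p x w)) b = chartForm (pullbackMetric I g' φ) p x w b := by
  filter_upwards [(isOpen_extChartAt_target p).mem_nhds (mem_extChartAt_target (I := I) p)]
    with x hx b
  exact apply_inverse_apply (isInvertible_chartMetric g hx) _ _

lemma oneillTAt_eq (g : Metric I M) (φ : M → N) (p : M) (v w : TangentSpace I p) :
    oneillTAt I' g φ p v w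
      = horProj I' g φ p (covDeriv g (fun x ↦ vertProj I' g φ x (FiberBundle.extend E w x)) p
          (vertProj I' g φ p v))
        + vertProj I' g φ p (covDeriv g (fun x ↦ horProj I' g φ x (FiberBundle.extend E w x)) p
          (vertProj I' g φ p v)) := by
  unfold oneillTAt oneillT
  rw [FiberBundle.extend_apply_self]

namespace IsRiemannianSubmersion

variable {g : Metric I M} {g' : Metric I' N} {φ : M → N} (hφ : IsRiemannianSubmersion g g' φ)

include hφ

lemma isLocalSubmersion (p : M) :
    IsLocalSubmersion (chartMetric g p) (chartForm (pullbackMetric I g' φ) p)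
      (chartMetric g' (φ p)) (chartMap I I' φ p (φ p)) (extChartAt I p p) := by
  have hu := mem_extChartAt_target (I := I) p
  have hy : φ ((extChartAt I p).symm (extChartAt I p p)) ∈ (chartAt H' (φ p)).source := by
    rw [extChartAt_to_inv]
    exact mem_chart_source _ _
  have ht : chartMap I I' φ p (φ p) (extChartAt I p p) ∈ (extChartAt I' (φ p)).target :=
    (extChartAt I' _).map_source (by rw [extChartAt_source]; exact hy)
  exact
    { contDiffAt_map := (contDiffAt_chartMap hφ.contMDiff hu hy).of_le
        (WithTop.coe_le_coe.2 le_top)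
      differentiableAt_metric := (contDiffAt_chartMetric g hu).differentiableAt (by simp)
      differentiableAt_metric' := (contDiffAt_chartMetric g' ht).differentiableAt (by simp)
      pullback := chartForm_pullbackMetric_eventuallyEq g' hφ.contMDiff hu hy
      differentiableAt_pullback := hφ.differentiableAt_chartForm_pullbackMetric hu
      symm := .of_forall fun x ↦ chartMetric_symm g p x
      symm_pullback := .of_forall fun x a b ↦
        pullbackMetric_symm g' φ _ (chartFrame I p x a) (chartFrame I p x b)
      symm' := chartMetric_symm g' _ _
      nonneg := .of_forall fun x a ↦ hφ.vertForm_self_nonneg (chartFrame I p x a) }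

lemma fderiv_chartMap_vertical {p : M} {U : TangentSpace I p} (hU : U ∈ vertical I I' φ p) :
    fderiv ℝ (chartMap I I' φ p (φ p)) (extChartAt I p p) (U : E) = 0 := by
  rw [fderiv_chartMap_self hφ.contMDiff p]
  exact hU

lemma chartForm_sub_horizontal {p : M} {X : TangentSpace I p} (hX : X ∈ horizontal I' g φ p)
    (b : E) : (chartMetric g p (extChartAt I p p)
      - chartForm (pullbackMetric I g' φ) p (extChartAt I p p)) b (X : E) = 0 :=
  (chartForm_self (vertForm g g' φ) p (b : TangentSpace I p) X).trans
    ((vertForm_symm g g' φ p _ X).trans (hφ.vertForm_of_horizontal hX _))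

lemma secondForm_add_self {p : M} (a b w : TangentSpace I p) :
    secondForm g g' φ p (a + b) (a + b) w
      = secondForm g g' φ p a a w + 2 * secondForm g g' φ p a b w + secondForm g g' φ p b b w :=
  firstKind_add_add_self (hφ.isLocalSubmersion p).differentiableAt_sub
    (hφ.isLocalSubmersion p).symm_sub a b w

/-- Along a geodesic, the derivative of the squared length of the vertical part of the velocity
is twice the second fundamental form of the fiber, evaluated on the vertical and horizontal parts
of the velocity. -/
lemma hasDerivAt_vertForm {c : ℝ → M} {s : Set ℝ} (hs : IsOpen s) (hc : IsGeodesicOn g c s) {t : ℝ}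
    (ht : t ∈ s) :
    HasDerivAt (fun τ ↦ vertForm g g' φ (c τ) (velocity I c τ) (velocity I c τ))
      (2 * secondForm g g' φ (c t) (vertProj I' g φ (c t) (velocity I c t))
        (vertProj I' g φ (c t) (velocity I c t)) (horProj I' g φ (c t) (velocity I c t))) t := by
  have hu := mem_extChartAt_target (I := I) (c t)
  have hx := mem_chart_source H (c t)
  have hP := hφ.differentiableAt_chartForm_vertForm hu
  have h := hc.hasDerivAt_form hs ht (vertForm g g' φ) (vertForm_symm g g' φ) hx hP
  obtain ⟨hd, -⟩ := hc.differentiability hs ht hx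
  have hv0 := velocity_eq_deriv hd.self_of_nhds.2.2.1 hd.self_of_nhds.2.2.2
  have hv := vertProj_add_horProj (I' := I') g φ (c t) (velocity I c t)
  have hv1 : ((vertProj I' g φ (c t) (velocity I c t) : E)
      + (horProj I' g φ (c t) (velocity I c t) : E) : E)
        = deriv (fun τ ↦ extChartAt I (c t) (c τ)) t := hv.trans hv0
  rw [← hv1] at h
  refine h.congr_deriv (congrArg (2 * ·) ?_)
  exact (hφ.isLocalSubmersion (c t)).firstKind_sub_self
    (hφ.fderiv_chartMap_vertical (vertProj_mem g φ (c t) (velocity I c t)))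
    (hφ.chartForm_sub_horizontal (horProj_mem g φ (c t) (velocity I c t)))
    (chartMetric_christoffel g hu _ _)

/-! ### O'Neill's tensor `T` -/

/-- The horizontal part of the constant extension of a vector, in coordinates. -/
lemma inverse_chartFrame_horProj (p : M) (w : TangentSpace I p) {u : E}
    (hu : u ∈ (extChartAt I p).target) :
    (chartFrame I p u).inverse (horProj I' g φ _ (FiberBundle.extend E w ((extChartAt I p).symm u)))
      = (chartMetric g p u).inverse (chartForm (pullbackMetric I g' φ) p u (w : E)) := by
  rw [extend_eq_chartFrame p w hu]
  obtain ⟨e, he⟩ := isInvertible_chartFrame (I := I) hu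
  obtain ⟨e', he'⟩ := isInvertible_chartMetric g hu
  have h : chartMetric g p u ((chartFrame I p u).inverse
      (horProj I' g φ _ (chartFrame I p u (w : E))))
      = chartForm (pullbackMetric I g' φ) p u (w : E) := by
    ext b
    have h1 := hφ.pullbackMetric_eq (chartFrame I p u (w : E)) (chartFrame I p u b)
    have h2 : chartFrame I p u
        ((chartFrame I p u).inverse (horProj I' g φ _ (chartFrame I p u (w : E))))
          = horProj I' g φ _ (chartFrame I p u (w : E)) := by
      rw [← he, ContinuousLinearMap.inverse_equiv]
      exact e.apply_symm_apply _
    exact (congrArg (fun z ↦ g.inner ((extChartAt I p).symm u) z (chartFrame I p u b)) h2).trans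
      h1.symm
  rw [← h, ← he', ContinuousLinearMap.inverse_equiv]
  exact (e'.symm_apply_apply _).symm

lemma inverse_chartFrame_vertProj (p : M) (w : TangentSpace I p) {u : E}
    (hu : u ∈ (extChartAt I p).target) :
    (chartFrame I p u).inverse
        (vertProj I' g φ _ (FiberBundle.extend E w ((extChartAt I p).symm u)))
      + (chartMetric g p u).inverse (chartForm (pullbackMetric I g' φ) p u (w : E)) = (w : E) := by
  rw [← hφ.inverse_chartFrame_horProj p w hu]
  have h := vertProj_add_horProj (I' := I') g φ _
    (FiberBundle.extend E w ((extChartAt I p).symm u))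
  have h1 : (chartFrame I p u).inverse (FiberBundle.extend E w ((extChartAt I p).symm u))
      = (w : E) := by
    obtain ⟨e, he⟩ := isInvertible_chartFrame (I := I) hu
    rw [extend_eq_chartFrame p w hu, ← he, ContinuousLinearMap.inverse_equiv]
    exact e.symm_apply_apply _
  have h2 := congrArg (chartFrame I p u).inverse h
  rw [map_add, h1] at h2
  exact h2

lemma differentiableAt_horizontalPart (p : M) (w : E) :
    DifferentiableAt ℝ (fun u ↦ (chartMetric g p u).inverse
      (chartForm (pullbackMetric I g' φ) p u w)) (extChartAt I p p) := by
  have hu := mem_extChartAt_target (I := I) p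
  have h1 : DifferentiableAt ℝ (fun u ↦ (chartMetric g p u).inverse) (extChartAt I p p) :=
    DifferentiableAt.comp (g := ContinuousLinearMap.inverse) _
      ((isInvertible_chartMetric g hu).contDiffAt_map_inverse (n := 1)
        |>.differentiableAt (by simp))
      ((contDiffAt_chartMetric g hu).differentiableAt (by simp))
  exact h1.clm_apply ((hφ.differentiableAt_chartForm_pullbackMetric hu).clm_apply
    (differentiableAt_const w))

lemma horizontalPart_self (p : M) (w : TangentSpace I p) :
    (chartMetric g p (extChartAt I p p)).inverse
      (chartForm (pullbackMetric I g' φ) p (extChartAt I p p) (w : E))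
      = (horProj I' g φ p w : E) := by
  have hu := mem_extChartAt_target (I := I) p
  obtain ⟨e', he'⟩ := isInvertible_chartMetric g hu
  have h : chartMetric g p (extChartAt I p p) (horProj I' g φ p w : E)
      = chartForm (pullbackMetric I g' φ) p (extChartAt I p p) (w : E) := by
    ext b
    exact (chartForm_self g.inner p (horProj I' g φ p w) (b : TangentSpace I p)).trans
      ((hφ.pullbackMetric_eq w (b : TangentSpace I p)).symm.trans
        (chartForm_self (pullbackMetric I g' φ) p w (b : TangentSpace I p)).symm)
  rw [← h, ← he', ContinuousLinearMap.inverse_equiv]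
  exact e'.symm_apply_apply _

/-- For vertical `U` and horizontal `X`, the inner product `g(∇_U 𝓥w, X)`. -/
lemma inner_covDeriv_vertProj {p : M} (w : TangentSpace I p) {U X : TangentSpace I p}
    (hU : U ∈ vertical I I' φ p) (hX : X ∈ horizontal I' g φ p) :
    g.inner p (covDeriv g (fun x ↦ vertProj I' g φ x (FiberBundle.extend E w x)) p U) X
      = secondForm g g' φ p U (vertProj I' g φ p w) X := by
  have hu := mem_extChartAt_target (I := I) p
  -- Tangent vectors are renamed as vectors of `E`, the space in which the chart computes:
  -- rewriting does not see through `TangentSpace`.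
  obtain ⟨w₀, hw₀⟩ : ∃ w₀ : E, w₀ = w := ⟨w, rfl⟩
  obtain ⟨V₀, hV₀⟩ : ∃ V₀ : E, V₀ = vertProj I' g φ p w := ⟨_, rfl⟩
  obtain ⟨X₀, hX₀⟩ : ∃ X₀ : E, X₀ = horProj I' g φ p w := ⟨_, rfl⟩
  obtain ⟨U₀, hU₀⟩ : ∃ U₀ : E, U₀ = U := ⟨U, rfl⟩
  obtain ⟨Z₀, hZ₀⟩ : ∃ Z₀ : E, Z₀ = X := ⟨X, rfl⟩
  have hv : V₀ + X₀ = w₀ := by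
    rw [hV₀, hX₀, hw₀]
    exact vertProj_add_horProj (I' := I') g φ p w
  have h := (hφ.isLocalSubmersion p).metric_covDeriv_vertical
    (W := V₀) (X := X₀) (X' := Z₀) (U := U₀) (Γ := christoffel g p (extChartAt I p p) U₀ V₀)
    (by rw [hU₀]; exact hφ.fderiv_chartMap_vertical hU)
    (by rw [hV₀]; exact hφ.fderiv_chartMap_vertical (vertProj_mem g φ p w))
    (by rw [hX₀]; exact hφ.chartForm_sub_horizontal (horProj_mem g φ p w))
    (by rw [hZ₀]; exact hφ.chartForm_sub_horizontal hX)
    (hφ.differentiableAt_horizontalPart p (V₀ + X₀))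
    (by rw [hv, hw₀, hX₀]; exact hφ.horizontalPart_self p w)
    (eventually_horizontalPart g g' φ p (V₀ + X₀)) (chartMetric_christoffel g hu _ _)
  have hY : VectorField.mpullback 𝓘(ℝ, E) I (extChartAt I p).symm
      (fun x ↦ vertProj I' g φ x (FiberBundle.extend E w x)) =ᶠ[𝓝 (extChartAt I p p)]
      fun x ↦ (w₀ - (chartMetric g p x).inverse
        (chartForm (pullbackMetric I g' φ) p x (V₀ + X₀)) : E) := by
    filter_upwards [(isOpen_extChartAt_target p).mem_nhds hu] with x hx
    rw [hv, hw₀]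
    exact eq_sub_of_add_eq (hφ.inverse_chartFrame_vertProj p w hx)
  have hfd : ∀ U₀ : E, fderiv ℝ (VectorField.mpullback 𝓘(ℝ, E) I (extChartAt I p).symm
      (fun x ↦ vertProj I' g φ x (FiberBundle.extend E w x)) : E → E) (extChartAt I p p) U₀
      = -fderiv ℝ (fun x ↦ (chartMetric g p x).inverse
        (chartForm (pullbackMetric I g' φ) p x (V₀ + X₀))) (extChartAt I p p) U₀ := by
    intro U₀
    refine (congrArg (fun L : E →L[ℝ] E ↦ L U₀) hY.fderiv_eq).trans ?_
    exact congrArg (fun L : E →L[ℝ] E ↦ L U₀) (fderiv_const_sub w₀)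
  have hext : V₀ = vertProj I' g φ p (FiberBundle.extend E w p) := by
    rw [FiberBundle.extend_apply_self]
    exact hV₀
  rw [← hfd, hext] at h
  rw [← hV₀, hext]
  subst hU₀ hZ₀
  exact (chartForm_self g.inner p _ _).symm.trans h

/-- For vertical `W`, the inner product `g(∇_U 𝓗w, W)`. -/
lemma inner_covDeriv_horProj {p : M} (w : TangentSpace I p) {U W : TangentSpace I p}
    (hW : W ∈ vertical I I' φ p) :
    g.inner p (covDeriv g (fun x ↦ horProj I' g φ x (FiberBundle.extend E w x)) p U) W
      = -secondForm g g' φ p U W (horProj I' g φ p w) := by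
  have hu := mem_extChartAt_target (I := I) p
  obtain ⟨w₀, hw₀⟩ : ∃ w₀ : E, w₀ = w := ⟨w, rfl⟩
  obtain ⟨V₀, hV₀⟩ : ∃ V₀ : E, V₀ = vertProj I' g φ p w := ⟨_, rfl⟩
  obtain ⟨X₀, hX₀⟩ : ∃ X₀ : E, X₀ = horProj I' g φ p w := ⟨_, rfl⟩
  obtain ⟨U₀, hU₀⟩ : ∃ U₀ : E, U₀ = U := ⟨U, rfl⟩
  obtain ⟨Z₀, hZ₀⟩ : ∃ Z₀ : E, Z₀ = W := ⟨W, rfl⟩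
  have hv : V₀ + X₀ = w₀ := by
    rw [hV₀, hX₀, hw₀]
    exact vertProj_add_horProj (I' := I') g φ p w
  have h := (hφ.isLocalSubmersion p).metric_covDeriv_horizontal
    (W := V₀) (X := X₀) (W' := Z₀) (U := U₀) (Γ := christoffel g p (extChartAt I p p) U₀ X₀)
    (by rw [hV₀]; exact hφ.fderiv_chartMap_vertical (vertProj_mem g φ p w))
    (by rw [hZ₀]; exact hφ.fderiv_chartMap_vertical hW)
    (hφ.differentiableAt_horizontalPart p (V₀ + X₀))
    (by rw [hv, hw₀, hX₀]; exact hφ.horizontalPart_self p w)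
    (eventually_horizontalPart g g' φ p (V₀ + X₀)) (chartMetric_christoffel g hu _ _)
  have hY : VectorField.mpullback 𝓘(ℝ, E) I (extChartAt I p).symm
      (fun x ↦ horProj I' g φ x (FiberBundle.extend E w x)) =ᶠ[𝓝 (extChartAt I p p)]
      fun x ↦ ((chartMetric g p x).inverse
        (chartForm (pullbackMetric I g' φ) p x (V₀ + X₀)) : E) := by
    filter_upwards [(isOpen_extChartAt_target p).mem_nhds hu] with x hx
    rw [hv, hw₀]
    exact hφ.inverse_chartFrame_horProj p w hx
  have hfd : ∀ U₀ : E, fderiv ℝ (VectorField.mpullback 𝓘(ℝ, E) I (extChartAt I p).symm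
      (fun x ↦ horProj I' g φ x (FiberBundle.extend E w x)) : E → E) (extChartAt I p p) U₀
      = fderiv ℝ (fun x ↦ (chartMetric g p x).inverse
        (chartForm (pullbackMetric I g' φ) p x (V₀ + X₀))) (extChartAt I p p) U₀ :=
    fun U₀ ↦ congrArg (fun L : E →L[ℝ] E ↦ L U₀) hY.fderiv_eq
  have hext : X₀ = horProj I' g φ p (FiberBundle.extend E w p) := by
    rw [FiberBundle.extend_apply_self]
    exact hX₀
  rw [← hfd, hext] at h
  rw [← hX₀, hext]
  subst hU₀ hZ₀
  exact (chartForm_self g.inner p _ _).symm.trans h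

lemma inner_oneillTAt_horizontal {p : M} (v w : TangentSpace I p) {X : TangentSpace I p}
    (hX : X ∈ horizontal I' g φ p) :
    g.inner p (oneillTAt I' g φ p v w) X
      = secondForm g g' φ p (vertProj I' g φ p v) (vertProj I' g φ p w) X := by
  rw [oneillTAt_eq, map_add, add_apply, inner_horProj _ _ _ _ hX,
    hX _ (vertProj_mem (I' := I') g φ p _), add_zero]
  exact hφ.inner_covDeriv_vertProj w (vertProj_mem g φ p v) hX

lemma inner_oneillTAt_vertical {p : M} (v w : TangentSpace I p) {W : TangentSpace I p}
    (hW : W ∈ vertical I I' φ p) :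
    g.inner p (oneillTAt I' g φ p v w) W
      = -secondForm g g' φ p (vertProj I' g φ p v) W (horProj I' g φ p w) := by
  rw [oneillTAt_eq, map_add, add_apply, inner_vertProj _ _ _ _ hW, g.symm p _ W,
    horProj_mem (I' := I') g φ p _ W hW, zero_add]
  exact hφ.inner_covDeriv_horProj w hW

end IsRiemannianSubmersion

end SecondForm

/-! ### Geometry of the fibers in terms of the second fundamental form -/

section Fibers

variable {E : Type*} [NormedAddCommGroup E] [NormedSpace ℝ E]
  {H : Type*} [TopologicalSpace H] {I : ModelWithCorners ℝ E H}
  {M : Type*} [TopologicalSpace M] [ChartedSpace H M] [IsManifold I ∞ M]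
  {E' : Type*} [NormedAddCommGroup E'] [NormedSpace ℝ E']
  {H' : Type*} [TopologicalSpace H'] {I' : ModelWithCorners ℝ E' H'}
  {N : Type*} [TopologicalSpace N] [ChartedSpace H' N] [IsManifold I' ∞ N]
  [FiniteDimensional ℝ E]

lemma eq_of_inner_eq (g : Metric I M) {p : M} {v w : TangentSpace I p}
    (h : ∀ z, g.inner p v z = g.inner p w z) : v = w := by
  by_contra hne
  refine (g.pos p (v - w) (sub_ne_zero.2 hne)).ne' ?_
  rw [(g.inner p).map_sub v w, sub_apply, h, sub_self]

lemma eq_of_inner_vertical_horizontal (g : Metric I M) (φ : M → N) {p : M} {v w : TangentSpace I p}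
    (hV : ∀ W ∈ vertical I I' φ p, g.inner p v W = g.inner p w W)
    (hH : ∀ X ∈ horizontal I' g φ p, g.inner p v X = g.inner p w X) : v = w := by
  refine eq_of_inner_eq g fun z ↦ ?_
  rw [← vertProj_add_horProj (I' := I') g φ p z, map_add, map_add, hV _ (vertProj_mem g φ p z),
    hH _ (horProj_mem g φ p z)]

lemma inner_grad (g : Metric I M) (ψ : M → ℝ) (p : M) (v : TangentSpace I p) :
    g.inner p (grad g ψ p) v = mvfderiv I ψ p v := by
  have h := isInvertible_of_posDef (E := E) (g.inner p) (g.pos p)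
  exact apply_inverse_apply (E := E) h (mvfderiv I ψ p) v

variable [I.Boundaryless] [I'.Boundaryless] [FiniteDimensional ℝ E']

lemma secondForm_zero (g : Metric I M) (g' : Metric I' N) (φ : M → N) (p : M)
    (u w : TangentSpace I p) : secondForm g g' φ p u w 0 = 0 := by
  have h : ∀ a b : E, firstKind (chartForm (vertForm g g' φ) p) (extChartAt I p p) a b 0
      = 1 / 2 * (fderiv ℝ (chartForm (vertForm g g' φ) p) (extChartAt I p p) a b 0
        + fderiv ℝ (chartForm (vertForm g g' φ) p) (extChartAt I p p) b a 0
        - fderiv ℝ (chartForm (vertForm g g' φ) p) (extChartAt I p p) 0 a b) := fun _ _ ↦ rfl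
  simp only [map_zero, zero_apply, add_zero, sub_zero, mul_zero] at h
  exact h u w

namespace IsRiemannianSubmersion

variable {g : Metric I M} {g' : Metric I' N} {φ : M → N} (hφ : IsRiemannianSubmersion g g' φ)

include hφ

lemma secondForm_eq_of_forall_self {p : M} {b : ℝ} {X : TangentSpace I p}
    (h : ∀ U ∈ vertical I I' φ p, secondForm g g' φ p U U X = g.inner p U U * b)
    {U W : TangentSpace I p} (hU : U ∈ vertical I I' φ p) (hW : W ∈ vertical I I' φ p) :
    secondForm g g' φ p U W X = g.inner p U W * b := by
  have h1 := hφ.secondForm_add_self U W X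
  rw [h _ hU, h _ hW, h _ ((vertical I I' φ p).add_mem hU hW)] at h1
  simp only [map_add, add_apply] at h1
  rw [g.symm p W U] at h1
  linarith

lemma hasTotallyGeodesicFibers_iff :
    HasTotallyGeodesicFibers I' g φ ↔ ∀ p, ∀ U ∈ vertical I I' φ p, ∀ X ∈ horizontal I' g φ p,
      secondForm g g' φ p U U X = 0 := by
  constructor
  · intro h p U hU X hX
    have h1 := hφ.inner_oneillTAt_horizontal U U hX
    rw [h p, vertProj_of_mem g φ p hU] at h1
    simpa using h1.symm
  · intro h p v w
    have h2 : ∀ X ∈ horizontal I' g φ p, ∀ U ∈ vertical I I' φ p, ∀ W ∈ vertical I I' φ p,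
        secondForm g g' φ p U W X = 0 := by
      intro X hX U hU W hW
      simpa using hφ.secondForm_eq_of_forall_self (b := 0) (X := X)
        (fun U hU ↦ by simpa using h p U hU X hX) hU hW
    refine eq_of_inner_vertical_horizontal (I' := I') g φ (fun W hW ↦ ?_) fun X hX ↦ ?_
    · rw [hφ.inner_oneillTAt_vertical v w hW,
        h2 _ (horProj_mem g φ p w) _ (vertProj_mem g φ p v) _ hW]
      simp
    · rw [hφ.inner_oneillTAt_horizontal v w hX,
        h2 _ hX _ (vertProj_mem g φ p v) _ (vertProj_mem g φ p w)]
      simp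

/-- If the second fundamental form is `g(U, U) g(Z, X)`, then `T_U W = g(U, W) Z`. -/
lemma oneillTAt_eq_smul {p : M} {Z : TangentSpace I p} (hZ : Z ∈ horizontal I' g φ p)
    (h : ∀ U ∈ vertical I I' φ p, ∀ X ∈ horizontal I' g φ p,
      secondForm g g' φ p U U X = g.inner p U U * g.inner p Z X)
    {U W : TangentSpace I p} (hU : U ∈ vertical I I' φ p) (hW : W ∈ vertical I I' φ p) :
    oneillTAt I' g φ p U W = g.inner p U W • Z := by
  refine eq_of_inner_vertical_horizontal (I' := I') g φ (fun W' hW' ↦ ?_) fun X hX ↦ ?_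
  · rw [hφ.inner_oneillTAt_vertical U W hW', horProj_of_mem_vertical g φ p hW, secondForm_zero,
      map_smul, smul_apply, g.symm p Z, hZ W' hW']
    simp
  · rw [hφ.inner_oneillTAt_horizontal U W hX, vertProj_of_mem g φ p hU, vertProj_of_mem g φ p hW,
      hφ.secondForm_eq_of_forall_self (fun U hU ↦ h U hU X hX) hU hW, map_smul, smul_apply,
      smul_eq_mul]

lemma meanCurvature_eq {p : M} {Z : TangentSpace I p} (hZ : Z ∈ horizontal I' g φ p)
    (h : ∀ U ∈ vertical I I' φ p, ∀ X ∈ horizontal I' g φ p,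
      secondForm g g' φ p U U X = g.inner p U U * g.inner p Z X)
    (hne : ∃ U ∈ vertical I I' φ p, U ≠ 0) :
    meanCurvature I' g φ p = Z := by
  have hfin : FiniteDimensional ℝ (TangentSpace I p) := inferInstanceAs (FiniteDimensional ℝ E)
  unfold meanCurvature
  set b := (exists_orthonormal_basis g p (vertical I I' φ p)).choose
  have hb := (exists_orthonormal_basis g p (vertical I I' φ p)).choose_spec
  have hT : ∀ i, oneillTAt I' g φ p (b i) (b i) = Z := by
    intro i
    rw [hφ.oneillTAt_eq_smul hZ h (b i).2 (b i).2, hb i i, if_pos rfl, one_smul]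
  have hk : (Module.finrank ℝ (vertical I I' φ p) : ℝ) ≠ 0 := by
    obtain ⟨U, hU, hU0⟩ := hne
    have : Nontrivial (vertical I I' φ p) :=
      ⟨⟨U, hU⟩, 0, fun h0 ↦ hU0 (congrArg Subtype.val h0)⟩
    exact_mod_cast Module.finrank_pos.ne'
  simp only [hT, Finset.sum_const, Finset.card_univ, Fintype.card_fin]
  rw [← Nat.cast_smul_eq_nsmul ℝ, smul_smul, inv_mul_cancel₀ hk, one_smul]

lemma secondForm_of_umbilical (h : HasTotallyUmbilicalFibers I' g φ) {p : M}
    {U X : TangentSpace I p} (hU : U ∈ vertical I I' φ p) (hX : X ∈ horizontal I' g φ p) :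
    secondForm g g' φ p U U X = g.inner p U U * g.inner p (meanCurvature I' g φ p) X := by
  have h1 := hφ.inner_oneillTAt_horizontal U U hX
  rw [h p U hU U hU, vertProj_of_mem g φ p hU, map_smul, smul_apply, smul_eq_mul] at h1
  exact h1.symm

end IsRiemannianSubmersion

end Fibers

/-! ### The infinitesimal Clairaut condition -/

section ClairautCondition

variable {E : Type*} [NormedAddCommGroup E] [NormedSpace ℝ E]
  {H : Type*} [TopologicalSpace H] {I : ModelWithCorners ℝ E H}
  {M : Type*} [TopologicalSpace M] [ChartedSpace H M] [IsManifold I ∞ M]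
  {E' : Type*} [NormedAddCommGroup E'] [NormedSpace ℝ E']
  {H' : Type*} [TopologicalSpace H'] {I' : ModelWithCorners ℝ E' H'}
  {N : Type*} [TopologicalSpace N] [ChartedSpace H' N] [IsManifold I' ∞ N]
  [FiniteDimensional ℝ E]

lemma hasDerivAt_comp_velocity {ψ : M → ℝ} (hψ : ContMDiff I 𝓘(ℝ, ℝ) ∞ ψ) {c : ℝ → M} {t : ℝ}
    (hc : MDifferentiableAt 𝓘(ℝ, ℝ) I c t) :
    HasDerivAt (fun τ ↦ ψ (c τ)) (mvfderiv I ψ (c t) (velocity I c t)) t := by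
  have h := mfderiv_comp (I := 𝓘(ℝ, ℝ)) (I' := I) (I'' := 𝓘(ℝ, ℝ)) t
    (hψ.mdifferentiable (by simp) (c t)) hc
  have hd : DifferentiableAt ℝ (fun τ ↦ ψ (c τ)) t :=
    ((hψ.mdifferentiable (by simp) (c t)).comp t hc).differentiableAt
  rw [mfderiv_eq_fderiv] at h
  have h1 := congrArg (fun L : ℝ →L[ℝ] ℝ ↦ L 1) h
  have h2 : deriv (fun τ ↦ ψ (c τ)) t = mvfderiv I ψ (c t) (velocity I c t) := by
    rw [← fderiv_apply_one_eq_deriv]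
    exact h1
  rw [← h2]
  exact hd.hasDerivAt

namespace IsRiemannianSubmersion

variable {g : Metric I M} {g' : Metric I' N} {φ : M → N} (hφ : IsRiemannianSubmersion g g' φ)

include hφ

/-- `sin ω` is the ratio of the lengths of `𝓥v` and `v`. -/
lemma exp_mul_sin_angle (a : ℝ) {p : M} {v : TangentSpace I p} (hv : v ≠ 0) :
    Real.exp a * Real.sin (angleToHorizontal I' g φ v)
      = √(Real.exp (2 * a) * vertForm g g' φ p v v / g.inner p v v) := by
  have hpos := g.pos p v hv
  have hX := horProj_mem (I' := I') g φ p v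
  have h1 : g.inner p v v = vertForm g g' φ p v v
      + g.inner p (horProj I' g φ p v) (horProj I' g φ p v) := by
    rw [inner_horProj _ _ _ _ hX, hφ.vertForm_eq, ← map_add, vertProj_add_horProj]
  have h2 := inner_self_nonneg g p (horProj I' g φ p v)
  rw [angleToHorizontal, Real.sin_arccos, length, length, div_pow, Real.sq_sqrt h2,
    Real.sq_sqrt hpos.le]
  have h3 : 1 - g.inner p (horProj I' g φ p v) (horProj I' g φ p v) / g.inner p v v
      = vertForm g g' φ p v v / g.inner p v v := by
    rw [one_sub_div hpos.ne']
    congr 1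
    linarith
  rw [h3, mul_div_assoc, Real.sqrt_mul (Real.exp_pos _).le, two_mul, Real.exp_add,
    Real.sqrt_mul_self (Real.exp_pos _).le]

variable [I.Boundaryless] [I'.Boundaryless] [FiniteDimensional ℝ E']

lemma hasDerivAt_exp_mul_vertForm {ψ : M → ℝ} (hψ : ContMDiff I 𝓘(ℝ, ℝ) ∞ ψ) {c : ℝ → M}
    {s : Set ℝ} (hs : IsOpen s) (hc : IsGeodesicOn g c s) {t : ℝ} (ht : t ∈ s) :
    HasDerivAt (fun τ ↦ Real.exp (2 * ψ (c τ)) *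
        vertForm g g' φ (c τ) (velocity I c τ) (velocity I c τ))
      (2 * Real.exp (2 * ψ (c t)) *
        (secondForm g g' φ (c t) (vertProj I' g φ (c t) (velocity I c t))
          (vertProj I' g φ (c t) (velocity I c t)) (horProj I' g φ (c t) (velocity I c t))
        + mvfderiv I ψ (c t) (velocity I c t) *
          vertForm g g' φ (c t) (velocity I c t) (velocity I c t))) t := by
  have h1 := hφ.hasDerivAt_vertForm hs hc ht
  have hcd : MDifferentiableAt 𝓘(ℝ, ℝ) I c t :=
    (hc.1.contMDiffAt (hs.mem_nhds ht)).mdifferentiableAt (by simp)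
  have h2 := ((hasDerivAt_comp_velocity hψ hcd).const_mul 2).exp
  refine (h2.mul h1).congr_deriv ?_
  ring

/-- The Clairaut condition, differentiated along the geodesics: at every point,
`g(T_U U, X) = -g(∇ψ, U + X) g(U, U)` for vertical `U` and horizontal `X`. -/
theorem isClairautWith_exp_iff {ψ : M → ℝ} (hψ : ContMDiff I 𝓘(ℝ, ℝ) ∞ ψ) :
    IsClairautWith I' g φ (fun p ↦ Real.exp (ψ p)) ↔
      ∀ p, ∀ U ∈ vertical I I' φ p, ∀ X ∈ horizontal I' g φ p,
        secondForm g g' φ p U U X + mvfderiv I ψ p (U + X) * g.inner p U U = 0 := by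
  constructor
  · rintro ⟨-, h⟩ p U hU X hX
    -- At time `0`, the squares of the constants of motion `exp ψ sin ω` and `|v|` are
    -- differentiated along the geodesic with initial velocity `z`.
    have key : ∀ z : TangentBundle I M, z.2 ≠ 0 →
        secondForm g g' φ z.1 (vertProj I' g φ z.1 z.2) (vertProj I' g φ z.1 z.2)
          (horProj I' g φ z.1 z.2) + mvfderiv I ψ z.1 z.2 * vertForm g g' φ z.1 z.2 z.2 = 0 := by
      intro z hz
      obtain ⟨c, s, hso, hsc, h0, hc, hvel, hz0⟩ := exists_geodesic g z.1 z.2 hz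
      have hd := hφ.hasDerivAt_exp_mul_vertForm hψ hso hc h0
      have hd' := (hc.hasDerivAt_metric hso h0).const_mul
        (Real.exp (2 * ψ (c 0)) * vertForm g g' φ (c 0) (velocity I c 0) (velocity I c 0)
          / g.inner (c 0) (velocity I c 0) (velocity I c 0))
      have hev : (fun τ ↦ Real.exp (2 * ψ (c τ)) *
          vertForm g g' φ (c τ) (velocity I c τ) (velocity I c τ)) =ᶠ[𝓝 0] fun τ ↦
          Real.exp (2 * ψ (c 0)) * vertForm g g' φ (c 0) (velocity I c 0) (velocity I c 0)
          / g.inner (c 0) (velocity I c 0) (velocity I c 0)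
            * g.inner (c τ) (velocity I c τ) (velocity I c τ) := by
        filter_upwards [hso.mem_nhds h0] with τ hτ
        have h1 := h c s hso hsc hc hvel τ hτ 0 h0
        have hpos := fun τ hτ ↦ g.pos (c τ) (velocity I c τ) (hvel τ hτ)
        have hnn : ∀ τ ∈ s, 0 ≤ Real.exp (2 * ψ (c τ)) *
            vertForm g g' φ (c τ) (velocity I c τ) (velocity I c τ)
              / g.inner (c τ) (velocity I c τ) (velocity I c τ) := fun τ hτ ↦
          div_nonneg (mul_nonneg (Real.exp_pos _).le (hφ.vertForm_self_nonneg _)) (hpos τ hτ).le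
        rw [hφ.exp_mul_sin_angle _ (hvel τ hτ), hφ.exp_mul_sin_angle _ (hvel 0 h0),
          Real.sqrt_inj (hnn τ hτ) (hnn 0 h0)] at h1
        rw [← h1, div_mul_cancel₀ _ (hpos τ hτ).ne']
      have h2 := hd.unique (hd'.congr_of_eventuallyEq hev)
      rw [mul_zero, mul_eq_zero] at h2
      have h3 := h2.resolve_left (by positivity)
      have h4 : ∀ z' : TangentBundle I M, z' = z →
          secondForm g g' φ z'.1 (vertProj I' g φ z'.1 z'.2) (vertProj I' g φ z'.1 z'.2)
            (horProj I' g φ z'.1 z'.2) + mvfderiv I ψ z'.1 z'.2 * vertForm g g' φ z'.1 z'.2 z'.2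
              = 0 →
          secondForm g g' φ z.1 (vertProj I' g φ z.1 z.2) (vertProj I' g φ z.1 z.2)
            (horProj I' g φ z.1 z.2) + mvfderiv I ψ z.1 z.2 * vertForm g g' φ z.1 z.2 z.2
              = 0 := by
        rintro z' rfl h
        exact h
      exact h4 _ hz0 h3
    rcases eq_or_ne (U + X) 0 with h0 | h0
    · have hU0 : U = 0 := by
        by_contra hne
        refine (g.pos p U hne).ne' ?_
        have h1 := hX U hU
        rw [eq_neg_of_add_eq_zero_right h0, map_neg, neg_eq_zero] at h1
        exact h1
      have hX0 : X = 0 := by rwa [hU0, zero_add] at h0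
      rw [hX0, secondForm_zero, hU0]
      simp
    · have h1 := key ⟨p, U + X⟩ h0
      have hX' : vertProj I' g φ p X = 0 := by
        refine eq_of_inner_vertical_horizontal (I' := I') g φ (fun W hW ↦ ?_) fun Y hY ↦ ?_
        · rw [inner_vertProj _ _ _ _ hW, g.symm, hX W hW]
          simp
        · rw [hY _ (vertProj_mem g φ p X)]
          simp
      have hUX : vertProj I' g φ p (U + X) = U := by
        rw [map_add, vertProj_of_mem g φ p hU, hX', add_zero]
      have hUX' : horProj I' g φ p (U + X) = X := by
        have := vertProj_add_horProj (I' := I') g φ p (U + X)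
        rwa [hUX, add_right_inj] at this
      have h2 : vertForm g g' φ p (U + X) (U + X) = g.inner p U U := by
        rw [hφ.vertForm_self_eq, hUX]
      change secondForm g g' φ p (vertProj I' g φ p (U + X)) (vertProj I' g φ p (U + X))
        (horProj I' g φ p (U + X)) + mvfderiv I ψ p (U + X) * vertForm g g' φ p (U + X) (U + X)
          = 0 at h1
      rwa [hUX, hUX', h2] at h1
  · intro h
    refine ⟨fun p ↦ Real.exp_pos _, fun c s hs hsc hc hvel t₁ ht₁ t₂ ht₂ ↦ ?_⟩
    have hpre : IsPreconnected s := hsc.isPreconnected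
    have hd1 : ∀ t ∈ s, HasDerivAt (fun τ ↦ Real.exp (2 * ψ (c τ)) *
        vertForm g g' φ (c τ) (velocity I c τ) (velocity I c τ)) 0 t := by
      intro t ht
      refine (hφ.hasDerivAt_exp_mul_vertForm hψ hs hc ht).congr_deriv ?_
      have h1 := h (c t) _ (vertProj_mem g φ _ (velocity I c t)) _
        (horProj_mem g φ _ (velocity I c t))
      rw [vertProj_add_horProj, ← hφ.vertForm_self_eq] at h1
      rw [h1, mul_zero]
    have hd2 : ∀ t ∈ s, HasDerivAt (fun τ ↦ g.inner (c τ) (velocity I c τ) (velocity I c τ)) 0 t :=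
      fun t ht ↦ hc.hasDerivAt_metric hs ht
    have e1 := hs.is_const_of_deriv_eq_zero hpre
      (fun t ht ↦ (hd1 t ht).differentiableAt.differentiableWithinAt)
      (fun t ht ↦ (hd1 t ht).deriv) ht₁ ht₂
    have e2 := hs.is_const_of_deriv_eq_zero hpre
      (fun t ht ↦ (hd2 t ht).differentiableAt.differentiableWithinAt)
      (fun t ht ↦ (hd2 t ht).deriv) ht₁ ht₂
    dsimp only at e1 e2 ⊢
    rw [hφ.exp_mul_sin_angle _ (hvel t₁ ht₁), hφ.exp_mul_sin_angle _ (hvel t₂ ht₂), e1, e2]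

end IsRiemannianSubmersion

end ClairautCondition

/-! ### Warped products -/

section Warped

variable
  {E₁ : Type*} [NormedAddCommGroup E₁] [NormedSpace ℝ E₁] [FiniteDimensional ℝ E₁]
  {H₁ : Type*} [TopologicalSpace H₁] {I₁ : ModelWithCorners ℝ E₁ H₁}
  {M₁ : Type*} [TopologicalSpace M₁] [ChartedSpace H₁ M₁] [IsManifold I₁ ∞ M₁]
  {E₂ : Type*} [NormedAddCommGroup E₂] [NormedSpace ℝ E₂] [FiniteDimensional ℝ E₂]
  {H₂ : Type*} [TopologicalSpace H₂] {I₂ : ModelWithCorners ℝ E₂ H₂}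
  {M₂ : Type*} [TopologicalSpace M₂] [ChartedSpace H₂ M₂] [IsManifold I₂ ∞ M₂]
  {E₁' : Type*} [NormedAddCommGroup E₁'] [NormedSpace ℝ E₁'] [FiniteDimensional ℝ E₁']
  {H₁' : Type*} [TopologicalSpace H₁'] {I₁' : ModelWithCorners ℝ E₁' H₁'}
  {N₁ : Type*} [TopologicalSpace N₁] [ChartedSpace H₁' N₁] [IsManifold I₁' ∞ N₁]
  {E₂' : Type*} [NormedAddCommGroup E₂'] [NormedSpace ℝ E₂'] [FiniteDimensional ℝ E₂']
  {H₂' : Type*} [TopologicalSpace H₂'] {I₂' : ModelWithCorners ℝ E₂' H₂'}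
  {N₂ : Type*} [TopologicalSpace N₂] [ChartedSpace H₂' N₂] [IsManifold I₂' ∞ N₂]

/-- The tangent vector to `M₁ × M₂` with components `a` and `b`. -/
def tangentPair (p : M₁ × M₂) (a : TangentSpace I₁ p.1) (b : TangentSpace I₂ p.2) :
    TangentSpace (I₁.prod I₂) p :=
  ((a, b) : E₁ × E₂)

lemma exists_eq_tangentPair {p : M₁ × M₂} (v : TangentSpace (I₁.prod I₂) p) :
    ∃ (a : TangentSpace I₁ p.1) (b : TangentSpace I₂ p.2), v = tangentPair p a b :=
  ⟨v.1, v.2, rfl⟩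

lemma tangentPair_add (p : M₁ × M₂) (a a' : TangentSpace I₁ p.1) (b b' : TangentSpace I₂ p.2) :
    tangentPair p a b + tangentPair p a' b' = tangentPair p (a + a') (b + b') := rfl

lemma tangentPair_eq_zero {p : M₁ × M₂} {a : TangentSpace I₁ p.1} {b : TangentSpace I₂ p.2} :
    tangentPair p a b = 0 ↔ a = 0 ∧ b = 0 :=
  Prod.mk_eq_zero

lemma warpedMetric_tangentPair (g₁ : Metric I₁ M₁) (g₂ : Metric I₂ M₂) (f : WarpingFunction I₁ M₁)
    (p : M₁ × M₂) (a a' : TangentSpace I₁ p.1) (b b' : TangentSpace I₂ p.2) :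
    (warpedMetric g₁ g₂ f).inner p (tangentPair p a b) (tangentPair p a' b')
      = g₁.inner p.1 a a' + f.toFun p.1 ^ 2 * g₂.inner p.2 b b' :=
  warpedInner_apply g₁ g₂ f p _ _

lemma mfderiv_prodMap_tangentPair {φ₁ : M₁ → N₁} {φ₂ : M₂ → N₂} (h₁ : ContMDiff I₁ I₁' ∞ φ₁)
    (h₂ : ContMDiff I₂ I₂' ∞ φ₂) (p : M₁ × M₂) (a : TangentSpace I₁ p.1) (b : TangentSpace I₂ p.2) :
    mfderiv (I₁.prod I₂) (I₁'.prod I₂') (Prod.map φ₁ φ₂) p (tangentPair p a b)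
      = tangentPair (Prod.map φ₁ φ₂ p) (mfderiv I₁ I₁' φ₁ p.1 a) (mfderiv I₂ I₂' φ₂ p.2 b) := by
  rw [mfderiv_prodMap (h₁.mdifferentiable (by simp) _) (h₂.mdifferentiable (by simp) _)]
  rfl

lemma tangentPair_mem_vertical {φ₁ : M₁ → N₁} {φ₂ : M₂ → N₂} (h₁ : ContMDiff I₁ I₁' ∞ φ₁)
    (h₂ : ContMDiff I₂ I₂' ∞ φ₂) {p : M₁ × M₂} {a : TangentSpace I₁ p.1} {b : TangentSpace I₂ p.2} :
    tangentPair p a b ∈ vertical (I₁.prod I₂) (I₁'.prod I₂') (Prod.map φ₁ φ₂) p ↔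
      a ∈ vertical I₁ I₁' φ₁ p.1 ∧ b ∈ vertical I₂ I₂' φ₂ p.2 := by
  change mfderiv (I₁.prod I₂) (I₁'.prod I₂') (Prod.map φ₁ φ₂) p (tangentPair p a b) = 0 ↔ _
  rw [mfderiv_prodMap_tangentPair h₁ h₂, tangentPair_eq_zero]
  rfl

lemma tangentPair_mem_horizontal (g₁ : Metric I₁ M₁) (g₂ : Metric I₂ M₂) (f : WarpingFunction I₁ M₁)
    {φ₁ : M₁ → N₁} {φ₂ : M₂ → N₂} (h₁ : ContMDiff I₁ I₁' ∞ φ₁)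
    (h₂ : ContMDiff I₂ I₂' ∞ φ₂) {p : M₁ × M₂} {a : TangentSpace I₁ p.1} {b : TangentSpace I₂ p.2} :
    tangentPair p a b ∈ horizontal (I₁'.prod I₂') (warpedMetric g₁ g₂ f) (Prod.map φ₁ φ₂) p ↔
      a ∈ horizontal I₁' g₁ φ₁ p.1 ∧ b ∈ horizontal I₂' g₂ φ₂ p.2 := by
  have hf := (pow_pos (f.pos p.1) 2).ne'
  constructor
  · intro h
    refine ⟨fun u hu ↦ ?_, fun u hu ↦ ?_⟩
    · have h3 := h _ ((tangentPair_mem_vertical h₁ h₂).2 ⟨hu, Submodule.zero_mem _⟩)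
      rw [warpedMetric_tangentPair] at h3
      simpa using h3
    · have h3 := h _ ((tangentPair_mem_vertical h₁ h₂).2 ⟨Submodule.zero_mem _, hu⟩)
      rw [warpedMetric_tangentPair] at h3
      simpa [hf] using h3
  · rintro ⟨ha, hb⟩ u hu
    obtain ⟨u₁, u₂, rfl⟩ := exists_eq_tangentPair u
    obtain ⟨hu₁, hu₂⟩ := (tangentPair_mem_vertical h₁ h₂).1 hu
    rw [warpedMetric_tangentPair, ha _ hu₁, hb _ hu₂]
    simp

lemma vertForm_tangentPair {g₁ : Metric I₁ M₁} {g₂ : Metric I₂ M₂} {f : WarpingFunction I₁ M₁}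
    {g₁' : Metric I₁' N₁} {g₂' : Metric I₂' N₂} {ρ : WarpingFunction I₁' N₁}
    {φ₁ : M₁ → N₁} {φ₂ : M₂ → N₂}
    (hφ : IsRiemannianWarpedProductSubmersion g₁ g₂ f g₁' g₂' ρ φ₁ φ₂) (p : M₁ × M₂)
    (a a' : TangentSpace I₁ p.1) (b b' : TangentSpace I₂ p.2) :
    vertForm (warpedMetric g₁ g₂ f) (warpedMetric g₁' g₂' ρ) (Prod.map φ₁ φ₂) p
        (tangentPair p a b) (tangentPair p a' b')
      = vertForm g₁ g₁' φ₁ p.1 a a' + f.toFun p.1 ^ 2 * vertForm g₂ g₂' φ₂ p.2 b b' := by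
  rw [vertForm_apply, mfderiv_prodMap_tangentPair hφ.left.contMDiff hφ.right.contMDiff,
    mfderiv_prodMap_tangentPair hφ.left.contMDiff hφ.right.contMDiff, warpedMetric_tangentPair,
    warpedMetric_tangentPair, vertForm_apply, vertForm_apply, hφ.warping]
  simp only [Prod.map_fst, Prod.map_snd]
  ring

lemma IsRiemannianWarpedProductSubmersion.isRiemannianSubmersion {g₁ : Metric I₁ M₁}
    {g₂ : Metric I₂ M₂} {f : WarpingFunction I₁ M₁}
    {g₁' : Metric I₁' N₁} {g₂' : Metric I₂' N₂} {ρ : WarpingFunction I₁' N₁}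
    {φ₁ : M₁ → N₁} {φ₂ : M₂ → N₂}
    (hφ : IsRiemannianWarpedProductSubmersion g₁ g₂ f g₁' g₂' ρ φ₁ φ₂) :
    IsRiemannianSubmersion (warpedMetric g₁ g₂ f) (warpedMetric g₁' g₂' ρ) (Prod.map φ₁ φ₂) where
  contMDiff := hφ.left.contMDiff.prodMap hφ.right.contMDiff
  surjective := hφ.left.surjective.prodMap hφ.right.surjective
  mfderiv_surjective p w := by
    obtain ⟨w₁, w₂, rfl⟩ := exists_eq_tangentPair w
    obtain ⟨a, ha⟩ := hφ.left.mfderiv_surjective p.1 w₁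
    obtain ⟨b, hb⟩ := hφ.right.mfderiv_surjective p.2 w₂
    refine ⟨tangentPair p a b, ?_⟩
    rw [mfderiv_prodMap_tangentPair hφ.left.contMDiff hφ.right.contMDiff, ha, hb]
  length_eq p v hv := by
    obtain ⟨a, b, rfl⟩ := exists_eq_tangentPair v
    obtain ⟨ha, hb⟩ :=
      (tangentPair_mem_horizontal g₁ g₂ f hφ.left.contMDiff hφ.right.contMDiff).1 hv
    have h := vertForm_tangentPair hφ p a a b b
    rw [hφ.left.vertForm_of_horizontal ha, hφ.right.vertForm_of_horizontal hb, mul_zero, add_zero,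
      vertForm_apply, sub_eq_zero] at h
    rw [length, length, h]

section Charts

variable [I₁.Boundaryless] [I₂.Boundaryless]

lemma chartFrame_prod {p : M₁ × M₂} {u : E₁ × E₂} (hu : u ∈ (extChartAt (I₁.prod I₂) p).target)
    (a : E₁ × E₂) :
    chartFrame (I₁.prod I₂) p u a
      = ((chartFrame I₁ p.1 u.1 a.1, chartFrame I₂ p.2 u.2 a.2) : E₁ × E₂) := by
  have hu' : u.1 ∈ (extChartAt I₁ p.1).target ∧ u.2 ∈ (extChartAt I₂ p.2).target := by
    rwa [extChartAt_prod, PartialEquiv.prod_target, mem_prod] at hu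
  have hd := mdifferentiableAt_extChartAt_symm hu
  have e₁ : mfderiv 𝓘(ℝ, E₁ × E₂) I₁ (fun x : E₁ × E₂ ↦ (extChartAt I₁ p.1).symm x.1) u a
      = chartFrame I₁ p.1 u.1 a.1 := by
    have h := mfderiv_comp (I := 𝓘(ℝ, E₁ × E₂)) (I' := 𝓘(ℝ, E₁)) (I'' := I₁) u
      (mdifferentiableAt_extChartAt_symm hu'.1) differentiableAt_fst.mdifferentiableAt
    rw [mfderiv_eq_fderiv, fderiv_fst] at h
    exact congrArg (fun L : E₁ × E₂ →L[ℝ] E₁ ↦ L a) h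
  have e₂ : mfderiv 𝓘(ℝ, E₁ × E₂) I₂ (fun x : E₁ × E₂ ↦ (extChartAt I₂ p.2).symm x.2) u a
      = chartFrame I₂ p.2 u.2 a.2 := by
    have h := mfderiv_comp (I := 𝓘(ℝ, E₁ × E₂)) (I' := 𝓘(ℝ, E₂)) (I'' := I₂) u
      (mdifferentiableAt_extChartAt_symm hu'.2) differentiableAt_snd.mdifferentiableAt
    rw [mfderiv_eq_fderiv, fderiv_snd] at h
    exact congrArg (fun L : E₁ × E₂ →L[ℝ] E₂ ↦ L a) h
  have k₁ := mfderiv_comp (I := 𝓘(ℝ, E₁ × E₂)) (I' := I₁.prod I₂) (I'' := I₁) u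
    mdifferentiableAt_fst hd
  have k₂ := mfderiv_comp (I := 𝓘(ℝ, E₁ × E₂)) (I' := I₁.prod I₂) (I'' := I₂) u
    mdifferentiableAt_snd hd
  rw [mfderiv_fst] at k₁
  rw [mfderiv_snd] at k₂
  refine Prod.ext ?_ ?_
  · exact (congrArg (fun L : E₁ × E₂ →L[ℝ] E₁ ↦ L a) k₁).symm.trans e₁
  · exact (congrArg (fun L : E₁ × E₂ →L[ℝ] E₂ ↦ L a) k₂).symm.trans e₂

lemma chartForm_vertForm_prod {g₁ : Metric I₁ M₁} {g₂ : Metric I₂ M₂} {f : WarpingFunction I₁ M₁}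
    {g₁' : Metric I₁' N₁} {g₂' : Metric I₂' N₂} {ρ : WarpingFunction I₁' N₁}
    {φ₁ : M₁ → N₁} {φ₂ : M₂ → N₂}
    (hφ : IsRiemannianWarpedProductSubmersion g₁ g₂ f g₁' g₂' ρ φ₁ φ₂) (p : M₁ × M₂) {u : E₁ × E₂}
    (hu : u ∈ (extChartAt (I₁.prod I₂) p).target) (a b : E₁ × E₂) :
    chartForm (vertForm (warpedMetric g₁ g₂ f) (warpedMetric g₁' g₂' ρ) (Prod.map φ₁ φ₂)) p u a b
      = chartForm (vertForm g₁ g₁' φ₁) p.1 u.1 a.1 b.1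
        + f.toFun ((extChartAt I₁ p.1).symm u.1) ^ 2
          * chartForm (vertForm g₂ g₂' φ₂) p.2 u.2 a.2 b.2 := by
  rw [chartForm_apply, chartFrame_prod hu, chartFrame_prod hu]
  exact vertForm_tangentPair hφ ((extChartAt I₁ p.1).symm u.1, (extChartAt I₂ p.2).symm u.2)
    _ _ _ _

end Charts

/-- The derivative of a field of forms which has the shape of a warped product. -/
lemma fderiv_warpedForm {P : E₁ × E₂ → E₁ × E₂ →L[ℝ] E₁ × E₂ →L[ℝ] ℝ}
    {P₁ : E₁ → E₁ →L[ℝ] E₁ →L[ℝ] ℝ} {P₂ : E₂ → E₂ →L[ℝ] E₂ →L[ℝ] ℝ} {F : E₁ → ℝ} {u : E₁ × E₂}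
    (hP : DifferentiableAt ℝ P u) (hP₁ : DifferentiableAt ℝ P₁ u.1)
    (hP₂ : DifferentiableAt ℝ P₂ u.2) (hF : DifferentiableAt ℝ F u.1)
    (h : ∀ᶠ x in 𝓝 u, ∀ a b, P x a b = P₁ x.1 a.1 b.1 + F x.1 * P₂ x.2 a.2 b.2)
    (c a b : E₁ × E₂) :
    fderiv ℝ P u c a b = fderiv ℝ P₁ u.1 c.1 a.1 b.1
      + (fderiv ℝ F u.1 c.1 * P₂ u.2 a.2 b.2 + F u.1 * fderiv ℝ P₂ u.2 c.2 a.2 b.2) := by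
  have h1 : HasFDerivAt (fun x ↦ P x a b) _ u :=
    (hP.hasFDerivAt.clm_apply (hasFDerivAt_const a u)).clm_apply (hasFDerivAt_const b u)
  have k₁ : HasFDerivAt (fun x : E₁ × E₂ ↦ P₁ x.1) (fderiv ℝ P₁ u.1 ∘L .fst ℝ E₁ E₂) u :=
    hP₁.hasFDerivAt.comp u hasFDerivAt_fst
  have k₂ : HasFDerivAt (fun x : E₁ × E₂ ↦ P₂ x.2) (fderiv ℝ P₂ u.2 ∘L .snd ℝ E₁ E₂) u :=
    hP₂.hasFDerivAt.comp u hasFDerivAt_snd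
  have k₃ : HasFDerivAt (fun x : E₁ × E₂ ↦ F x.1) (fderiv ℝ F u.1 ∘L .fst ℝ E₁ E₂) u :=
    hF.hasFDerivAt.comp u hasFDerivAt_fst
  have h2 : HasFDerivAt (fun x : E₁ × E₂ ↦ P₁ x.1 a.1 b.1 + F x.1 * P₂ x.2 a.2 b.2) _ u :=
    ((k₁.clm_apply (hasFDerivAt_const a.1 u)).clm_apply (hasFDerivAt_const b.1 u)).add
      (k₃.mul ((k₂.clm_apply (hasFDerivAt_const a.2 u)).clm_apply (hasFDerivAt_const b.2 u)))
  have h3 : (fun x ↦ P x a b) =ᶠ[𝓝 u] fun x ↦ P₁ x.1 a.1 b.1 + F x.1 * P₂ x.2 a.2 b.2 := by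
    filter_upwards [h] with x hx using hx a b
  have h4 := congrArg (fun L : E₁ × E₂ →L[ℝ] ℝ ↦ L c) (h1.unique (h2.congr_of_eventuallyEq h3))
  simp at h4
  linarith

/-- First-kind Christoffel symbols of a field of forms which has the shape of a warped product. -/
lemma firstKind_warpedForm {P : E₁ × E₂ → E₁ × E₂ →L[ℝ] E₁ × E₂ →L[ℝ] ℝ}
    {P₁ : E₁ → E₁ →L[ℝ] E₁ →L[ℝ] ℝ} {P₂ : E₂ → E₂ →L[ℝ] E₂ →L[ℝ] ℝ} {F : E₁ → ℝ} {u : E₁ × E₂}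
    (hP : DifferentiableAt ℝ P u) (hP₁ : DifferentiableAt ℝ P₁ u.1)
    (hP₂ : DifferentiableAt ℝ P₂ u.2) (hF : DifferentiableAt ℝ F u.1)
    (h : ∀ᶠ x in 𝓝 u, ∀ a b, P x a b = P₁ x.1 a.1 b.1 + F x.1 * P₂ x.2 a.2 b.2)
    (a₁ b₁ : E₁) {a₂ b₂ : E₂} (h₀ : P₂ u.2 a₂ b₂ = 0) :
    firstKind P u (a₁, a₂) (a₁, a₂) (b₁, b₂) = firstKind P₁ u.1 a₁ a₁ b₁
      + F u.1 * firstKind P₂ u.2 a₂ a₂ b₂ - 1 / 2 * (fderiv ℝ F u.1 b₁ * P₂ u.2 a₂ a₂) := by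
  simp only [firstKind, fderiv_warpedForm hP hP₁ hP₂ hF h, h₀]
  ring

lemma hasFDerivAt_comp_extChartAt_symm [I₁.Boundaryless] {ψ : M₁ → ℝ}
    (hψ : ContMDiff I₁ 𝓘(ℝ, ℝ) ∞ ψ) (p : M₁) :
    HasFDerivAt (fun u ↦ ψ ((extChartAt I₁ p).symm u)) (mvfderiv I₁ ψ p : E₁ →L[ℝ] ℝ)
      (extChartAt I₁ p p) := by
  have h : HasFDerivWithinAt (fun u ↦ ψ ((extChartAt I₁ p).symm u))
      (mvfderiv I₁ ψ p : E₁ →L[ℝ] ℝ) (range I₁) (extChartAt I₁ p p) :=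
    (hψ.mdifferentiable (by simp) p).hasMFDerivAt.2
  rw [I₁.range_eq_univ] at h
  exact hasFDerivWithinAt_univ.1 h

variable [I₁.Boundaryless] [I₂.Boundaryless] [I₁'.Boundaryless] [I₂'.Boundaryless]

lemma contMDiff_log_warping (f : WarpingFunction I₁ M₁) :
    ContMDiff I₁ 𝓘(ℝ, ℝ) ∞ fun y ↦ Real.log (f.toFun y) := fun x ↦
  ((Real.contDiffAt_log (n := ∞)).2 (f.pos x).ne').contMDiffAt.comp x (f.contMDiff x)

/-- The second fundamental form of the fibers of a warped product submersion, for vertical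
`(u₁, u₂)` and horizontal `(x₁, x₂)`. -/
lemma IsRiemannianWarpedProductSubmersion.secondForm_tangentPair {g₁ : Metric I₁ M₁}
    {g₂ : Metric I₂ M₂} {f : WarpingFunction I₁ M₁}
    {g₁' : Metric I₁' N₁} {g₂' : Metric I₂' N₂} {ρ : WarpingFunction I₁' N₁}
    {φ₁ : M₁ → N₁} {φ₂ : M₂ → N₂}
    (hφ : IsRiemannianWarpedProductSubmersion g₁ g₂ f g₁' g₂' ρ φ₁ φ₂) (p : M₁ × M₂)
    (u₁ x₁ : TangentSpace I₁ p.1) {u₂ x₂ : TangentSpace I₂ p.2}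
    (hu₂ : u₂ ∈ vertical I₂ I₂' φ₂ p.2) (hx₂ : x₂ ∈ horizontal I₂' g₂ φ₂ p.2) :
    secondForm (warpedMetric g₁ g₂ f) (warpedMetric g₁' g₂' ρ) (Prod.map φ₁ φ₂) p
        (tangentPair p u₁ u₂) (tangentPair p u₁ u₂) (tangentPair p x₁ x₂)
      = secondForm g₁ g₁' φ₁ p.1 u₁ u₁ x₁ + f.toFun p.1 ^ 2 *
        (secondForm g₂ g₂' φ₂ p.2 u₂ u₂ x₂
          - mvfderiv I₁ (fun y ↦ Real.log (f.toFun y)) p.1 x₁ * g₂.inner p.2 u₂ u₂) := by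
  have hu := mem_extChartAt_target (I := I₁.prod I₂) p
  obtain ⟨D, hD⟩ : ∃ D : E₁ →L[ℝ] ℝ, D = mvfderiv I₁ (fun y ↦ Real.log (f.toFun y)) p.1 :=
    ⟨_, rfl⟩
  have hlog : HasFDerivAt (fun u ↦ Real.log (f.toFun ((extChartAt I₁ p.1).symm u))) D
      (extChartAt I₁ p.1 p.1) := by
    rw [hD]
    exact hasFDerivAt_comp_extChartAt_symm (contMDiff_log_warping f) p.1
  have hF : HasFDerivAt (fun u ↦ f.toFun ((extChartAt I₁ p.1).symm u) ^ 2)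
      (f.toFun p.1 ^ 2 • (2 : ℝ) • D) (extChartAt I₁ p.1 p.1) := by
    -- `f² = exp (2 ln f)`
    have h1 := (hlog.const_mul 2).exp
    have h2 : ∀ x, Real.exp (2 * Real.log (f.toFun x)) = f.toFun x ^ 2 := by
      intro x
      rw [two_mul, Real.exp_add, Real.exp_log (f.pos x), sq]
    simp only [h2, extChartAt_to_inv] at h1
    exact h1
  have e1 : chartForm (vertForm g₂ g₂' φ₂) p.2 (extChartAt I₂ p.2 p.2) (u₂ : E₂) (x₂ : E₂) = 0 := by
    refine (chartForm_self _ p.2 u₂ x₂).trans ?_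
    rw [vertForm_symm]
    exact hφ.right.vertForm_of_horizontal hx₂ _
  have e2 : chartForm (vertForm g₂ g₂' φ₂) p.2 (extChartAt I₂ p.2 p.2) (u₂ : E₂) (u₂ : E₂)
      = g₂.inner p.2 u₂ u₂ :=
    (chartForm_self _ p.2 u₂ u₂).trans (vertForm_of_vertical _ _ _ _ hu₂ _)
  have e3 : f.toFun ((extChartAt I₁ p.1).symm (extChartAt I₁ p.1 p.1)) = f.toFun p.1 := by
    rw [extChartAt_to_inv]
  have e4 : fderiv ℝ (fun u ↦ f.toFun ((extChartAt I₁ p.1).symm u) ^ 2) (extChartAt I₁ p.1 p.1) x₁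
      = f.toFun p.1 ^ 2 * (2 * mvfderiv I₁ (fun y ↦ Real.log (f.toFun y)) p.1 x₁) := by
    rw [hF.fderiv, hD]
    rfl
  have key : secondForm (warpedMetric g₁ g₂ f) (warpedMetric g₁' g₂' ρ) (Prod.map φ₁ φ₂) p
        (tangentPair p u₁ u₂) (tangentPair p u₁ u₂) (tangentPair p x₁ x₂)
      = secondForm g₁ g₁' φ₁ p.1 u₁ u₁ x₁
        + f.toFun ((extChartAt I₁ p.1).symm (extChartAt I₁ p.1 p.1)) ^ 2 *
          secondForm g₂ g₂' φ₂ p.2 u₂ u₂ x₂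
        - 1 / 2 * (fderiv ℝ (fun u ↦ f.toFun ((extChartAt I₁ p.1).symm u) ^ 2)
            (extChartAt I₁ p.1 p.1) x₁ *
          chartForm (vertForm g₂ g₂' φ₂) p.2 (extChartAt I₂ p.2 p.2) u₂ u₂) :=
    firstKind_warpedForm (u := extChartAt (I₁.prod I₂) p p)
      (hφ.isRiemannianSubmersion.differentiableAt_chartForm_vertForm hu)
      (hφ.left.differentiableAt_chartForm_vertForm (mem_extChartAt_target p.1))
      (hφ.right.differentiableAt_chartForm_vertForm (mem_extChartAt_target p.2))
      hF.differentiableAt (by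
        filter_upwards [(isOpen_extChartAt_target p).mem_nhds hu] with x hx
        exact chartForm_vertForm_prod hφ p hx) u₁ x₁ e1
  refine key.trans ((congr (congrArg₂ (fun c a b : ℝ ↦ secondForm g₁ g₁' φ₁ p.1 u₁ u₁ x₁ +
    c ^ 2 * secondForm g₂ g₂' φ₂ p.2 u₂ u₂ x₂ - 1 / 2 * (a * b)) e3 e4) e2).trans ?_)
  ring

end Warped

/-! ### Clairaut warped product submersions -/

section Fibers

variable {E : Type*} [NormedAddCommGroup E] [NormedSpace ℝ E] [FiniteDimensional ℝ E]
  {H : Type*} [TopologicalSpace H] {I : ModelWithCorners ℝ E H}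
  {M : Type*} [TopologicalSpace M] [ChartedSpace H M] [IsManifold I ∞ M]
  {E' : Type*} [NormedAddCommGroup E'] [NormedSpace ℝ E'] [FiniteDimensional ℝ E']
  {H' : Type*} [TopologicalSpace H'] {I' : ModelWithCorners ℝ E' H'}
  {N : Type*} [TopologicalSpace N] [ChartedSpace H' N] [IsManifold I' ∞ N]

lemma exists_vertical_ne_zero (h : Module.finrank ℝ E' < Module.finrank ℝ E) (φ : M → N) (p : M) :
    ∃ U ∈ vertical I I' φ p, U ≠ 0 := by
  have : FiniteDimensional ℝ (TangentSpace I p) := inferInstanceAs (FiniteDimensional ℝ E)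
  have : FiniteDimensional ℝ (TangentSpace I' (φ p)) := inferInstanceAs (FiniteDimensional ℝ E')
  exact (Submodule.ne_bot_iff _).1 (LinearMap.ker_ne_bot_of_finrank_lt h)

lemma secondForm_zero_zero (g : Metric I M) (g' : Metric I' N) (φ : M → N) (p : M)
    (x : TangentSpace I p) : secondForm g g' φ p 0 0 x = 0 := by
  have h : ∀ c : E, firstKind (chartForm (vertForm g g' φ) p) (extChartAt I p p) 0 0 c = 0 := by
    intro c
    simp [firstKind]
  exact h x

lemma exists_eq_add_vertical_horizontal (g : Metric I M) (φ : M → N) {p : M}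
    (v : TangentSpace I p) :
    ∃ U ∈ vertical I I' φ p, ∃ X ∈ horizontal I' g φ p, v = U + X :=
  ⟨_, vertProj_mem g φ p v, _, horProj_mem g φ p v, (vertProj_add_horProj g φ p v).symm⟩

end Fibers

section Warped

variable
  {E₁ : Type*} [NormedAddCommGroup E₁] [NormedSpace ℝ E₁] [FiniteDimensional ℝ E₁]
  {H₁ : Type*} [TopologicalSpace H₁] {I₁ : ModelWithCorners ℝ E₁ H₁}
  {M₁ : Type*} [TopologicalSpace M₁] [ChartedSpace H₁ M₁] [IsManifold I₁ ∞ M₁]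
  {E₂ : Type*} [NormedAddCommGroup E₂] [NormedSpace ℝ E₂] [FiniteDimensional ℝ E₂]
  {H₂ : Type*} [TopologicalSpace H₂] {I₂ : ModelWithCorners ℝ E₂ H₂}
  {M₂ : Type*} [TopologicalSpace M₂] [ChartedSpace H₂ M₂] [IsManifold I₂ ∞ M₂]
  {E₁' : Type*} [NormedAddCommGroup E₁'] [NormedSpace ℝ E₁'] [FiniteDimensional ℝ E₁']
  {H₁' : Type*} [TopologicalSpace H₁'] {I₁' : ModelWithCorners ℝ E₁' H₁'}
  {N₁ : Type*} [TopologicalSpace N₁] [ChartedSpace H₁' N₁] [IsManifold I₁' ∞ N₁]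
  {E₂' : Type*} [NormedAddCommGroup E₂'] [NormedSpace ℝ E₂'] [FiniteDimensional ℝ E₂']
  {H₂' : Type*} [TopologicalSpace H₂'] {I₂' : ModelWithCorners ℝ E₂' H₂'}
  {N₂ : Type*} [TopologicalSpace N₂] [ChartedSpace H₂' N₂] [IsManifold I₂' ∞ N₂]
  [I₁.Boundaryless] [I₂.Boundaryless] [I₁'.Boundaryless] [I₂'.Boundaryless]
  {g₁ : Metric I₁ M₁} {g₂ : Metric I₂ M₂} {f : WarpingFunction I₁ M₁}
  {g₁' : Metric I₁' N₁} {g₂' : Metric I₂' N₂} {ρ : WarpingFunction I₁' N₁}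
  {φ₁ : M₁ → N₁} {φ₂ : M₂ → N₂}

namespace IsRiemannianWarpedProductSubmersion

/-- As `f = ρ ∘ φ₁`, the warping function is constant along the fibers. -/
lemma mvfderiv_log_warping_of_vertical
    (hφ : IsRiemannianWarpedProductSubmersion g₁ g₂ f g₁' g₂' ρ φ₁ φ₂)
    {x : M₁} {u : TangentSpace I₁ x} (hu : u ∈ vertical I₁ I₁' φ₁ x) :
    mvfderiv I₁ (fun y ↦ Real.log (f.toFun y)) x u = 0 := by
  have h1 : (fun y ↦ Real.log (f.toFun y)) = (fun z ↦ Real.log (ρ.toFun z)) ∘ φ₁ := by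
    funext y
    rw [Function.comp_apply, hφ.warping]
  rw [h1]
  have h := mfderiv_comp (I := I₁) (I' := I₁') (I'' := 𝓘(ℝ, ℝ)) x
    ((contMDiff_log_warping ρ).mdifferentiable (by simp) (φ₁ x))
    (hφ.left.contMDiff.mdifferentiable (by simp) x)
  have hu' : (mfderiv I₁ I₁' φ₁ x u : E₁') = 0 := hu
  have h2 := congrArg (fun L : E₁ →L[ℝ] ℝ ↦ L u) h
  refine h2.trans ?_
  refine (congrArg (fun w : E₁' ↦ (mfderiv I₁' 𝓘(ℝ, ℝ) (fun z ↦ Real.log (ρ.toFun z)) (φ₁ x) :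
    E₁' →L[ℝ] ℝ) w) hu').trans ?_
  exact map_zero _

/-- The infinitesimal Clairaut condition of a warped product submersion, separated into a condition
on `∇ψ` and conditions on the fibers of the two factors. -/
theorem isClairautWith_exp_iff_forall [Nonempty M₁] [Nonempty M₂]
    (hφ : IsRiemannianWarpedProductSubmersion g₁ g₂ f g₁' g₂' ρ φ₁ φ₂)
    (h₁ : Module.finrank ℝ E₁' < Module.finrank ℝ E₁)
    (h₂ : Module.finrank ℝ E₂' < Module.finrank ℝ E₂)
    {ψ : M₁ × M₂ → ℝ} (hψ : ContMDiff (I₁.prod I₂) 𝓘(ℝ, ℝ) ∞ ψ) :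
    IsClairautWith (I₁'.prod I₂') (warpedMetric g₁ g₂ f) (Prod.map φ₁ φ₂)
        (fun p ↦ Real.exp (ψ p)) ↔
      (∀ (p : M₁ × M₂) (a : TangentSpace I₁ p.1) (b : TangentSpace I₂ p.2),
        mvfderiv (I₁.prod I₂) ψ p (tangentPair p a b)
          = mvfderiv I₁ (fun y ↦ Real.log (f.toFun y)) p.1 a) ∧
      (∀ x, ∀ U ∈ vertical I₁ I₁' φ₁ x, ∀ X ∈ horizontal I₁' g₁ φ₁ x,
        secondForm g₁ g₁' φ₁ x U U X
          = -(g₁.inner x U U * mvfderiv I₁ (fun y ↦ Real.log (f.toFun y)) x X)) ∧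
      (∀ y, ∀ U ∈ vertical I₂ I₂' φ₂ y, ∀ X ∈ horizontal I₂' g₂ φ₂ y,
        secondForm g₂ g₂' φ₂ y U U X = 0) := by
  have hf : ∀ x, f.toFun x ^ 2 ≠ 0 := fun x ↦ (pow_pos (f.pos x) 2).ne'
  rw [hφ.isRiemannianSubmersion.isClairautWith_exp_iff hψ]
  constructor
  · intro h
    have key : ∀ (p : M₁ × M₂), ∀ u₁ ∈ vertical I₁ I₁' φ₁ p.1, ∀ u₂ ∈ vertical I₂ I₂' φ₂ p.2,
        ∀ x₁ ∈ horizontal I₁' g₁ φ₁ p.1, ∀ x₂ ∈ horizontal I₂' g₂ φ₂ p.2,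
        secondForm g₁ g₁' φ₁ p.1 u₁ u₁ x₁ + f.toFun p.1 ^ 2 * (secondForm g₂ g₂' φ₂ p.2 u₂ u₂ x₂
          - mvfderiv I₁ (fun y ↦ Real.log (f.toFun y)) p.1 x₁ * g₂.inner p.2 u₂ u₂)
        + mvfderiv (I₁.prod I₂) ψ p (tangentPair p (u₁ + x₁) (u₂ + x₂))
          * (g₁.inner p.1 u₁ u₁ + f.toFun p.1 ^ 2 * g₂.inner p.2 u₂ u₂) = 0 := by
      intro p u₁ hu₁ u₂ hu₂ x₁ hx₁ x₂ hx₂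
      have h3 := h p _ ((tangentPair_mem_vertical hφ.left.contMDiff hφ.right.contMDiff).2
        ⟨hu₁, hu₂⟩) _ ((tangentPair_mem_horizontal g₁ g₂ f hφ.left.contMDiff
          hφ.right.contMDiff).2 ⟨hx₁, hx₂⟩)
      rwa [hφ.secondForm_tangentPair p u₁ x₁ hu₂ hx₂, warpedMetric_tangentPair,
        tangentPair_add] at h3
    have hadd : ∀ (p : M₁ × M₂) (a : TangentSpace I₁ p.1) (b : TangentSpace I₂ p.2),
        mvfderiv (I₁.prod I₂) ψ p (tangentPair p a b)
          = mvfderiv (I₁.prod I₂) ψ p (tangentPair p a 0)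
            + mvfderiv (I₁.prod I₂) ψ p (tangentPair p 0 b) := by
      intro p a b
      rw [← map_add, tangentPair_add, add_zero, zero_add]
    have hadd₁ : ∀ (p : M₁ × M₂) (a a' : TangentSpace I₁ p.1),
        mvfderiv (I₁.prod I₂) ψ p (tangentPair p (a + a') 0)
          = mvfderiv (I₁.prod I₂) ψ p (tangentPair p a 0)
            + mvfderiv (I₁.prod I₂) ψ p (tangentPair p a' 0) := by
      intro p a a'
      rw [← map_add, tangentPair_add, add_zero]
    have hadd₂ : ∀ (p : M₁ × M₂) (b b' : TangentSpace I₂ p.2),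
        mvfderiv (I₁.prod I₂) ψ p (tangentPair p 0 (b + b'))
          = mvfderiv (I₁.prod I₂) ψ p (tangentPair p 0 b)
            + mvfderiv (I₁.prod I₂) ψ p (tangentPair p 0 b') := by
      intro p b b'
      rw [← map_add, tangentPair_add, add_zero]
    -- `(U, X) = ((u, 0), 0)` and `((0, u), 0)`: `dψ` vanishes on vertical vectors.
    have hV₁ : ∀ (p : M₁ × M₂), ∀ u ∈ vertical I₁ I₁' φ₁ p.1,
        mvfderiv (I₁.prod I₂) ψ p (tangentPair p u 0) = 0 := by
      intro p u hu
      rcases eq_or_ne u 0 with rfl | hne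
      · rw [tangentPair_eq_zero.2 ⟨rfl, rfl⟩, map_zero]
      have h3 := key p u hu 0 (zero_mem _) 0 (zero_mem _) 0 (zero_mem _)
      simpa [secondForm_zero, secondForm_zero_zero, (g₁.pos p.1 u hne).ne'] using h3
    have hV₂ : ∀ (p : M₁ × M₂), ∀ u ∈ vertical I₂ I₂' φ₂ p.2,
        mvfderiv (I₁.prod I₂) ψ p (tangentPair p 0 u) = 0 := by
      intro p u hu
      rcases eq_or_ne u 0 with rfl | hne
      · rw [tangentPair_eq_zero.2 ⟨rfl, rfl⟩, map_zero]
      have h3 := key p 0 (zero_mem _) u hu 0 (zero_mem _) 0 (zero_mem _)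
      simpa [secondForm_zero, secondForm_zero_zero, (g₂.pos p.2 u hne).ne', (f.pos p.1).ne']
        using h3
    -- `U = (u, 0)` with `u ≠ 0` and `X = (0, x)`: `dψ` vanishes on the second factor.
    have hH₂ : ∀ (p : M₁ × M₂), ∀ x ∈ horizontal I₂' g₂ φ₂ p.2,
        mvfderiv (I₁.prod I₂) ψ p (tangentPair p 0 x) = 0 := by
      intro p x hx
      obtain ⟨u, hu, hne⟩ := exists_vertical_ne_zero (I := I₁) (I' := I₁') h₁ φ₁ p.1
      have h3 := key p u hu 0 (zero_mem _) 0 (zero_mem _) x hx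
      simpa [secondForm_zero, secondForm_zero_zero, (g₁.pos p.1 u hne).ne', hadd p u x,
        hV₁ p u hu] using h3
    -- `U = (0, u)` with `u ≠ 0` and `X = (x, 0)`: `dψ` agrees with `d(ln f)` on the first factor.
    have hH₁ : ∀ (p : M₁ × M₂), ∀ x ∈ horizontal I₁' g₁ φ₁ p.1,
        mvfderiv (I₁.prod I₂) ψ p (tangentPair p x 0)
          = mvfderiv I₁ (fun y ↦ Real.log (f.toFun y)) p.1 x := by
      intro p x hx
      obtain ⟨u, hu, hne⟩ := exists_vertical_ne_zero (I := I₂) (I' := I₂') h₂ φ₂ p.2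
      have h3 := key p 0 (zero_mem _) u hu x hx 0 (zero_mem _)
      rw [zero_add, add_zero, hadd p x u, hV₂ p u hu, secondForm_zero, secondForm_zero_zero,
        map_zero] at h3
      have h4 := mul_ne_zero (hf p.1) (g₂.pos p.2 u hne).ne'
      refine mul_right_cancel₀ h4 ?_
      linarith
    have hdψ : ∀ (p : M₁ × M₂) (a : TangentSpace I₁ p.1) (b : TangentSpace I₂ p.2),
        mvfderiv (I₁.prod I₂) ψ p (tangentPair p a b)
          = mvfderiv I₁ (fun y ↦ Real.log (f.toFun y)) p.1 a := by
      intro p a b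
      obtain ⟨u, hu, x, hx, rfl⟩ := exists_eq_add_vertical_horizontal (I' := I₁') g₁ φ₁ a
      obtain ⟨u', hu', x', hx', rfl⟩ := exists_eq_add_vertical_horizontal (I' := I₂') g₂ φ₂ b
      rw [hadd, hadd₁, hadd₂, hV₁ p u hu, hV₂ p u' hu', hH₁ p x hx, hH₂ p x' hx', map_add,
        hφ.mvfderiv_log_warping_of_vertical hu, add_zero, add_zero]
    refine ⟨hdψ, fun x U hU X hX ↦ ?_, fun y U hU X hX ↦ ?_⟩
    · obtain ⟨y⟩ := ‹Nonempty M₂›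
      have h3 := key (x, y) U hU 0 (zero_mem _) X hX 0 (zero_mem _)
      rw [hdψ, secondForm_zero, map_add, hφ.mvfderiv_log_warping_of_vertical hU] at h3
      simp only [map_zero] at h3
      linarith
    · obtain ⟨x⟩ := ‹Nonempty M₁›
      have h3 := key (x, y) 0 (zero_mem _) U hU 0 (zero_mem _) X hX
      rw [hdψ, secondForm_zero, add_zero] at h3
      simp only [map_zero, zero_mul, sub_zero, zero_add, add_zero] at h3
      exact (mul_eq_zero.1 h3).resolve_left (hf x)
  · rintro ⟨hdψ, hS₁, hS₂⟩ p U hU X hX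
    obtain ⟨u₁, u₂, rfl⟩ := exists_eq_tangentPair U
    obtain ⟨x₁, x₂, rfl⟩ := exists_eq_tangentPair X
    obtain ⟨hu₁, hu₂⟩ := (tangentPair_mem_vertical hφ.left.contMDiff hφ.right.contMDiff).1 hU
    obtain ⟨hx₁, hx₂⟩ :=
      (tangentPair_mem_horizontal g₁ g₂ f hφ.left.contMDiff hφ.right.contMDiff).1 hX
    rw [hφ.secondForm_tangentPair p u₁ x₁ hu₂ hx₂, warpedMetric_tangentPair, tangentPair_add, hdψ,
      hS₁ _ _ hu₁ _ hx₁, hS₂ _ _ hu₂ _ hx₂, map_add, hφ.mvfderiv_log_warping_of_vertical hu₁]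
    ring

end IsRiemannianWarpedProductSubmersion

end Warped

end Clairaut

theorem theorem3p2 {m₁ m₂ n₁ n₂ : ℕ} (hn₁ : n₁ < m₁) (hn₂ : n₂ < m₂)
    {M₁ : Type*} [TopologicalSpace M₁] [T2Space M₁] [SecondCountableTopology M₁] [Nonempty M₁]
    [ChartedSpace (EuclideanSpace ℝ (Fin m₁)) M₁] [IsManifold (𝓡 m₁) ∞ M₁]
    {M₂ : Type*} [TopologicalSpace M₂] [T2Space M₂] [SecondCountableTopology M₂] [Nonempty M₂]
    [ChartedSpace (EuclideanSpace ℝ (Fin m₂)) M₂] [IsManifold (𝓡 m₂) ∞ M₂]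
    {N₁ : Type*} [TopologicalSpace N₁] [T2Space N₁] [SecondCountableTopology N₁]
    [ChartedSpace (EuclideanSpace ℝ (Fin n₁)) N₁] [IsManifold (𝓡 n₁) ∞ N₁]
    {N₂ : Type*} [TopologicalSpace N₂] [T2Space N₂] [SecondCountableTopology N₂]
    [ChartedSpace (EuclideanSpace ℝ (Fin n₂)) N₂] [IsManifold (𝓡 n₂) ∞ N₂]
    (g₁ : Clairaut.Metric (𝓡 m₁) M₁) (g₂ : Clairaut.Metric (𝓡 m₂) M₂)
    (g₁' : Clairaut.Metric (𝓡 n₁) N₁) (g₂' : Clairaut.Metric (𝓡 n₂) N₂)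
    (f : Clairaut.WarpingFunction (𝓡 m₁) M₁) (ρ : Clairaut.WarpingFunction (𝓡 n₁) N₁)
    (φ₁ : M₁ → N₁) (φ₂ : M₂ → N₂)
    (hφ : Clairaut.IsRiemannianWarpedProductSubmersion g₁ g₂ f g₁' g₂' ρ φ₁ φ₂)
    (hfib : ∀ q : N₁ × N₂, IsConnected (Prod.map φ₁ φ₂ ⁻¹' {q}))
    (ψ : M₁ × M₂ → ℝ) (hψ : ContMDiff ((𝓡 m₁).prod (𝓡 m₂)) 𝓘(ℝ, ℝ) ∞ ψ) :
    Clairaut.IsClairautWith ((𝓡 n₁).prod (𝓡 n₂)) (Clairaut.warpedMetric g₁ g₂ f)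
        (Prod.map φ₁ φ₂) (fun p ↦ Real.exp (ψ p)) ↔
      (∀ p : M₁ × M₂, Clairaut.grad (Clairaut.warpedMetric g₁ g₂ f) ψ p ∈
        Clairaut.horizontal ((𝓡 n₁).prod (𝓡 n₂)) (Clairaut.warpedMetric g₁ g₂ f)
          (Prod.map φ₁ φ₂) p) ∧
      (Clairaut.HasTotallyUmbilicalFibers (𝓡 n₁) g₁ φ₁ ∧
        (∀ p : M₁ × M₂, Clairaut.liftLeft p (Clairaut.meanCurvature (𝓡 n₁) g₁ φ₁ p.1) =
          -Clairaut.grad (Clairaut.warpedMetric g₁ g₂ f) ψ p) ∧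
        (∀ x : M₁, Clairaut.meanCurvature (𝓡 n₁) g₁ φ₁ x =
          -Clairaut.grad g₁ (fun y ↦ Real.log (f.toFun y)) x)) ∧
      Clairaut.HasTotallyGeodesicFibers (𝓡 n₂) g₂ φ₂ := by
  have hgrad : ∀ (x : M₁) (X : TangentSpace (𝓡 m₁) x),
      g₁.inner x (-Clairaut.grad g₁ (fun y ↦ Real.log (f.toFun y)) x) X
        = -mvfderiv (𝓡 m₁) (fun y ↦ Real.log (f.toFun y)) x X := by
    intro x X
    rw [map_neg, neg_apply, Clairaut.inner_grad]
  rw [hφ.isClairautWith_exp_iff_forall (by simpa using hn₁) (by simpa using hn₂) hψ,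
    hφ.right.hasTotallyGeodesicFibers_iff]
  constructor
  · rintro ⟨hdψ, hS₁, hS₂⟩
    -- `-∇ ln f` is horizontal, and is the mean curvature vector field of the fibers of `φ₁`
    have hZ : ∀ x, -Clairaut.grad g₁ (fun y ↦ Real.log (f.toFun y)) x
        ∈ Clairaut.horizontal (𝓡 n₁) g₁ φ₁ x := by
      intro x u hu
      rw [g₁.symm, hgrad, hφ.mvfderiv_log_warping_of_vertical hu, neg_zero]
    have hS : ∀ x, ∀ U ∈ Clairaut.vertical (𝓡 m₁) (𝓡 n₁) φ₁ x,
        ∀ X ∈ Clairaut.horizontal (𝓡 n₁) g₁ φ₁ x,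
        Clairaut.secondForm g₁ g₁' φ₁ x U U X = g₁.inner x U U *
          g₁.inner x (-Clairaut.grad g₁ (fun y ↦ Real.log (f.toFun y)) x) X := by
      intro x U hU X hX
      rw [hgrad, hS₁ x U hU X hX, mul_neg]
    have hmean : ∀ x, Clairaut.meanCurvature (𝓡 n₁) g₁ φ₁ x =
        -Clairaut.grad g₁ (fun y ↦ Real.log (f.toFun y)) x := fun x ↦
      hφ.left.meanCurvature_eq (hZ x) (hS x)
        (Clairaut.exists_vertical_ne_zero (by simpa using hn₁) φ₁ x)
    refine ⟨fun p u hu ↦ ?_, ⟨fun x U hU W hW ↦ ?_, fun p ↦ ?_, hmean⟩, hS₂⟩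
    · obtain ⟨u₁, u₂, rfl⟩ := Clairaut.exists_eq_tangentPair u
      have hu₁ := ((Clairaut.tangentPair_mem_vertical hφ.left.contMDiff
        hφ.right.contMDiff).1 hu).1
      rw [(Clairaut.warpedMetric g₁ g₂ f).symm, Clairaut.inner_grad, hdψ,
        hφ.mvfderiv_log_warping_of_vertical hu₁]
    · rw [hmean]
      exact hφ.left.oneillTAt_eq_smul (hZ x) (hS x) hU hW
    · refine Clairaut.eq_of_inner_eq (Clairaut.warpedMetric g₁ g₂ f) fun z ↦ ?_
      obtain ⟨z₁, z₂, rfl⟩ := Clairaut.exists_eq_tangentPair z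
      rw [map_neg, neg_apply, Clairaut.inner_grad, hdψ, ← hgrad, ← hmean]
      refine (Clairaut.warpedMetric_tangentPair g₁ g₂ f p _ z₁ 0 z₂).trans ?_
      simp
  · rintro ⟨-, ⟨humb, hlift, hmean⟩, hS₂⟩
    refine ⟨fun p a b ↦ ?_, fun x U hU X hX ↦ ?_, hS₂⟩
    · have h : (Clairaut.warpedMetric g₁ g₂ f).inner p
          (Clairaut.liftLeft p (Clairaut.meanCurvature (𝓡 n₁) g₁ φ₁ p.1))
          (Clairaut.tangentPair p a b)
            = g₁.inner p.1 (Clairaut.meanCurvature (𝓡 n₁) g₁ φ₁ p.1) a :=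
        (Clairaut.warpedMetric_tangentPair g₁ g₂ f p _ a 0 b).trans (by simp)
      rw [hlift, map_neg, neg_apply, Clairaut.inner_grad, hmean, hgrad] at h
      exact neg_injective h
    · rw [hφ.left.secondForm_of_umbilical humb hU hX, hmean, hgrad, mul_neg]
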